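/- Let $(S,\mathcal F)$ be a measurable space (for instance a Hausdorff space with its Borel $\sigma$-field) and let $P$ be a probability measure on it. Let $b_n>0$ $(n\ge 1)$ satisfy $b_n\to 0$, $nb_n^2\to\infty$, $b_n/b_{n+1}\to 1$, and let $k_n$ be natural numbers with $k_n/n\to\nu$ for some $0<\nu<\infty$. Logarithms take values in $[-\infty,\infty]$, with $\log 0=-\infty$. Let $\Phi$ be the set of measurable $f:S\to\mathbb R$ with $\int f^2\,dP<\infty$ and $$\lim_{n\to\infty}\frac{1}{nb_n^2}\log\bigl(n\,P(|f|>b_n^{-1})\bigr)=-\infty .$$ Let $\Lambda_\Phi$ be the set of probability measures $Q$ on $S$ with $\int|f|\,dQ<\infty$ for all $f\in\Phi$, and let $\Lambda_{0\Phi}$ be the set of finite signed measures $G$ on $S$ with $G(S)=0$ and $\int|f|\,d|G|<\infty$ for all $f\in\Phi$, where $|G|$ is the total variation of $G$. The $\tau_\Phi$-topology (the $\sigma_\Phi$-field) on $\Lambda_{0\Phi}$ is the coarsest topology (the smallest $\sigma$-field) for which all maps $G\mapsto\int f\,dG$, $f\in\Phi$, are continuous (measurable); $\Lambda_{0\Phi}^2=\Lambda_{0\Phi}\times\Lambda_{0\Phi}$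 carries the product topology and the product $\sigma$-field. Put $$\rho_0^2(G,P)=\tfrac12\int\Bigl(\frac{dG}{dP}\Bigr)^2dP\ \text{ if } G\ll P,\qquad \rho_0^2(G,P)=\infty\ \text{ otherwise},$$ and, for $(G_2,G_1)\in\Lambda_{0\Phi}^2$ and $A\subset\Lambda_{0\Phi}^2$, $$\rho_{0b}^2\bigl((G_2,G_1),P\bigr)=\nu\,\rho_0^2(G_2,P)+\rho_0^2(G_1,P),\qquad \rho_{0b}^2(A,P)=\inf_{\bar G\in A}\rho_{0b}^2(\bar G,P),\qquad \inf\emptyset=\infty .$$ Let $H,H_1,H_2,\ldots\in\Lambda_{0\Phi}$ be such that (A) $P_n:=P+b_nH_n\in\Lambda_\Phi$ and $P+b_nH\in\Lambda_\Phi$ for all $n\ge1$, and $H_n\to H$ in the $\tau_\Phi$-topology; (B1) for every $f\in\Phi$, $\displaystyle\limsup_{n\to\infty}\sup_{m\ge1}\frac{1}{nb_n^2}\log\Bigl(nb_n\,|H_m|\bigl(|f|>b_n^{-1}\bigr)\Bigr)=-\infty .$ For each $n$ let $X_1,\ldots,X_n$ be i.i.d. with law $P_n$ and empirical measure $\widehat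 P_n$; given $X_1,\ldots,X_n$, let $X_1^*,\ldots,X_{k_n}^*$ be i.i.d. with law $\widehat P_n$, and let $P^*_{k_n}$ be their empirical measure. Write $\mathbf P_n$ for the joint law of the two samples, and let $\widetilde H=(0,H)\in\Lambda_{0\Phi}^2$. Then, for every measurable set $\bar\Omega_0\subset\Lambda_{0\Phi}^2$, $$\liminf_{n\to\infty}\frac1{nb_n^2}\log\mathbf P_n\Bigl(\bigl(P^*_{k_n}-\widehat P_n,\ \widehat P_n-P\bigr)\in b_n\bar\Omega_0\Bigr)\ \ge\ -\rho_{0b}^2\bigl(\operatorname{int}(\bar\Omega_0-\widetilde H),P\bigr)$$ and $$\limsup_{n\to\infty}\frac1{nb_n^2}\log\mathbf P_n\Bigl(\bigl(P^*_{k_n}-\widehat P_n,\ \widehat P_n-P\bigr)\in b_n\bar\Omega_0\Bigr)\ \le\ -\rho_{0b}^2\bigl(\operatorname{cl}(\bar\Omega_0-\widetilde H),P\bigr),$$ where the interior and the closure are taken in the product $\tau_\Phi$-topology. In particular this holds for $k_n=n$, with $\nu=1$. -/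

import Mathlib

open MeasureTheory ProbabilityTheory Filter Topology
open scoped ENNReal

noncomputable section

namespace BootstrapMDP

variable {S : Type*} [MeasurableSpace S]

/-- `(n β²)⁻¹ log x`, with `log 0 = -∞`; the values are extended real numbers. -/
def scaledLog (n : ℕ) (β : ℝ) (x : ℝ≥0∞) : EReal :=
  ((((n : ℝ) * β ^ 2)⁻¹ : ℝ) : EReal) * ENNReal.log x

/-- The class `Φ` of test functions: measurable `f` with `∫ f² dP < ∞` and
`(n b_n²)⁻¹ log (n P(|f| > b_n⁻¹)) → -∞`. -/
def Phi (P : ProbabilityMeasure S) (b : ℕ → ℝ) : Set (S → ℝ) :=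
  {f | Measurable f ∧ MemLp f 2 (P : Measure S) ∧
    Tendsto (fun n : ℕ => scaledLog n (b n)
      ((n : ℝ≥0∞) * (P : Measure S) {x | (b n)⁻¹ < |f x|})) atTop (𝓝 ⊥)}

/-- `Λ_Φ`: the probability measures that integrate every `f ∈ Φ`. -/
def Lambda (Φ : Set (S → ℝ)) : Set (ProbabilityMeasure S) :=
  {Q | ∀ f ∈ Φ, Integrable f (Q : Measure S)}

/-- `Λ_{0Φ}`: the (finite) signed measures `G` with `G(S) = 0` and `∫ |f| d|G| < ∞` for all
`f ∈ Φ`, where `|G|` is the total variation measure. -/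
def Lambda0 (Φ : Set (S → ℝ)) : Submodule ℝ (SignedMeasure S) where
  carrier := {G | G Set.univ = 0 ∧ ∀ f ∈ Φ, Integrable f G.variation}
  zero_mem' := by
    refine ⟨by simp, fun f _ => ?_⟩
    simp
  add_mem' := by
    rintro G G' ⟨hG, hGf⟩ ⟨hG', hGf'⟩
    refine ⟨by simp [hG, hG'], fun f hf => ?_⟩
    exact VectorMeasure.Integrable.add_vectorMeasure (hGf f hf) (hGf' f hf)
  smul_mem' := by
    rintro c G ⟨hG, hGf⟩
    refine ⟨by simp [hG], fun f hf => ?_⟩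
    exact VectorMeasure.Integrable.smul_vectorMeasure (hGf f hf) c

/-- The family `(∫ f dG)_{f ∈ Φ}` of integrals with respect to the signed measure `G`. -/
def pairing (Φ : Set (S → ℝ)) (G : Lambda0 Φ) : Φ → ℝ :=
  fun f => VectorMeasure.integral (G : SignedMeasure S) (f : S → ℝ) (ContinuousLinearMap.lsmul ℝ ℝ)

/-- The `τ_Φ`-topology: the coarsest one for which `G ↦ ∫ f dG` is continuous for all `f ∈ Φ`. -/
instance instTopologicalSpaceLambda0 (Φ : Set (S → ℝ)) : TopologicalSpace (Lambda0 Φ) :=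
  TopologicalSpace.induced (pairing Φ) Pi.topologicalSpace

/-- The `σ_Φ`-field: the smallest one for which `G ↦ ∫ f dG` is measurable for all `f ∈ Φ`. -/
instance instMeasurableSpaceLambda0 (Φ : Set (S → ℝ)) : MeasurableSpace (Lambda0 Φ) :=
  MeasurableSpace.comap (pairing Φ) MeasurableSpace.pi

open Classical in
/-- `ρ₀²(G, P) = ½ ∫ (dG/dP)² dP` if `G ≪ P`, and `∞` otherwise. -/
def rho0sq (G : SignedMeasure S) (P : ProbabilityMeasure S) : ℝ≥0∞ :=
  if G ≪ᵥ (P : Measure S).toENNRealVectorMeasure then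
    2⁻¹ * ∫⁻ x, ENNReal.ofReal (G.rnDeriv (P : Measure S) x ^ 2) ∂(P : Measure S)
  else ⊤

/-- The rate function `ν ρ₀²(G₂, P) + ρ₀²(G₁, P)` of a pair `(G₂, G₁)`. -/
def rho0bsq {Φ : Set (S → ℝ)} (ν : ℝ) (P : ProbabilityMeasure S)
    (G : Lambda0 Φ × Lambda0 Φ) : ℝ≥0∞ :=
  ENNReal.ofReal ν * rho0sq (G.1 : SignedMeasure S) P + rho0sq (G.2 : SignedMeasure S) P

/-- The infimum of the rate function over a set of pairs; it is `∞` on the empty set. -/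
def rho0bsqSet {Φ : Set (S → ℝ)} (ν : ℝ) (P : ProbabilityMeasure S)
    (Ω : Set (Lambda0 Φ × Lambda0 Φ)) : ℝ≥0∞ :=
  ⨅ G ∈ Ω, rho0bsq ν P G

/-- The empirical measure `n⁻¹ ∑ᵢ δ_{xᵢ}` of a sample of size `n` (the zero measure if `n = 0`). -/
def empirical {n : ℕ} (x : Fin n → S) : Measure S :=
  (n : ℝ≥0∞)⁻¹ • ∑ i, Measure.dirac (x i)

theorem empirical_univ_le {n : ℕ} (x : Fin n → S) : empirical x Set.univ ≤ 1 := by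
  simp [empirical, ENNReal.inv_mul_le_one]

instance instIsFiniteMeasureEmpirical {n : ℕ} (x : Fin n → S) :
    IsFiniteMeasure (empirical x) :=
  ⟨(empirical_univ_le x).trans_lt ENNReal.one_lt_top⟩

instance instIsProbabilityMeasureEmpirical {n : ℕ} [NeZero n] (x : Fin n → S) :
    IsProbabilityMeasure (empirical x) := by
  refine ⟨?_⟩
  simp [empirical, ENNReal.inv_mul_cancel (Nat.cast_ne_zero.2 (NeZero.ne n))]

theorem measurable_empirical {n : ℕ} :
    Measurable (fun x : Fin n → S => empirical x) := by
  refine Measure.measurable_of_measurable_coe _ fun s hs => ?_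
  simp only [empirical, Measure.smul_apply, Measure.finsetSum_apply, smul_eq_mul,
    Measure.dirac_apply' _ hs]
  refine Measurable.const_mul (Finset.measurable_sum _ fun i _ => ?_) _
  exact (measurable_one.indicator hs).comp (measurable_pi_apply i)

/-- The conditional law of the bootstrap sample: given the sample `x`, the law of `k` independent
random variables with distribution the empirical measure of `x`. -/
def bootstrapKernel (S : Type*) [MeasurableSpace S] (n k : ℕ) :
    Kernel (Fin n → S) (Fin k → S) where
  toFun x := Measure.pi fun _ => empirical x
  measurable' := by
    refine Measurable.measure_of_isPiSystem generateFrom_pi.symm isPiSystem_pi ?_ ?_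
    · rintro _ ⟨s, hs, rfl⟩
      simp only [Measure.pi_pi]
      exact Finset.measurable_prod _ fun i _ =>
        (Measure.measurable_coe (hs i (Set.mem_univ i))).comp measurable_empirical
    · simp only [Measure.pi_univ]
      exact Finset.measurable_prod _ fun i _ =>
        (Measure.measurable_coe MeasurableSet.univ).comp measurable_empirical

instance instIsFiniteKernelBootstrap (n k : ℕ) : IsFiniteKernel (bootstrapKernel S n k) := by
  refine ⟨1, ENNReal.one_lt_top, fun x => ?_⟩
  change Measure.pi (fun _ : Fin k => empirical x) Set.univ ≤ 1
  rw [Measure.pi_univ]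
  exact Finset.prod_le_one' fun i _ => empirical_univ_le x

/-- The joint law of `((X₁, …, X_n), (X*₁, …, X*_k))`, where `X₁, …, X_n` are i.i.d. with law `Q`
and, given these, `X*₁, …, X*_k` are i.i.d. with law the empirical measure of `X₁, …, X_n`. -/
def sampleLaw (Q : ProbabilityMeasure S) (n k : ℕ) :
    Measure ((Fin n → S) × (Fin k → S)) :=
  (Measure.pi fun _ : Fin n => (Q : Measure S)) ⊗ₘ bootstrapKernel S n k

/-- The event `(P*_k - P̂_n, P̂_n - P) ∈ β Ω`. -/
def deviationEvent {Φ : Set (S → ℝ)} (P : ProbabilityMeasure S) (β : ℝ)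
    (Ω : Set (Lambda0 Φ × Lambda0 Φ)) (n k : ℕ) : Set ((Fin n → S) × (Fin k → S)) :=
  {w | ∃ G ∈ Ω,
    (empirical w.2).toSignedMeasure - (empirical w.1).toSignedMeasure
      = β • (G.1 : SignedMeasure S) ∧
    (empirical w.1).toSignedMeasure - (P : Measure S).toSignedMeasure
      = β • (G.2 : SignedMeasure S)}

/-- Assumption A: for all `n ≥ 1`, `P_n = P + b_n H_n` and `P + b_n H` are probability measures in
`Λ_Φ`, and `H_n → H` in the `τ_Φ`-topology. -/
structure AssumptionA (P : ProbabilityMeasure S) (b : ℕ → ℝ) (Pn : ℕ → ProbabilityMeasure S)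
    (Hn : ℕ → Lambda0 (Phi P b)) (H : Lambda0 (Phi P b)) : Prop where
  eq_add : ∀ n, 1 ≤ n → (Pn n : Measure S).toSignedMeasure
    = (P : Measure S).toSignedMeasure + b n • (Hn n : SignedMeasure S)
  mem : ∀ n, 1 ≤ n → Pn n ∈ Lambda (Phi P b)
  limit_mem : ∀ n, 1 ≤ n → ∃ Q ∈ Lambda (Phi P b), (Q : Measure S).toSignedMeasure
    = (P : Measure S).toSignedMeasure + b n • (H : SignedMeasure S)
  tendsto : Tendsto Hn atTop (𝓝 H)

/-- Assumption B1: for every `f ∈ Φ`,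
`limsup_n sup_{m ≥ 1} (n b_n²)⁻¹ log (n b_n |H_m|(|f| > b_n⁻¹)) = -∞`. -/
def AssumptionB1 (P : ProbabilityMeasure S) (b : ℕ → ℝ)
    (Hn : ℕ → Lambda0 (Phi P b)) : Prop :=
  ∀ f ∈ Phi P b,
    limsup (fun n : ℕ => ⨆ (m : ℕ) (_ : 1 ≤ m), scaledLog n (b n)
      (ENNReal.ofReal (n * b n) *
        (Hn m : SignedMeasure S).variation {x | (b n)⁻¹ < |f x|})) atTop = ⊥

end BootstrapMDP

end

/-!
Upper bound: the event that `P*_k - P̂_n` integrates `f` and `P̂_n - P` integrates `g` to a total of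
at least `c b_n` is handled by Chernoff's inequality, applied to the bootstrap stage conditionally
on the sample. The conditional cumulants are governed by empirical second moments of functions
truncated where a test function `F ∈ Φ` exceeds `b_n⁻¹`. These concentrate superexponentially fast,
because membership in `Φ` together with assumption B1 makes larger values of `F` superexponentially
rare under `P_n` as well. Optimizing the tilt gives the rate `c² / (2 (∫ f² / ν + ∫ g²))`. Since
`ρ₀b²` is a dual `L²`-norm, each point of rate above `α` is separated from `0` by such a half-space
of rate above `α`, and a compactness argument along ultrafilters covers a closed set of rate above
`α` by finitely many of them.

Lower bound: near an interior point of finite rate, with densities truncated to bounded `g₂` and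
`g₁`, tilt the resampling law by `exp (b_n g₂)` and the sampling law by `exp (b_n g₁)`. The tilted
laws put mass close to `1` on the event, and the likelihood ratio costs
`k_n b_n² ∫ g₂² / 2 + n b_n² ∫ g₁² / 2`, where `k_n ≈ ν n`.
-/

noncomputable section

namespace BootstrapMDP

variable {S : Type*} [MeasurableSpace S]

/-! ### Exponential rates at speed `n b_n²` -/

theorem scaledLog_eq_div (n : ℕ) (β : ℝ) (x : ℝ≥0∞) :
    scaledLog n β x = ENNReal.log x / ((n * β ^ 2 : ℝ) : EReal) := by
  rw [scaledLog, EReal.coe_inv, mul_comm, EReal.div_eq_inv_mul, mul_comm]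

theorem scaledLog_le_iff {n : ℕ} {β : ℝ} (h : 0 < (n : ℝ) * β ^ 2) (x : ℝ≥0∞) (a : ℝ) :
    scaledLog n β x ≤ a ↔ x ≤ ENNReal.ofReal (Real.exp (n * β ^ 2 * a)) := by
  rw [scaledLog_eq_div, EReal.div_le_iff_le_mul (EReal.coe_pos.2 h) (EReal.coe_ne_top _),
    ← EReal.coe_mul, ← EReal.exp_coe, ← ENNReal.log_le_log_iff, EReal.log_exp]

theorem le_scaledLog_iff {n : ℕ} {β : ℝ} (h : 0 < (n : ℝ) * β ^ 2) (x : ℝ≥0∞) (a : ℝ) :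
    a ≤ scaledLog n β x ↔ ENNReal.ofReal (Real.exp (n * β ^ 2 * a)) ≤ x := by
  rw [scaledLog_eq_div, EReal.le_div_iff_mul_le (EReal.coe_pos.2 h) (EReal.coe_ne_top _),
    ← EReal.coe_mul, mul_comm a, ← EReal.exp_coe, ← ENNReal.log_le_log_iff, EReal.log_exp]

/-- The conditions of the moderate deviation regime on the scale: `b_n > 0`, `b_n → 0` and
`n b_n² → ∞`. -/
structure Normalizing (b : ℕ → ℝ) : Prop where
  pos : ∀ n, 1 ≤ n → 0 < b n
  zero : Tendsto b atTop (𝓝 0)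
  speed : Tendsto (fun n : ℕ => (n : ℝ) * b n ^ 2) atTop atTop

namespace Normalizing

variable {b : ℕ → ℝ}

theorem eventually_pos (hb : Normalizing b) : ∀ᶠ n in atTop, 0 < b n :=
  (eventually_ge_atTop 1).mono hb.pos

theorem eventually_speed_pos (hb : Normalizing b) : ∀ᶠ n : ℕ in atTop, 0 < (n : ℝ) * b n ^ 2 :=
  hb.speed.eventually_gt_atTop 0

theorem tendsto_inv_atTop (hb : Normalizing b) : Tendsto (fun n => (b n)⁻¹) atTop atTop :=
  (tendsto_nhdsWithin_iff.2 ⟨hb.zero, hb.eventually_pos⟩).inv_tendsto_nhdsGT_zero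

end Normalizing

/-- The quantities `p n` decay exponentially at rate at least `a`: eventually
`p n ≤ exp (-a n b_n²)`. -/
def ExpBound (b : ℕ → ℝ) (p : ℕ → ℝ≥0∞) (a : ℝ) : Prop :=
  ∀ᶠ n : ℕ in atTop, p n ≤ ENNReal.ofReal (Real.exp (n * b n ^ 2 * (-a)))

theorem ExpBound.mono {b : ℕ → ℝ} {p q : ℕ → ℝ≥0∞} {a : ℝ} (h : ExpBound b p a)
    (hq : ∀ᶠ n in atTop, q n ≤ p n) : ExpBound b q a := by
  filter_upwards [h, hq] with n h1 h2 using h2.trans h1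

theorem ExpBound.anti {b : ℕ → ℝ} {p : ℕ → ℝ≥0∞} {a a' : ℝ} (h : ExpBound b p a) (ha : a' ≤ a) :
    ExpBound b p a' := by
  filter_upwards [h] with n hn
  refine hn.trans (ENNReal.ofReal_le_ofReal (Real.exp_le_exp.2 ?_))
  exact mul_le_mul_of_nonneg_left (by linarith) (by positivity)

theorem ExpBound.add {b : ℕ → ℝ} (hb : Normalizing b) {p q : ℕ → ℝ≥0∞} {a a' : ℝ}
    (hp : ExpBound b p a) (hq : ExpBound b q a) (ha : a' < a) :
    ExpBound b (fun n => p n + q n) a' := by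
  filter_upwards [hp, hq, hb.speed.eventually_ge_atTop (Real.log 2 / (a - a'))] with n h1 h2 h3
  refine (add_le_add h1 h2).trans ?_
  rw [← ENNReal.ofReal_add (Real.exp_pos _).le (Real.exp_pos _).le]
  refine ENNReal.ofReal_le_ofReal ?_
  rw [div_le_iff₀ (by linarith)] at h3
  have : (n : ℝ) * b n ^ 2 * (-a') ≥ Real.log 2 + n * b n ^ 2 * (-a) := by linarith
  calc _ = Real.exp (Real.log 2 + n * b n ^ 2 * (-a)) := by
        rw [Real.exp_add, Real.exp_log two_pos]; ring
    _ ≤ _ := Real.exp_le_exp.2 this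

theorem ExpBound.finset_sum {b : ℕ → ℝ} (hb : Normalizing b) {ι : Type*} (s : Finset ι)
    {p : ι → ℕ → ℝ≥0∞} {a : ℝ} (hp : ∀ i ∈ s, ∃ a' > a, ExpBound b (p i) a') :
    ∃ a' > a, ExpBound b (fun n => ∑ i ∈ s, p i n) a' := by
  classical
  induction s using Finset.induction_on with
  | empty => exact ⟨a + 1, by simp, by simp [ExpBound]⟩
  | insert i s hi ih =>
    obtain ⟨a₁, h₁, hp₁⟩ := ih fun j hj => hp j (Finset.mem_insert_of_mem hj)
    obtain ⟨a₂, h₂, hp₂⟩ := hp i (Finset.mem_insert_self i s)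
    obtain ⟨a₃, h₃, lt_min_rates⟩ := exists_between (lt_min h₁ h₂)
    refine ⟨a₃, h₃, ?_⟩
    simp only [Finset.sum_insert hi]
    exact (hp₂.anti (min_le_right _ _)).add hb (hp₁.anti (min_le_left _ _)) lt_min_rates

/-- Superexponential smallness at speed `n b_n²`: decay at every exponential rate. -/
def SuperSmall (b : ℕ → ℝ) (p : ℕ → ℝ≥0∞) : Prop := ∀ a : ℝ, ExpBound b p a

theorem SuperSmall.mono {b : ℕ → ℝ} {p q : ℕ → ℝ≥0∞} (h : SuperSmall b p)
    (hq : ∀ᶠ n in atTop, q n ≤ p n) : SuperSmall b q := fun a => (h a).mono hq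

theorem SuperSmall.add {b : ℕ → ℝ} (hb : Normalizing b) {p q : ℕ → ℝ≥0∞}
    (hp : SuperSmall b p) (hq : SuperSmall b q) : SuperSmall b (fun n => p n + q n) :=
  fun a => (hp (a + 1)).add hb (hq (a + 1)) (by linarith)

theorem superSmall_iff_tendsto_scaledLog {b : ℕ → ℝ} (hb : Normalizing b) {p : ℕ → ℝ≥0∞} :
    SuperSmall b p ↔ Tendsto (fun n => scaledLog n (b n) (p n)) atTop (𝓝 ⊥) := by
  rw [EReal.tendsto_nhds_bot_iff_real]
  constructor
  · intro h x
    filter_upwards [h (-(x - 1)), hb.eventually_speed_pos] with n hn hpos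
    rw [neg_neg, ← scaledLog_le_iff hpos] at hn
    exact hn.trans_lt (by exact_mod_cast sub_one_lt x)
  · intro h a
    filter_upwards [h (-a), hb.eventually_speed_pos] with n hn hpos
    exact (scaledLog_le_iff hpos _ _).1 hn.le

/-! ### Integration against signed measures -/

/-- The integral `∫ f dG` of a real function against a signed measure; it is `0` when `f` is not
integrable with respect to the total variation of `G`. -/
def sint (G : SignedMeasure S) (f : S → ℝ) : ℝ :=
  VectorMeasure.integral G f (ContinuousLinearMap.lsmul ℝ ℝ)

theorem sint_toSignedMeasure (μ : Measure S) [IsFiniteMeasure μ] (f : S → ℝ) :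
    sint μ.toSignedMeasure f = ∫ x, f x ∂μ := by
  have h : (ContinuousLinearMap.lsmul ℝ ℝ : ℝ →L[ℝ] ℝ →L[ℝ] ℝ)
      = (ContinuousLinearMap.lsmul ℝ ℝ).flip := by
    ext; simp
  rw [sint, h, VectorMeasure.integral_toSignedMeasure]

theorem sint_add_left {G G' : SignedMeasure S} {f : S → ℝ} (h : Integrable f G.variation)
    (h' : Integrable f G'.variation) : sint (G + G') f = sint G f + sint G' f :=
  VectorMeasure.integral_add_vectorMeasure h h'

theorem sint_sub_left {G G' : SignedMeasure S} {f : S → ℝ} (h : Integrable f G.variation)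
    (h' : Integrable f G'.variation) : sint (G - G') f = sint G f - sint G' f :=
  VectorMeasure.integral_sub_vectorMeasure h h'

theorem sint_smul_left (G : SignedMeasure S) (c : ℝ) (f : S → ℝ) :
    sint (c • G) f = c * sint G f :=
  VectorMeasure.integral_smul_vectorMeasure f c

theorem sint_add {G : SignedMeasure S} {f g : S → ℝ} (h : Integrable f G.variation)
    (h' : Integrable g G.variation) : sint G (fun x => f x + g x) = sint G f + sint G g :=
  VectorMeasure.integral_add h h'

theorem sint_sub {G : SignedMeasure S} {f g : S → ℝ} (h : Integrable f G.variation)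
    (h' : Integrable g G.variation) : sint G (fun x => f x - g x) = sint G f - sint G g :=
  VectorMeasure.integral_sub h h'

theorem sint_const_mul (G : SignedMeasure S) (c : ℝ) (f : S → ℝ) :
    sint G (fun x => c * f x) = c * sint G f :=
  VectorMeasure.integral_fun_smul G _ c f

theorem abs_sint_le (G : SignedMeasure S) (f : S → ℝ) :
    |sint G f| ≤ ∫ x, |f x| ∂G.variation := by
  refine (VectorMeasure.norm_integral_le_integral_norm (μ := G) (f := f)
    (B := ContinuousLinearMap.lsmul ℝ ℝ)).trans ?_
  simp

instance isFiniteMeasure_variation (G : SignedMeasure S) : IsFiniteMeasure G.variation := by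
  rw [← SignedMeasure.totalVariation_eq_variation]
  unfold SignedMeasure.totalVariation
  infer_instance

theorem variation_eq_jordan (G : SignedMeasure S) :
    G.variation = G.toJordanDecomposition.posPart + G.toJordanDecomposition.negPart :=
  (SignedMeasure.totalVariation_eq_variation G).symm

theorem sint_eq_sub_jordan {G : SignedMeasure S} {f : S → ℝ} (hf : Integrable f G.variation) :
    sint G f = ∫ x, f x ∂G.toJordanDecomposition.posPart
      - ∫ x, f x ∂G.toJordanDecomposition.negPart := by
  rw [variation_eq_jordan] at hf
  conv_lhs => rw [← G.toSignedMeasure_toJordanDecomposition]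
  rw [JordanDecomposition.toSignedMeasure, sint_sub_left, sint_toSignedMeasure,
    sint_toSignedMeasure]
  · simpa using hf.left_of_add_measure
  · simpa using hf.right_of_add_measure

theorem exists_measurable_sign (G : SignedMeasure S) :
    ∃ s : S → ℝ, Measurable s ∧ (∀ x, |s x| ≤ 1) ∧ ∀ f : S → ℝ, Integrable f G.variation →
      sint G (fun x => s x * f x) = ∫ x, f x ∂G.variation := by
  classical
  obtain ⟨u, hu, hpos, hneg⟩ := G.toJordanDecomposition.mutuallySingular
  set s : S → ℝ := fun x => if x ∈ u then -1 else 1 with hs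
  have hsm : Measurable s := Measurable.ite hu measurable_const measurable_const
  have hs1 : ∀ x, |s x| ≤ 1 := fun x => by simp only [hs]; split_ifs <;> simp
  refine ⟨s, hsm, hs1, fun f hf => ?_⟩
  have eq_pos : ∫ x, s x * f x ∂G.toJordanDecomposition.posPart
      = ∫ x, f x ∂G.toJordanDecomposition.posPart := by
    have hae : ∀ᵐ x ∂G.toJordanDecomposition.posPart, x ∉ u := by simpa [ae_iff] using hpos
    exact integral_congr_ae (hae.mono fun x hx => by simp [hs, hx])
  have eq_neg : ∫ x, s x * f x ∂G.toJordanDecomposition.negPart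
      = - ∫ x, f x ∂G.toJordanDecomposition.negPart := by
    have hae : ∀ᵐ x ∂G.toJordanDecomposition.negPart, x ∈ u := by simpa [ae_iff] using! hneg
    rw [← integral_neg]
    exact integral_congr_ae (hae.mono fun x hx => by simp [hs, hx])
  rw [sint_eq_sub_jordan (hf.bdd_mul hsm.aestronglyMeasurable (Eventually.of_forall hs1)), eq_pos,
    eq_neg]
  rw [variation_eq_jordan] at hf ⊢
  rw [integral_add_measure hf.left_of_add_measure hf.right_of_add_measure, sub_neg_eq_add]

theorem integrable_variation_withDensity {μ : Measure S} {g f : S → ℝ} (hg : Integrable g μ)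
    (hf : Measurable f) (hfg : Integrable (fun x => f x * g x) μ) :
    Integrable f (μ.withDensityᵥ g).variation := by
  rw [Measure.variation_withDensityᵥ hg]
  rw [integrable_withDensity_iff_integrable_smul₀' hg.aestronglyMeasurable.enorm (by simp)]
  refine hfg.norm.mono' ?_ ?_
  · exact (hg.aestronglyMeasurable.norm).smul hf.aestronglyMeasurable |>.congr (by simp; rfl)
  · refine Eventually.of_forall fun x => ?_
    simp [mul_comm]

theorem integrable_and_integral_withDensity_ofReal {μ : Measure S} {f h : S → ℝ}
    (hh : AEMeasurable h μ) (hi : Integrable (fun x => max (h x) 0 * f x) μ) :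
    Integrable f (μ.withDensity fun x => ENNReal.ofReal (h x)) ∧
      ∫ x, f x ∂(μ.withDensity fun x => ENNReal.ofReal (h x)) = ∫ x, max (h x) 0 * f x ∂μ := by
  rw [integrable_withDensity_iff_integrable_smul₀' hh.ennreal_ofReal (by simp),
    integral_withDensity_eq_integral_toReal_smul₀ hh.ennreal_ofReal (by simp)]
  simpa only [ENNReal.toReal_ofReal', smul_eq_mul, and_true] using hi

theorem integrable_max_zero_mul {μ : Measure S} {f g : S → ℝ} (hg : AEMeasurable g μ)
    (hf : Measurable f) (hfg : Integrable (fun x => f x * g x) μ) :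
    Integrable (fun x => max (g x) 0 * f x) μ := by
  refine hfg.norm.mono' ((hg.max aemeasurable_const).mul hf.aemeasurable).aestronglyMeasurable
    (Eventually.of_forall fun x => ?_)
  rw [norm_mul, norm_mul, mul_comm]
  gcongr
  rw [Real.norm_eq_abs, Real.norm_eq_abs, abs_of_nonneg (le_max_right _ _)]
  exact max_le (le_abs_self _) (abs_nonneg _)

theorem sint_withDensity {μ : Measure S} {g f : S → ℝ} (hg : Integrable g μ) (hf : Measurable f)
    (hfg : Integrable (fun x => f x * g x) μ) :
    sint (μ.withDensityᵥ g) f = ∫ x, f x * g x ∂μ := by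
  have : IsFiniteMeasure (μ.withDensity fun x => ENNReal.ofReal (g x)) :=
    isFiniteMeasure_withDensity_ofReal hg.2
  have : IsFiniteMeasure (μ.withDensity fun x => ENNReal.ofReal (-g x)) :=
    isFiniteMeasure_withDensity_ofReal hg.neg.2
  have hgm := hg.aestronglyMeasurable.aemeasurable
  have hpos := integrable_max_zero_mul hgm hf hfg
  have hneg : Integrable (fun x => max (-g x) 0 * f x) μ :=
    integrable_max_zero_mul hgm.neg hf (by simpa using hfg.neg)
  obtain ⟨ipos, epos⟩ := integrable_and_integral_withDensity_ofReal hgm hpos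
  obtain ⟨ineg, eneg⟩ :=
    integrable_and_integral_withDensity_ofReal (h := fun x => -g x) hgm.neg hneg
  rw [withDensityᵥ_eq_withDensity_pos_part_sub_withDensity_neg_part hg, sint_sub_left
    (by simpa using ipos) (by simpa using ineg), sint_toSignedMeasure, sint_toSignedMeasure, epos,
    eneg, ← integral_sub hpos hneg]
  refine integral_congr_ae (Eventually.of_forall fun x => ?_)
  change max (g x) 0 * f x - max (-g x) 0 * f x = f x * g x
  rw [← sub_mul, max_zero_sub_max_neg_zero_eq_self, mul_comm]

section Phi

variable {P : ProbabilityMeasure S} {b : ℕ → ℝ}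

theorem mem_Phi_iff (hb : Normalizing b) {f : S → ℝ} :
    f ∈ Phi P b ↔ Measurable f ∧ MemLp f 2 (P : Measure S) ∧
      SuperSmall b (fun n => (n : ℝ≥0∞) * (P : Measure S) {x | (b n)⁻¹ < |f x|}) := by
  rw [superSmall_iff_tendsto_scaledLog hb]
  rfl

theorem mem_Phi_of_abs_le (hb : Normalizing b) {f g : S → ℝ} (hf : f ∈ Phi P b) (hg : Measurable g)
    (hle : ∀ x, |g x| ≤ |f x|) : g ∈ Phi P b := by
  rw [mem_Phi_iff hb] at hf ⊢
  refine ⟨hg, hf.2.1.mono hg.aestronglyMeasurable (Eventually.of_forall hle),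
    hf.2.2.mono (Eventually.of_forall fun n => ?_)⟩
  exact mul_le_mul_right (measure_mono fun x hx => lt_of_lt_of_le hx (hle x)) _

theorem max_abs_mem_Phi (hb : Normalizing b) {f g : S → ℝ} (hf : f ∈ Phi P b) (hg : g ∈ Phi P b) :
    (fun x => max |f x| |g x|) ∈ Phi P b := by
  rw [mem_Phi_iff hb] at hf hg ⊢
  have hm : Measurable fun x => max |f x| |g x| := hf.1.abs.max hg.1.abs
  refine ⟨hm, (hf.2.1.abs.add hg.2.1.abs).mono hm.aestronglyMeasurable
    (Eventually.of_forall fun x => ?_), (hf.2.2.add hb hg.2.2).mono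
    (Eventually.of_forall fun n => ?_)⟩
  · have h1 := abs_nonneg (f x)
    have h2 := abs_nonneg (g x)
    simp only [Pi.add_apply, Pi.abs_apply, Real.norm_eq_abs]
    rw [abs_of_nonneg (le_max_of_le_left h1), abs_of_nonneg (add_nonneg h1 h2)]
    exact max_le (by linarith) (by linarith)
  · rw [← mul_add]
    gcongr
    refine (measure_mono ?_).trans (measure_union_le _ _)
    intro x hx
    simp only [Set.mem_ofPred_eq, Set.mem_union] at hx ⊢
    rw [abs_of_nonneg (le_max_of_le_left (abs_nonneg _))] at hx
    exact lt_max_iff.1 hx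

theorem mem_Phi_of_bounded (hb : Normalizing b) {f : S → ℝ} (hf : Measurable f) {C : ℝ}
    (hC : ∀ x, |f x| ≤ C) : f ∈ Phi P b := by
  rw [mem_Phi_iff hb]
  refine ⟨hf, MemLp.of_bound hf.aestronglyMeasurable C (Eventually.of_forall hC), fun a => ?_⟩
  filter_upwards [hb.tendsto_inv_atTop.eventually_ge_atTop C] with n hn
  have : {x | (b n)⁻¹ < |f x|} = ∅ := by
    ext x
    simpa using (hC x).trans hn
  simp [this]

theorem exists_dominating_mem_Phi (hb : Normalizing b) (J : Finset (S → ℝ))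
    (hJ : ∀ f ∈ J, f ∈ Phi P b) :
    ∃ F ∈ Phi P b, (∀ x, 1 ≤ F x) ∧ ∀ f ∈ J, ∀ x, |f x| ≤ F x := by
  classical
  induction J using Finset.induction_on with
  | empty =>
    exact ⟨fun _ => 1, mem_Phi_of_bounded hb measurable_const (C := 1) (by simp), by simp, by simp⟩
  | insert g J hg ih =>
    obtain ⟨F, hF, h1, hJF⟩ := ih fun f hf => hJ f (Finset.mem_insert_of_mem hf)
    refine ⟨_, max_abs_mem_Phi hb hF (hJ g (Finset.mem_insert_self _ _)),
      fun x => le_max_of_le_left ((h1 x).trans (le_abs_self _)), fun f hf x => ?_⟩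
    rcases Finset.mem_insert.1 hf with rfl | hf
    · exact le_max_right _ _
    · exact le_max_of_le_left ((hJF f hf x).trans (le_abs_self _))

end Phi

/-! ### Uniform integrability of a setwise convergent sequence of signed measures -/

theorem integrable_of_abs_le {μ : Measure S} {F h : S → ℝ} (hF : Integrable F μ)
    (hh : Measurable h) (hle : ∀ x, |h x| ≤ F x) : Integrable h μ :=
  hF.mono' hh.aestronglyMeasurable (Eventually.of_forall hle)

theorem tendsto_setIntegral_gt_atTop {μ : Measure S} {F h : S → ℝ} (hFm : Measurable F)
    (hh : Integrable h μ) :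
    Tendsto (fun T : ℝ => ∫ x in {x | T < F x}, h x ∂μ) atTop (𝓝 0) := by
  have hm : ∀ T : ℝ, MeasurableSet {x | T < F x} := fun T => measurableSet_lt measurable_const hFm
  have := tendsto_integral_filter_of_dominated_convergence (μ := μ) (l := atTop)
    (F := fun (T : ℝ) x => {x | T < F x}.indicator h x) (f := fun _ => (0 : ℝ)) (fun x => ‖h x‖)
    (Eventually.of_forall fun T => hh.aestronglyMeasurable.indicator (hm T))
    (Eventually.of_forall fun T => Eventually.of_forall fun x => norm_indicator_le_norm_self _ _)
    hh.norm
    (Eventually.of_forall fun x => tendsto_const_nhds.congr' <| by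
      filter_upwards [eventually_ge_atTop (F x)] with T hT
      rw [Set.indicator_of_notMem]
      simpa using hT)
  simpa [integral_indicator, hm] using this

theorem abs_sint_sub_le_of_eq_on_le {F h h' : S → ℝ} {T : ℝ} {D : SignedMeasure S}
    (hFm : Measurable F) (hD : Integrable F D.variation)
    (hh : Measurable h) (hhF : ∀ x, |h x| ≤ F x) (hh' : Measurable h') (hhF' : ∀ x, |h' x| ≤ F x)
    (heq : ∀ x, F x ≤ T → h x = h' x) :
    |sint D h - sint D h'| ≤ 2 * ∫ x in {x | T < F x}, F x ∂D.variation := by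
  have hm : MeasurableSet {x | T < F x} := measurableSet_lt measurable_const hFm
  have ih := integrable_of_abs_le hD hh hhF
  have ih' := integrable_of_abs_le hD hh' hhF'
  rw [← sint_sub ih ih', ← integral_const_mul, ← integral_indicator hm]
  refine (abs_sint_le _ _).trans
    (integral_mono (ih.sub ih').abs ((hD.const_mul 2).indicator hm) fun x => ?_)
  by_cases hx : T < F x
  · rw [Set.indicator_of_mem (show x ∈ {x | T < F x} from hx)]
    refine (abs_sub _ _).trans ?_
    linarith [hhF x, hhF' x]
  · rw [Set.indicator_of_notMem (show x ∉ {x | T < F x} from hx), heq x (not_lt.1 hx)]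
    simp

/-- `A` is a measurable function dominated by `F` and vanishing where `F` exceeds `T`. Such
functions are the partial sums of the gliding hump construction. -/
structure IsTruncated (F : S → ℝ) (T : ℝ) (A : S → ℝ) : Prop where
  measurable : Measurable A
  dominated : ∀ x, |A x| ≤ F x
  eq_zero : ∀ x, T < F x → A x = 0

theorem IsTruncated.add_indicator {F A s : S → ℝ} {T T' : ℝ} (hA : IsTruncated F T A)
    (hFm : Measurable F) (hF0 : ∀ x, 0 ≤ F x) (hs : Measurable s) (hs1 : ∀ x, |s x| ≤ 1)
    (hT : T ≤ T') :
    IsTruncated F T' fun x => A x + s x * ({x | T < F x} \ {x | T' < F x}).indicator F x where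
  measurable := hA.measurable.add (hs.mul (hFm.indicator
    ((measurableSet_lt measurable_const hFm).diff (measurableSet_lt measurable_const hFm))))
  dominated x := by
    by_cases hx : T < F x
    · rw [hA.eq_zero x hx, zero_add, abs_mul]
      refine (mul_le_of_le_one_left (abs_nonneg _) (hs1 x)).trans ?_
      rw [abs_of_nonneg (Set.indicator_nonneg (fun x _ => hF0 x) x)]
      exact Set.indicator_le_self' (fun x _ => hF0 x) x
    · rw [Set.indicator_of_notMem fun h => hx h.1, mul_zero, add_zero]
      exact hA.dominated x
  eq_zero x hx := by
    rw [hA.eq_zero x (hT.trans_lt hx), Set.indicator_of_notMem fun h => h.2 hx, mul_zero, add_zero]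

theorem IsTruncated.exists_hump {F A : S → ℝ} {T : ℝ} (hA : IsTruncated F T A)
    (hFm : Measurable F) (hF0 : ∀ x, 0 ≤ F x) {D : SignedMeasure S}
    (hD : Integrable F D.variation) {δ : ℝ} (hδ : 0 < δ) :
    ∃ (T' : ℝ) (A' : S → ℝ), T + 1 ≤ T' ∧ IsTruncated F T' A' ∧ (∀ x, F x ≤ T → A' x = A x) ∧
      ∀ h : S → ℝ, Measurable h → (∀ x, |h x| ≤ F x) → (∀ x, F x ≤ T' → h x = A' x) →
        sint D A + ∫ x in {x | T < F x}, F x ∂D.variation - δ ≤ sint D h := by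
  obtain ⟨T', htail, hTT'⟩ := (((tendsto_setIntegral_gt_atTop hFm hD).eventually_lt_const
    (show (0 : ℝ) < δ / 3 by positivity)).and (eventually_ge_atTop (T + 1))).exists
  obtain ⟨s, hs, hs1, hsint⟩ := exists_measurable_sign D
  set B : S → ℝ := fun x => s x * ({x | T < F x} \ {x | T' < F x}).indicator F x
  have hm : ∀ T, MeasurableSet {x | T < F x} := fun T => measurableSet_lt measurable_const hFm
  have hAB : IsTruncated F T' fun x => A x + B x :=
    hA.add_indicator hFm hF0 hs hs1 (by linarith)
  refine ⟨T', fun x => A x + B x, hTT', hAB, fun x hx => ?_, fun h hh hhF hhA => ?_⟩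
  · simp only [B]
    rw [Set.indicator_of_notMem fun h => not_lt.2 hx h.1, mul_zero, add_zero]
  have hsint_B : sint D B = ∫ x in {x | T < F x}, F x ∂D.variation
      - ∫ x in {x | T' < F x}, F x ∂D.variation := by
    rw [hsint _ (hD.indicator ((hm T).diff (hm T'))), integral_indicator ((hm T).diff (hm T')),
      setIntegral_sdiff (hm T') hD.integrableOn]
    exact fun x (hx : T' < F x) => show T < F x by linarith
  have iA := integrable_of_abs_le hD hA.measurable hA.dominated
  have iB : Integrable B D.variation := by
    simpa [Pi.sub_def] using (integrable_of_abs_le hD hAB.measurable hAB.dominated).sub iA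
  have hclose := abs_le.1
    (abs_sint_sub_le_of_eq_on_le hFm hD hh hhF hAB.measurable hAB.dominated hhA)
  rw [sint_add iA iB] at hclose
  linarith [hclose.1]

theorem exists_eq_on_le_of_compatible {F : S → ℝ} {T : ℕ → ℝ} {A : ℕ → S → ℝ}
    (hA : ∀ j, IsTruncated F (T j) (A j)) (hT : ∀ j, T j + 1 ≤ T (j + 1))
    (hAA : ∀ j x, F x ≤ T j → A (j + 1) x = A j x) :
    ∃ h : S → ℝ, Measurable h ∧ (∀ x, |h x| ≤ F x) ∧ ∀ j x, F x ≤ T j → h x = A j x := by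
  have hmono : Monotone T := monotone_nat_of_le_succ fun j => by linarith [hT j]
  have hgrow : ∀ j : ℕ, T 0 + j ≤ T j := fun j => by
    induction j with
    | zero => simp
    | succ j ih => push_cast; linarith [hT j]
  have hagree : ∀ i j, i ≤ j → ∀ x, F x ≤ T i → A j x = A i x := by
    intro i j hij x hx
    induction j, hij using Nat.le_induction with
    | base => rfl
    | succ j hij ih => rw [hAA j x (hx.trans (hmono hij)), ih]
  have hreach : ∀ x, ∃ j, F x ≤ T j := fun x =>
    ⟨⌈F x - T 0⌉₊, by linarith [Nat.le_ceil (F x - T 0), hgrow ⌈F x - T 0⌉₊]⟩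
  choose j hj using hreach
  have hh : ∀ i x, F x ≤ T i → A (j x) x = A i x := fun i x hx =>
    (le_total i (j x)).elim (fun h => hagree _ _ h x hx) fun h => (hagree _ _ h x (hj x)).symm
  refine ⟨fun x => A (j x) x, ?_, fun x => (hA _).dominated x, hh⟩
  refine measurable_of_tendsto_metrizable (fun i => (hA i).measurable)
    (tendsto_pi_nhds.2 fun x => tendsto_const_nhds.congr' ?_)
  filter_upwards [eventually_ge_atTop (j x)] with i hi
  exact hh i x ((hj x).trans (hmono hi))

/- If the tails stayed above `ε` along a subsequence, one could glue together functions on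
successive annuli `{T_j < F ≤ T_{j+1}}` on each of which some `D n` has a large integral; the
resulting test function contradicts the convergence. -/
theorem eventually_tail_le_of_tendsto_zero {F : S → ℝ} (hFm : Measurable F) (hF0 : ∀ x, 0 ≤ F x)
    (D : ℕ → SignedMeasure S) (hD : ∀ n, Integrable F (D n).variation)
    (hlim : ∀ h : S → ℝ, Measurable h → (∀ x, |h x| ≤ F x) →
      Tendsto (fun n => sint (D n) h) atTop (𝓝 0))
    {ε : ℝ} (hε : 0 < ε) :
    ∃ T : ℝ, ∀ᶠ n in atTop, ∫ x in {x | T < F x}, F x ∂(D n).variation ≤ ε := by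
  by_contra! hcon
  have hstep : ∀ (N : ℕ) (p : {p : ℝ × (S → ℝ) // IsTruncated F p.1 p.2}),
      ∃ q : {p : ℝ × (S → ℝ) // IsTruncated F p.1 p.2}, p.1.1 + 1 ≤ q.1.1 ∧
        (∀ x, F x ≤ p.1.1 → q.1.2 x = p.1.2 x) ∧ ∃ n, N ≤ n ∧
        ∀ h : S → ℝ, Measurable h → (∀ x, |h x| ≤ F x) → (∀ x, F x ≤ q.1.1 → h x = q.1.2 x) →
          ε / 2 ≤ sint (D n) h := by
    rintro N ⟨⟨T, A⟩, hA⟩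
    have hsmall := (hlim A hA.measurable hA.dominated).eventually_const_lt
      (show -(ε / 4) < 0 by linarith)
    obtain ⟨n, ⟨hbig, hnA⟩, hnN⟩ := (((hcon T).and_eventually hsmall).and_eventually
      (eventually_ge_atTop N)).exists
    obtain ⟨T', A', hT, hA', hAA, hh⟩ :=
      hA.exists_hump hFm hF0 (hD n) (show (0 : ℝ) < ε / 4 by linarith)
    exact ⟨⟨⟨T', A'⟩, hA'⟩, hT, hAA, n, hnN, fun h h1 h2 h3 => by linarith [hh h h1 h2 h3]⟩
  choose next hgrow hagree hlarge using hstep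
  let p : ℕ → {p : ℝ × (S → ℝ) // IsTruncated F p.1 p.2} := fun j => Nat.rec
    ⟨(0, fun _ => 0), measurable_const, by simpa using hF0, by simp⟩ (fun i q => next i q) j
  obtain ⟨h, hhm, hhF, hh⟩ := exists_eq_on_le_of_compatible (fun j => (p j).2)
    (fun j => hgrow j (p j)) fun j => hagree j (p j)
  obtain ⟨N, hN⟩ := eventually_atTop.1
    ((hlim h hhm hhF).eventually_lt_const (show (0 : ℝ) < ε / 2 by linarith))
  obtain ⟨n, hn, hnh⟩ := hlarge N (p N)
  linarith [hN n hn, hnh h hhm hhF (hh (N + 1))]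

/-! ### Regular triangular arrays -/

theorem integrableOn_of_bound {μ : Measure S} [IsFiniteMeasure μ] {s : Set S}
    (hs : MeasurableSet s) {f : S → ℝ} (hf : Measurable f) {C : ℝ} (hC : ∀ x ∈ s, |f x| ≤ C) :
    IntegrableOn f s μ :=
  IntegrableOn.of_bound (measure_lt_top _ _) hf.aestronglyMeasurable C
    ((ae_restrict_iff' hs).2 (Eventually.of_forall hC))

theorem abs_setIntegral_sub_setIntegral_le {μ : Measure S} [IsProbabilityMeasure μ]
    {F ψ φ : S → ℝ} {C T B δ : ℝ} (hFm : Measurable F) (hF0 : ∀ x, 0 ≤ F x) (hψm : Measurable ψ)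
    (hφm : Measurable φ) (hTB : T ≤ B) (hδ : 0 ≤ δ) (hψ : ∀ x, F x ≤ B → |ψ x| ≤ C * F x ^ 2)
    (hψφ : ∀ x, F x ≤ T → |ψ x - φ x| ≤ δ) :
    |∫ x in {x | F x ≤ B}, ψ x ∂μ - ∫ x in {x | F x ≤ T}, φ x ∂μ|
      ≤ δ + C * ∫ x in {x | T < F x ∧ F x ≤ B}, F x ^ 2 ∂μ := by
  have hm : ∀ t, MeasurableSet {x | F x ≤ t} := fun t => measurableSet_le hFm measurable_const
  have hmid : MeasurableSet {x | T < F x ∧ F x ≤ B} :=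
    (measurableSet_lt measurable_const hFm).inter (hm B)
  have hsq : ∀ x, F x ≤ B → F x ^ 2 ≤ B ^ 2 := fun x hx => pow_le_pow_left₀ (hF0 x) hx 2
  have iψ : IntegrableOn ψ {x | F x ≤ B} μ :=
    integrableOn_of_bound (hm B) hψm (C := |C| * B ^ 2) fun x hx => (hψ x hx).trans <|
      mul_le_mul (le_abs_self C) (hsq x hx) (sq_nonneg _) (abs_nonneg C)
  have iψT : IntegrableOn ψ {x | F x ≤ T} μ := iψ.mono_set fun x hx => le_trans hx hTB
  have iφT : IntegrableOn φ {x | F x ≤ T} μ := by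
    have hdiff := iψT.sub (integrableOn_of_bound (μ := μ) (hm T) (hψm.sub hφm) hψφ)
    simpa using hdiff
  have iF : IntegrableOn (fun x => F x ^ 2) {x | T < F x ∧ F x ≤ B} μ :=
    integrableOn_of_bound hmid (hFm.pow_const 2) (C := B ^ 2) fun x hx => by
      rw [abs_of_nonneg (sq_nonneg _)]
      exact hsq x hx.2
  have hsdiff : {x | F x ≤ B} \ {x | F x ≤ T} = {x | T < F x ∧ F x ≤ B} := by
    ext x
    simp [and_comm]
  have hlow : |∫ x in {x | F x ≤ T}, ψ x ∂μ - ∫ x in {x | F x ≤ T}, φ x ∂μ| ≤ δ := by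
    rw [← integral_sub iψT iφT, ← Real.norm_eq_abs]
    refine (norm_setIntegral_le_of_norm_le_const (measure_lt_top _ _) hψφ).trans ?_
    exact mul_le_of_le_one_right hδ measureReal_le_one
  have hhigh : |∫ x in {x | T < F x ∧ F x ≤ B}, ψ x ∂μ|
      ≤ C * ∫ x in {x | T < F x ∧ F x ≤ B}, F x ^ 2 ∂μ := by
    rw [← integral_const_mul, ← Real.norm_eq_abs]
    exact norm_integral_le_of_norm_le (iF.const_mul C)
      ((ae_restrict_iff' hmid).2 (Eventually.of_forall fun x hx => hψ x hx.2))
  rw [← hsdiff, setIntegral_sdiff (hm T) iψ fun x hx => le_trans hx hTB, hsdiff] at hhigh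
  calc _ = |(∫ x in {x | F x ≤ T}, ψ x ∂μ - ∫ x in {x | F x ≤ T}, φ x ∂μ)
        + (∫ x in {x | F x ≤ B}, ψ x ∂μ - ∫ x in {x | F x ≤ T}, ψ x ∂μ)| := by ring_nf
    _ ≤ _ := (abs_add_le _ _).trans (add_le_add hlow hhigh)

theorem abs_integral_sub_setIntegral_le {μ : Measure S} {F φ G : S → ℝ} {T : ℝ}
    (hFm : Measurable F) (hG : Integrable G μ) (hφm : Measurable φ) (hφ : ∀ x, |φ x| ≤ G x) :
    |∫ x, φ x ∂μ - ∫ x in {x | F x ≤ T}, φ x ∂μ| ≤ ∫ x in {x | T < F x}, G x ∂μ := by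
  have hc : {x | F x ≤ T}ᶜ = {x | T < F x} := by
    ext x
    simp
  rw [← integral_add_compl (measurableSet_le hFm measurable_const)
    (integrable_of_abs_le hG hφm hφ), add_sub_cancel_left, hc, ← Real.norm_eq_abs]
  exact norm_integral_le_of_norm_le hG.integrableOn (Eventually.of_forall hφ)

/-- A triangular array of laws `Q n` that is close to `P`, as seen by functions dominated by
multiples of `F` and truncated to `{F ≤ b_n⁻¹}`. -/
structure RegularArray (P : Measure S) (b : ℕ → ℝ) (Q : ℕ → Measure S) (F : S → ℝ) : Prop where
  normalizing : Normalizing b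
  meas : Measurable F
  one_le : ∀ x, 1 ≤ F x
  sq : Integrable (fun x => F x ^ 2) P
  tail : SuperSmall b (fun n => (n : ℝ≥0∞) * Q n {x | (b n)⁻¹ < F x})
  unif : ∀ ε > 0, ∃ T : ℝ, ∀ᶠ n in atTop,
    ∫ x in {x | T < F x ∧ F x ≤ (b n)⁻¹}, F x ^ 2 ∂Q n ≤ ε
  bdd : ∀ h : S → ℝ, Measurable h → (∃ C, ∀ x, |h x| ≤ C) →
    Tendsto (fun n => ∫ x, h x ∂Q n) atTop (𝓝 (∫ x, h x ∂P))

namespace RegularArray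

variable {P : Measure S} {b : ℕ → ℝ} {Q : ℕ → Measure S} {F : S → ℝ}

theorem measurableSet_trunc (h : RegularArray P b Q F) (n : ℕ) :
    MeasurableSet {x | F x ≤ (b n)⁻¹} := measurableSet_le h.meas measurable_const

theorem le_sq (h : RegularArray P b Q F) (x : S) : F x ≤ F x ^ 2 := by
  nlinarith [h.one_le x]

theorem one_le_sq (h : RegularArray P b Q F) (x : S) : 1 ≤ F x ^ 2 := by
  nlinarith [h.one_le x]

theorem tendsto_setIntegral_le_const (h : RegularArray P b Q F) {φ : S → ℝ} {C T : ℝ}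
    (hφm : Measurable φ) (hφ : ∀ x, |φ x| ≤ C * F x ^ 2) :
    Tendsto (fun n => ∫ x in {x | F x ≤ T}, φ x ∂Q n) atTop
      (𝓝 (∫ x in {x | F x ≤ T}, φ x ∂P)) := by
  have hm : MeasurableSet {x | F x ≤ T} := measurableSet_le h.meas measurable_const
  simp only [← integral_indicator hm]
  refine h.bdd _ (hφm.indicator hm) ⟨|C| * T ^ 2, fun x => ?_⟩
  by_cases hx : F x ≤ T
  · rw [Set.indicator_of_mem (show x ∈ {x | F x ≤ T} from hx)]
    exact (hφ x).trans (mul_le_mul (le_abs_self C)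
      (pow_le_pow_left₀ (zero_le_one.trans (h.one_le x)) hx 2) (sq_nonneg _) (abs_nonneg C))
  · rw [Set.indicator_of_notMem (show x ∉ {x | F x ≤ T} from hx), abs_zero]
    positivity

theorem tendsto_setIntegral [IsProbabilityMeasure P] [∀ n, IsProbabilityMeasure (Q n)]
    (h : RegularArray P b Q F) {ψ : ℕ → S → ℝ} {φ : S → ℝ} {C : ℝ}
    (hψm : ∀ n, Measurable (ψ n)) (hφm : Measurable φ)
    (hψ : ∀ᶠ n in atTop, ∀ x, F x ≤ (b n)⁻¹ → |ψ n x| ≤ C * F x ^ 2)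
    (hφ : ∀ x, |φ x| ≤ C * F x ^ 2)
    (hlim : ∀ T ε : ℝ, 0 < ε → ∀ᶠ n in atTop, ∀ x, F x ≤ T → |ψ n x - φ x| ≤ ε) :
    Tendsto (fun n => ∫ x in {x | F x ≤ (b n)⁻¹}, ψ n x ∂Q n) atTop (𝓝 (∫ x, φ x ∂P)) := by
  obtain ⟨x₀⟩ := nonempty_of_isProbabilityMeasure P
  have hC0 : 0 ≤ C :=
    nonneg_of_mul_nonneg_left ((abs_nonneg _).trans (hφ x₀)) (by linarith [h.one_le_sq x₀])
  refine Metric.tendsto_nhds.2 fun ε hε => ?_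
  obtain ⟨δ, hδ, hCδ⟩ : ∃ δ > 0, δ + C * δ = ε / 4 :=
    ⟨ε / (4 * (1 + C)), by positivity, by field_simp⟩
  obtain ⟨T₁, hT₁⟩ := h.unif δ hδ
  obtain ⟨T, hT, hTT₁⟩ := (((tendsto_setIntegral_gt_atTop h.meas h.sq).eventually_lt_const hδ).and
    (eventually_ge_atTop T₁)).exists
  have hP : |∫ x, φ x ∂P - ∫ x in {x | F x ≤ T}, φ x ∂P| ≤ C * δ := by
    refine (abs_integral_sub_setIntegral_le h.meas (h.sq.const_mul C) hφm hφ).trans ?_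
    rw [integral_const_mul]
    exact mul_le_mul_of_nonneg_left hT.le hC0
  filter_upwards [hT₁, hψ, hlim T δ hδ, Metric.tendsto_nhds.1
    (h.tendsto_setIntegral_le_const (T := T) hφm hφ) (ε / 4) (by linarith),
    h.normalizing.tendsto_inv_atTop.eventually_ge_atTop T] with n htail hψn hψφ hn hTb
  have hQ := abs_setIntegral_sub_setIntegral_le (μ := Q n) h.meas
    (fun x => zero_le_one.trans (h.one_le x)) (hψm n) hφm hTb hδ.le hψn hψφ
  have htail' : ∫ x in {x | T < F x ∧ F x ≤ (b n)⁻¹}, F x ^ 2 ∂Q n ≤ δ := by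
    refine (setIntegral_mono_set (integrableOn_of_bound ((measurableSet_lt measurable_const
      h.meas).inter (h.measurableSet_trunc n)) (h.meas.pow_const 2) (C := (b n)⁻¹ ^ 2)
      fun x hx => ?_) (Eventually.of_forall fun x => sq_nonneg _)
      (Eventually.of_forall fun x hx => ⟨hTT₁.trans_lt hx.1, hx.2⟩)).trans htail
    rw [abs_of_nonneg (sq_nonneg _)]
    exact pow_le_pow_left₀ (zero_le_one.trans (h.one_le x)) hx.2 2
  have hCtail := mul_le_mul_of_nonneg_left htail' hC0
  rw [Real.dist_eq] at hn ⊢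
  rw [abs_le] at hP hQ
  rw [abs_lt] at hn ⊢
  constructor <;> linarith [hP.1, hP.2, hQ.1, hQ.2, hn.1, hn.2]

end RegularArray

theorem abs_sint_le_setIntegral {G : SignedMeasure S} {f g : S → ℝ} {s : Set S}
    (hs : MeasurableSet s) (hg : IntegrableOn g s G.variation) (hfg : ∀ x ∈ s, |f x| ≤ g x)
    (hf0 : ∀ x ∉ s, f x = 0) : |sint G f| ≤ ∫ x in s, g x ∂G.variation := by
  rw [← integral_indicator hs]
  refine (abs_sint_le _ _).trans (integral_mono_of_nonneg (Eventually.of_forall fun x =>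
    abs_nonneg _) (hg.integrable_indicator hs) (Eventually.of_forall fun x => ?_))
  by_cases hx : x ∈ s
  · simpa only [Set.indicator_of_mem hx] using hfg x hx
  · simp [Set.indicator_of_notMem hx, hf0 x hx]

theorem setIntegral_variation_add_le {G G' : SignedMeasure S} {F : S → ℝ} (hF0 : ∀ x, 0 ≤ F x)
    (hG : Integrable F G.variation) (hG' : Integrable F G'.variation) (s : Set S) :
    ∫ x in s, F x ∂(G + G').variation
      ≤ ∫ x in s, F x ∂G.variation + ∫ x in s, F x ∂G'.variation := by
  rw [← integral_add_measure hG.integrableOn hG'.integrableOn, ← Measure.restrict_add]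
  exact integral_mono_measure (Measure.restrict_mono le_rfl VectorMeasure.variation_add_le)
    (Eventually.of_forall hF0) (hG.add_measure hG').integrableOn

theorem mul_sq_le_of_le_inv {β t : ℝ} (hβ : 0 < β) (ht : 0 ≤ t) (h : t ≤ β⁻¹) :
    β * t ^ 2 ≤ t := by
  have : β * t ≤ 1 := by rwa [mul_comm, ← le_div_iff₀ hβ, one_div]
  nlinarith

theorem le_mul_sq_of_inv_le {β t : ℝ} (hβ : 0 < β) (h : β⁻¹ ≤ t) : t ≤ β * t ^ 2 := by
  have : 1 ≤ t * β := by rwa [← div_le_iff₀ hβ, one_div]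
  nlinarith [(inv_pos.2 hβ).trans_le h]

theorem tendsto_setIntegral_inv_lt_div {μ : Measure S} {b : ℕ → ℝ} (hb : Normalizing b)
    {F f : S → ℝ} (hFm : Measurable F) (hF2 : Integrable (fun x => F x ^ 2) μ) {C : ℝ}
    (hC : 0 ≤ C) (hfC : ∀ x, |f x| ≤ C * F x) :
    Tendsto (fun n => (∫ x in {x | (b n)⁻¹ < F x}, f x ∂μ) / b n) atTop (𝓝 0) := by
  have hlim := ((tendsto_setIntegral_gt_atTop hFm hF2).comp hb.tendsto_inv_atTop).const_mul C
  rw [mul_zero] at hlim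
  refine squeeze_zero_norm' ?_ hlim
  filter_upwards [eventually_ge_atTop 1] with n hn
  have hbn := hb.pos n hn
  rw [norm_div, Real.norm_eq_abs (b n), abs_of_pos hbn, div_le_iff₀ hbn, Function.comp_apply,
    mul_assoc, mul_comm _ (b n), ← integral_const_mul, ← integral_const_mul]
  refine norm_integral_le_of_norm_le ((hF2.const_mul _).const_mul _).integrableOn ?_
  refine (ae_restrict_iff' (measurableSet_lt measurable_const hFm)).2 (Eventually.of_forall
    fun x hx => (hfC x).trans ?_)
  exact mul_le_mul_of_nonneg_left (le_mul_sq_of_inv_le hbn (le_of_lt hx)) hC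

section Phi

variable {P : ProbabilityMeasure S} {b : ℕ → ℝ}

theorem continuous_sint {Φ : Set (S → ℝ)} {f : S → ℝ} (hf : f ∈ Φ) :
    Continuous fun G : Lambda0 Φ => sint (G : SignedMeasure S) f :=
  (continuous_apply (A := fun _ : Φ => ℝ) (⟨f, hf⟩ : Φ)).comp
    (continuous_induced_dom (f := pairing Φ))

theorem integrable_of_mem_Phi (hb : Normalizing b) {f : S → ℝ} (hf : f ∈ Phi P b) :
    Integrable f (P : Measure S) :=
  ((mem_Phi_iff hb).1 hf).2.1.integrable (by norm_num)

theorem integrable_variation_of_abs_le (G : Lambda0 (Phi P b))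
    {F f : S → ℝ} (hF : F ∈ Phi P b) (hf : Measurable f) {C : ℝ} (hfC : ∀ x, |f x| ≤ C * F x) :
    Integrable f (G : SignedMeasure S).variation :=
  integrable_of_abs_le ((G.2.2 F hF).const_mul C) hf hfC

end Phi

/-- The sequence of local alternatives `P_n = P + b_n H_n` with `H_n → H`, together with the
superexponential bound on the tails of `|H_n|` to which assumption B1 is reduced. -/
structure LocalAlternatives (P : ProbabilityMeasure S) (b : ℕ → ℝ) (Pn : ℕ → ProbabilityMeasure S)
    (Hn : ℕ → Lambda0 (Phi P b)) (H : Lambda0 (Phi P b)) : Prop where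
  eq_add : ∀ n, 1 ≤ n → (Pn n : Measure S).toSignedMeasure
    = (P : Measure S).toSignedMeasure + b n • (Hn n : SignedMeasure S)
  tendsto : Tendsto Hn atTop (𝓝 H)
  superSmall_variation : ∀ f ∈ Phi P b, SuperSmall b fun n => ENNReal.ofReal (n * b n) *
    (Hn n : SignedMeasure S).variation {x | (b n)⁻¹ < |f x|}

namespace LocalAlternatives

variable {P : ProbabilityMeasure S} {b : ℕ → ℝ} {Pn : ℕ → ProbabilityMeasure S}
  {Hn : ℕ → Lambda0 (Phi P b)} {H : Lambda0 (Phi P b)}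

theorem of_assumptions (hb : Normalizing b) (hA : AssumptionA P b Pn Hn H)
    (hB1 : AssumptionB1 P b Hn) : LocalAlternatives P b Pn Hn H where
  eq_add := hA.eq_add
  tendsto := hA.tendsto
  superSmall_variation f hf a := by
    have hlt : ∀ᶠ n : ℕ in atTop, (⨆ (m : ℕ) (_ : 1 ≤ m), scaledLog n (b n)
      (ENNReal.ofReal (n * b n) * (Hn m : SignedMeasure S).variation {x | (b n)⁻¹ < |f x|}))
        < ((-a : ℝ) : EReal) := by
      refine eventually_lt_of_limsup_lt ?_
      rw [hB1 f hf]
      exact EReal.bot_lt_coe _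
    filter_upwards [hlt, hb.eventually_speed_pos, eventually_ge_atTop 1] with n hn hpos hn1
    exact (scaledLog_le_iff hpos _ _).1 ((le_iSup₂_of_le n hn1 le_rfl).trans hn.le)

theorem tendsto_sint (hA : LocalAlternatives P b Pn Hn H) {f : S → ℝ} (hf : f ∈ Phi P b) :
    Tendsto (fun n => sint (Hn n : SignedMeasure S) f) atTop (𝓝 (sint (H : SignedMeasure S) f)) :=
  ((continuous_sint hf).tendsto H).comp hA.tendsto

theorem tendsto_sint_of_abs_le (hA : LocalAlternatives P b Pn Hn H) (hb : Normalizing b)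
    {F f : S → ℝ} (hF : F ∈ Phi P b) (hf : Measurable f) {C : ℝ} (hC : 0 < C)
    (hfC : ∀ x, |f x| ≤ C * F x) :
    Tendsto (fun n => sint (Hn n : SignedMeasure S) f) atTop
      (𝓝 (sint (H : SignedMeasure S) f)) := by
  have hmem : (fun x => C⁻¹ * f x) ∈ Phi P b := by
    refine mem_Phi_of_abs_le hb hF (hf.const_mul _) fun x => ?_
    rw [abs_mul, abs_of_pos (inv_pos.2 hC), inv_mul_le_iff₀ hC]
    exact (hfC x).trans (mul_le_mul_of_nonneg_left (le_abs_self _) hC.le)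
  have hscale : ∀ G : SignedMeasure S, sint G f = C * sint G (fun x => C⁻¹ * f x) := fun G => by
    rw [sint_const_mul, mul_inv_cancel_left₀ hC.ne']
  simp only [hscale]
  exact (hA.tendsto_sint hmem).const_mul C

theorem integral_eq (hA : LocalAlternatives P b Pn Hn H) {n : ℕ} (hn : 1 ≤ n) {f : S → ℝ}
    (hP : Integrable f (P : Measure S)) (hH : Integrable f (Hn n : SignedMeasure S).variation) :
    ∫ x, f x ∂(Pn n : Measure S) = ∫ x, f x ∂(P : Measure S) + b n * sint (Hn n) f := by
  rw [← sint_toSignedMeasure, hA.eq_add n hn, sint_add_left (by simpa using hP)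
    (VectorMeasure.Integrable.smul_vectorMeasure hH (b n)), sint_toSignedMeasure, sint_smul_left]

theorem measure_le (hA : LocalAlternatives P b Pn Hn H) (hb : Normalizing b) {n : ℕ}
    (hn : 1 ≤ n) {s : Set S} (hs : MeasurableSet s) :
    (Pn n : Measure S) s ≤ (P : Measure S) s
      + ENNReal.ofReal (b n) * (Hn n : SignedMeasure S).variation s := by
  have hbn := (hb.pos n hn).le
  have heq := congrArg (fun G : SignedMeasure S => G s) (hA.eq_add n hn)
  simp only [Measure.toSignedMeasure_apply_measurable hs, FunLike.coe_add, FunLike.coe_smul,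
    Pi.add_apply, Pi.smul_apply, smul_eq_mul] at heq
  have hle : (Hn n : SignedMeasure S) s ≤ (Hn n : SignedMeasure S).variation.real s :=
    (Real.le_norm_self _).trans (VectorMeasure.norm_measure_le_variation (measure_ne_top _ _))
  rw [← ofReal_measureReal (μ := (Pn n : Measure S)), ← ofReal_measureReal (μ := (P : Measure S)),
    ← ofReal_measureReal (μ := (Hn n : SignedMeasure S).variation), ← ENNReal.ofReal_mul hbn,
    ← ENNReal.ofReal_add measureReal_nonneg (mul_nonneg hbn measureReal_nonneg), heq]
  gcongr

theorem eventually_tail_le (hA : LocalAlternatives P b Pn Hn H) (hb : Normalizing b)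
    {F : S → ℝ} (hF : F ∈ Phi P b) (hF0 : ∀ x, 0 ≤ F x) {ε : ℝ} (hε : 0 < ε) :
    ∃ T : ℝ, ∀ᶠ n in atTop,
      ∫ x in {x | T < F x}, F x ∂(Hn n : SignedMeasure S).variation ≤ ε := by
  have hFm := ((mem_Phi_iff hb).1 hF).1
  obtain ⟨T₁, hT₁⟩ := eventually_tail_le_of_tendsto_zero hFm hF0
    (fun n => ((Hn n - H : Lambda0 (Phi P b)) : SignedMeasure S))
    (fun n => (Hn n - H).2.2 F hF) (fun h hh hle => by
      have hmem : h ∈ Phi P b := mem_Phi_of_abs_le hb hF hh fun x => (hle x).trans (le_abs_self _)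
      have hlim := (hA.tendsto_sint hmem).sub_const (sint (H : SignedMeasure S) h)
      rw [sub_self] at hlim
      refine hlim.congr fun n => ?_
      rw [Submodule.coe_sub, sint_sub_left ((Hn n).2.2 h hmem) (H.2.2 h hmem)]) (half_pos hε)
  obtain ⟨T, hT, hTT⟩ := (((tendsto_setIntegral_gt_atTop hFm (H.2.2 F hF)).eventually_le_const
    (half_pos hε)).and (eventually_ge_atTop T₁)).exists
  refine ⟨T, ?_⟩
  filter_upwards [hT₁] with n hn
  have hsplit : (Hn n : SignedMeasure S)
      = ((Hn n - H : Lambda0 (Phi P b)) : SignedMeasure S) + H := by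
    simp
  have hD := (Hn n - H).2.2 F hF
  rw [hsplit]
  calc _ ≤ _ := setIntegral_variation_add_le hF0 hD (H.2.2 F hF) _
    _ ≤ ε / 2 + ε / 2 := add_le_add ((setIntegral_mono_set hD.integrableOn
        (Eventually.of_forall hF0) (Eventually.of_forall fun x hx => hTT.trans_lt hx)).trans hn) hT
    _ = ε := add_halves ε

theorem superSmall_tail (hA : LocalAlternatives P b Pn Hn H) (hb : Normalizing b)
    {F : S → ℝ} (hF : F ∈ Phi P b) :
    SuperSmall b (fun n => (n : ℝ≥0∞) * (Pn n : Measure S) {x | (b n)⁻¹ < |F x|}) := by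
  obtain ⟨hFm, -, hFtail⟩ := (mem_Phi_iff hb).1 hF
  refine (hFtail.add hb (hA.superSmall_variation F hF)).mono ?_
  filter_upwards [eventually_ge_atTop 1] with n hn
  have hm : MeasurableSet {x | (b n)⁻¹ < |F x|} := measurableSet_lt measurable_const hFm.abs
  refine (mul_le_mul_right (hA.measure_le hb hn hm) _).trans ?_
  rw [mul_add, ← mul_assoc, ENNReal.ofReal_mul (by positivity), ENNReal.ofReal_natCast]

theorem tendsto_integral_of_bounded (hA : LocalAlternatives P b Pn Hn H) (hb : Normalizing b)
    {h : S → ℝ} (hm : Measurable h) {C : ℝ} (hC : ∀ x, |h x| ≤ C) :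
    Tendsto (fun n => ∫ x, h x ∂(Pn n : Measure S)) atTop (𝓝 (∫ x, h x ∂(P : Measure S))) := by
  have hmem : h ∈ Phi P b := mem_Phi_of_bounded hb hm hC
  have hlim := (hb.zero.mul (hA.tendsto_sint hmem)).const_add (∫ x, h x ∂(P : Measure S))
  rw [zero_mul, add_zero] at hlim
  refine hlim.congr' ?_
  filter_upwards [eventually_ge_atTop 1] with n hn
  exact (hA.integral_eq hn (integrable_of_mem_Phi hb hmem) ((Hn n).2.2 h hmem)).symm

theorem eventually_setIntegral_sq_le (hA : LocalAlternatives P b Pn Hn H) (hb : Normalizing b)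
    {F : S → ℝ} (hF : F ∈ Phi P b) (hF0 : ∀ x, 0 ≤ F x) {ε : ℝ} (hε : 0 < ε) :
    ∃ T : ℝ, ∀ᶠ n in atTop,
      ∫ x in {x | T < F x ∧ F x ≤ (b n)⁻¹}, F x ^ 2 ∂(Pn n : Measure S) ≤ ε := by
  obtain ⟨hFm, hF2, -⟩ := (mem_Phi_iff hb).1 hF
  obtain ⟨T₁, hT₁⟩ := hA.eventually_tail_le hb hF hF0 (half_pos hε)
  obtain ⟨T, hT, hTT⟩ := (((tendsto_setIntegral_gt_atTop hFm
    hF2.integrable_sq).eventually_le_const (half_pos hε)).and (eventually_ge_atTop T₁)).exists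
  refine ⟨T, ?_⟩
  filter_upwards [hT₁, eventually_ge_atTop 1] with n hn hn1
  have hbn := hb.pos n hn1
  set B : Set S := {x | T < F x ∧ F x ≤ (b n)⁻¹}
  have hB : MeasurableSet B :=
    (measurableSet_lt measurable_const hFm).inter (measurableSet_le hFm measurable_const)
  have hmem : B.indicator (fun x => F x ^ 2) ∈ Phi P b := by
    refine mem_Phi_of_bounded hb ((hFm.pow_const 2).indicator hB) (C := (b n)⁻¹ ^ 2) fun x => ?_
    by_cases hx : x ∈ B
    · rw [Set.indicator_of_mem hx, abs_of_nonneg (sq_nonneg _)]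
      exact pow_le_pow_left₀ (hF0 x) hx.2 2
    · rw [Set.indicator_of_notMem hx, abs_zero]
      positivity
  have hPB : ∫ x in B, F x ^ 2 ∂(P : Measure S) ≤ ε / 2 :=
    (setIntegral_mono_set hF2.integrable_sq.integrableOn
      (Eventually.of_forall fun x => sq_nonneg _) (Eventually.of_forall fun x hx => hx.1)).trans hT
  have hHB : b n * sint (Hn n) (B.indicator (fun x => F x ^ 2)) ≤ ε / 2 := by
    rw [← sint_const_mul]
    refine (le_abs_self _).trans ((abs_sint_le_setIntegral (measurableSet_lt measurable_const hFm)
      ((Hn n).2.2 F hF).integrableOn (fun x _ => ?_) fun x hx => ?_).trans hn)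
    · by_cases hx : x ∈ B
      · rw [Set.indicator_of_mem hx, abs_of_nonneg (by positivity)]
        exact mul_sq_le_of_le_inv hbn (hF0 x) hx.2
      · rw [Set.indicator_of_notMem hx, mul_zero, abs_zero]
        exact hF0 x
    · rw [Set.indicator_of_notMem fun hxB => hx (hTT.trans_lt hxB.1), mul_zero]
  rw [← integral_indicator hB, hA.integral_eq hn1 (integrable_of_mem_Phi hb hmem)
    ((Hn n).2.2 _ hmem), integral_indicator hB]
  linarith

theorem regularArray (hA : LocalAlternatives P b Pn Hn H) (hb : Normalizing b)
    {F : S → ℝ} (hF : F ∈ Phi P b) (hF1 : ∀ x, 1 ≤ F x) :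
    RegularArray (P : Measure S) b (fun n => (Pn n : Measure S)) F where
  normalizing := hb
  meas := ((mem_Phi_iff hb).1 hF).1
  one_le := hF1
  sq := ((mem_Phi_iff hb).1 hF).2.1.integrable_sq
  tail := by
    simpa only [abs_of_nonneg (zero_le_one.trans (hF1 _))] using hA.superSmall_tail hb hF
  unif _ hε := hA.eventually_setIntegral_sq_le hb hF (fun x => zero_le_one.trans (hF1 x)) hε
  bdd _ hm := fun ⟨_, hC⟩ => hA.tendsto_integral_of_bounded hb hm hC

theorem tendsto_sint_indicator_tail (hA : LocalAlternatives P b Pn Hn H) (hb : Normalizing b)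
    {F f : S → ℝ} (hF : F ∈ Phi P b) (hF0 : ∀ x, 0 ≤ F x) {C : ℝ} (hC : 0 < C)
    (hfC : ∀ x, |f x| ≤ C * F x) :
    Tendsto (fun n => sint (Hn n : SignedMeasure S) ({x | (b n)⁻¹ < F x}.indicator f))
      atTop (𝓝 0) := by
  have hFm := ((mem_Phi_iff hb).1 hF).1
  rw [Metric.tendsto_nhds]
  intro ε hε
  obtain ⟨T, hT⟩ := hA.eventually_tail_le hb hF hF0 (show 0 < ε / (2 * C) by positivity)
  filter_upwards [hT, hb.tendsto_inv_atTop.eventually_ge_atTop T] with n hn hTn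
  rw [Real.dist_eq, sub_zero]
  calc _ ≤ ∫ x in {x | T < F x}, C * F x ∂(Hn n : SignedMeasure S).variation :=
        abs_sint_le_setIntegral (measurableSet_lt measurable_const hFm)
          (((Hn n).2.2 F hF).const_mul C).integrableOn
          (fun x _ => (norm_indicator_le_norm_self f x).trans (hfC x))
          fun x hx => Set.indicator_of_notMem (show x ∉ {x | (b n)⁻¹ < F x} from
            fun h => hx (hTn.trans_lt h)) _
    _ = C * ∫ x in {x | T < F x}, F x ∂(Hn n : SignedMeasure S).variation :=
        integral_const_mul _ _
    _ ≤ C * (ε / (2 * C)) := mul_le_mul_of_nonneg_left hn hC.le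
    _ = ε / 2 := by field_simp
    _ < ε := half_lt_self hε

theorem tendsto_drift (hA : LocalAlternatives P b Pn Hn H) (hb : Normalizing b)
    {F f : S → ℝ} (hF : F ∈ Phi P b) (hF0 : ∀ x, 0 ≤ F x)
    (hf : Measurable f) {C : ℝ} (hC : 0 < C) (hfC : ∀ x, |f x| ≤ C * F x) :
    Tendsto (fun n => (∫ x in {x | F x ≤ (b n)⁻¹}, f x ∂(Pn n : Measure S)
      - ∫ x, f x ∂(P : Measure S)) / b n) atTop (𝓝 (sint (H : SignedMeasure S) f)) := by
  obtain ⟨hFm, hF2, -⟩ := (mem_Phi_iff hb).1 hF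
  have iP : Integrable f (P : Measure S) :=
    integrable_of_abs_le ((integrable_of_mem_Phi hb hF).const_mul C) hf hfC
  have hlim := ((hA.tendsto_sint_of_abs_le hb hF hf hC hfC).sub
    (hA.tendsto_sint_indicator_tail hb hF hF0 hC hfC)).sub
    (tendsto_setIntegral_inv_lt_div hb hFm hF2.integrable_sq hC.le hfC)
  rw [sub_zero, sub_zero] at hlim
  refine hlim.congr' ?_
  filter_upwards [eventually_ge_atTop 1] with n hn
  have hbn := hb.pos n hn
  have ht : MeasurableSet {x | F x ≤ (b n)⁻¹} := measurableSet_le hFm measurable_const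
  have hc : {x | (b n)⁻¹ < F x} = {x | F x ≤ (b n)⁻¹}ᶜ := by
    ext x
    simp
  have iH := integrable_variation_of_abs_le (Hn n) hF hf hfC
  have hsint : sint (Hn n : SignedMeasure S) ({x | F x ≤ (b n)⁻¹}.indicator f)
      = sint (Hn n : SignedMeasure S) f
        - sint (Hn n : SignedMeasure S) ({x | (b n)⁻¹ < F x}.indicator f) := by
    rw [hc, ← sint_sub iH (iH.indicator ht.compl), Set.indicator_compl]
    simp
  have integral_trunc := hA.integral_eq hn (iP.indicator ht) (iH.indicator ht)
  rw [integral_indicator ht, integral_indicator ht, hsint] at integral_trunc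
  rw [integral_trunc, ← integral_add_compl ht iP, ← hc]
  field_simp
  ring

end LocalAlternatives

/-! ### Chernoff bounds -/

theorem abs_exp_sub_one_sub_le (x : ℝ) : |Real.exp x - 1 - x| ≤ x ^ 2 * Real.exp |x| := by
  have h := Complex.norm_exp_sub_sum_le_norm_mul_exp (x : ℂ) 2
  simp only [Finset.sum_range_succ, Finset.sum_range_zero, pow_zero, Nat.factorial, pow_one,
    Nat.cast_one, div_one, zero_add, Nat.succ_eq_add_one, mul_one] at h
  rw [Complex.norm_real, Real.norm_eq_abs, sq_abs] at h
  rw [← Real.norm_eq_abs, ← Complex.norm_real]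
  push_cast
  rwa [sub_sub]

theorem abs_exp_mul_sub_one_div_sub_le {t β y C u : ℝ} (ht : 0 ≤ t) (hβ : 0 < β) (hu : 0 ≤ u)
    (hβu : β * u ≤ 1) (hy : |y| ≤ C * u ^ 2) :
    |(Real.exp (t * β ^ 2 * y) - 1) / β ^ 2 - t * y|
      ≤ t ^ 2 * C ^ 2 * Real.exp (t * |C|) * (β ^ 2 * u ^ 4) := by
  have hyC : |y| ≤ |C| * u ^ 2 :=
    hy.trans (mul_le_mul_of_nonneg_right (le_abs_self C) (sq_nonneg _))
  have hysq : y ^ 2 ≤ C ^ 2 * u ^ 4 := by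
    rw [← sq_abs, ← sq_abs C]
    calc |y| ^ 2 ≤ (|C| * u ^ 2) ^ 2 := pow_le_pow_left₀ (abs_nonneg _) hyC 2
      _ = |C| ^ 2 * u ^ 4 := by ring
  have hexponent : |t * β ^ 2 * y| ≤ t * |C| := by
    rw [abs_mul, abs_of_nonneg (by positivity)]
    have hone : (β * u) ^ 2 ≤ 1 := pow_le_one₀ (by positivity) hβu
    calc t * β ^ 2 * |y| ≤ t * β ^ 2 * (|C| * u ^ 2) := by gcongr
      _ = t * |C| * (β * u) ^ 2 := by ring
      _ ≤ t * |C| * 1 := by gcongr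
      _ = t * |C| := mul_one _
  have hrem : (Real.exp (t * β ^ 2 * y) - 1) / β ^ 2 - t * y
      = (Real.exp (t * β ^ 2 * y) - 1 - t * β ^ 2 * y) / β ^ 2 := by
    field_simp
  rw [hrem, abs_div, abs_of_pos (show 0 < β ^ 2 by positivity), div_le_iff₀ (by positivity)]
  calc _ ≤ (t * β ^ 2 * y) ^ 2 * Real.exp |t * β ^ 2 * y| := abs_exp_sub_one_sub_le _
    _ ≤ (t * β ^ 2 * y) ^ 2 * Real.exp (t * |C|) := by gcongr
    _ = t ^ 2 * β ^ 4 * y ^ 2 * Real.exp (t * |C|) := by ring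
    _ ≤ t ^ 2 * β ^ 4 * (C ^ 2 * u ^ 4) * Real.exp (t * |C|) := by gcongr
    _ = t ^ 2 * C ^ 2 * Real.exp (t * |C|) * (β ^ 2 * u ^ 4) * β ^ 2 := by ring

theorem abs_exp_sub_quadratic_le (x : ℝ) :
    |Real.exp x - 1 - x - x ^ 2 / 2| ≤ |x| ^ 3 * Real.exp |x| := by
  have h := Complex.norm_exp_sub_sum_le_norm_mul_exp (x : ℂ) 3
  simp only [Finset.sum_range_succ, Finset.sum_range_zero, pow_zero, Nat.factorial, pow_one,
    Nat.cast_one, div_one, zero_add, Nat.succ_eq_add_one, mul_one] at h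
  rw [Complex.norm_real, Real.norm_eq_abs] at h
  rw [← Real.norm_eq_abs, ← Complex.norm_real]
  push_cast
  convert h using 2
  push_cast
  ring

theorem pow_le_exp_mul_sub_one {a : ℝ} (ha : 0 ≤ a) (N : ℕ) :
    a ^ N ≤ Real.exp (N * (a - 1)) := by
  rw [Real.exp_nat_mul]
  exact pow_le_pow_left₀ ha (by linarith [Real.add_one_le_exp (a - 1)]) N

/-- The empirical mean of `f` over the sample `x`. -/
def avg {n : ℕ} (x : Fin n → S) (f : S → ℝ) : ℝ := (n : ℝ)⁻¹ * ∑ i, f (x i)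

theorem integral_empirical {n : ℕ} (x : Fin n → S) {f : S → ℝ} (hf : Measurable f) :
    ∫ y, f y ∂(empirical x) = avg x f := by
  rw [empirical, integral_smul_measure, integral_finsetSum_measure]
  · simp [avg, integral_dirac' _ _ hf.stronglyMeasurable]
  · exact fun i _ => integrable_dirac' hf.stronglyMeasurable (by simp)

theorem integrable_empirical {n : ℕ} (x : Fin n → S) {f : S → ℝ} (hf : Measurable f) :
    Integrable f (empirical x) := by
  rcases Nat.eq_zero_or_pos n with rfl | hn
  · simp [empirical]
  · refine Integrable.smul_measure ?_ (by simp [hn.ne'])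
    rw [integrable_finsetSum_measure]
    exact fun i _ => integrable_dirac' hf.stronglyMeasurable (by simp)

theorem measurable_avg {n : ℕ} {f : S → ℝ} (hf : Measurable f) :
    Measurable fun x : Fin n → S => avg x f :=
  (Finset.measurable_sum _ fun i _ => hf.comp (measurable_pi_apply i)).const_mul _

theorem natCast_mul_avg {S : Type*} {n : ℕ} (hn : 1 ≤ n) (x : Fin n → S) (f : S → ℝ) :
    (n : ℝ) * avg x f = ∑ i, f (x i) := by
  have : (n : ℝ) ≠ 0 := by positivity
  rw [avg, mul_inv_cancel_left₀ this]

theorem avg_congr {S : Type*} {n : ℕ} {x : Fin n → S} {f g : S → ℝ} (h : ∀ i, f (x i) = g (x i)) :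
    avg x f = avg x g := by
  simp [avg, h]

theorem avg_neg {S : Type*} {n : ℕ} (x : Fin n → S) (f : S → ℝ) :
    avg x (fun y => -f y) = -avg x f := by
  simp [avg]

theorem exp_add_sum {ι : Type*} [Fintype ι] (c : ℝ) (a : ι → ℝ) :
    Real.exp (c + ∑ i, a i) = Real.exp c * ∏ i, Real.exp (a i) := by
  rw [Real.exp_add, Real.exp_sum]

theorem lintegral_pi_exp {N : ℕ} (Q : Measure S) [IsProbabilityMeasure Q] {h : S → ℝ}
    (hexp : Integrable (fun x => Real.exp (h x)) Q) (c : ℝ) :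
    ∫⁻ x : Fin N → S, ENNReal.ofReal (Real.exp (c + ∑ i, h (x i))) ∂(Measure.pi fun _ => Q)
      = ENNReal.ofReal (Real.exp c * (∫ x, Real.exp (h x) ∂Q) ^ N) := by
  have hi : Integrable (fun x : Fin N → S => ∏ i, Real.exp (h (x i))) (Measure.pi fun _ => Q) :=
    Integrable.fintype_prod fun _ => hexp
  simp only [exp_add_sum]
  rw [← ofReal_integral_eq_lintegral_ofReal (hi.const_mul _)
    (Eventually.of_forall fun x => by positivity), integral_const_mul,
    integral_fintype_prod_eq_pow (fun x => Real.exp (h x)), Fintype.card_fin]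

theorem chernoff {N : ℕ} (Q : Measure S) [IsProbabilityMeasure Q] {h : S → ℝ}
    (hexp : Integrable (fun x => Real.exp (h x)) Q) (c : ℝ) :
    Measure.pi (fun _ : Fin N => Q) {x | c ≤ ∑ i, h (x i)}
      ≤ ENNReal.ofReal (Real.exp (-c + N * (∫ x, Real.exp (h x) ∂Q - 1))) := by
  have hmeas : AEMeasurable (fun x : Fin N → S =>
      ENNReal.ofReal (Real.exp (-c + ∑ i, h (x i)))) (Measure.pi fun _ => Q) := by
    simp only [exp_add_sum]
    refine ((Finset.aemeasurable_fun_prod _ fun i _ => ?_).const_mul _).ennreal_ofReal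
    exact hexp.aestronglyMeasurable.aemeasurable.comp_quasiMeasurePreserving
      (measurePreserving_eval (fun _ : Fin N => Q) i).quasiMeasurePreserving
  have hmarkov := mul_meas_ge_le_lintegral₀ hmeas 1
  rw [one_mul, lintegral_pi_exp Q hexp] at hmarkov
  refine ((measure_mono fun x hx => ?_).trans hmarkov).trans (ENNReal.ofReal_le_ofReal ?_)
  · have hx' : c ≤ ∑ i, h (x i) := hx
    exact ENNReal.one_le_ofReal.2 (Real.one_le_exp (by linarith))
  · rw [Real.exp_add]
    exact mul_le_mul_of_nonneg_left (pow_le_exp_mul_sub_one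
      (integral_nonneg fun _ => (Real.exp_pos _).le) N) (Real.exp_pos _).le

theorem integrable_exp_indicator {μ : Measure S} [IsFiniteMeasure μ] {s : Set S}
    (hs : MeasurableSet s) {h : S → ℝ} (hm : Measurable h) {C : ℝ} (hC : ∀ x ∈ s, |h x| ≤ C) :
    Integrable (fun x => Real.exp (s.indicator h x)) μ := by
  refine Integrable.of_bound (hm.indicator hs).exp.aestronglyMeasurable (Real.exp |C|)
    (Eventually.of_forall fun x => ?_)
  rw [Real.norm_eq_abs, Real.abs_exp]
  refine Real.exp_le_exp.2 ?_
  by_cases hx : x ∈ s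
  · rw [Set.indicator_of_mem hx]
    exact (le_abs_self _).trans ((hC x hx).trans (le_abs_self _))
  · rw [Set.indicator_of_notMem hx]
    positivity

theorem integral_exp_indicator_sub_one {μ : Measure S} [IsProbabilityMeasure μ] {s : Set S}
    (hs : MeasurableSet s) {h : S → ℝ} (hm : Measurable h) {C : ℝ} (hC : ∀ x ∈ s, |h x| ≤ C) :
    ∫ x, Real.exp (s.indicator h x) ∂μ - 1 = ∫ x in s, (Real.exp (h x) - 1) ∂μ := by
  have hone : (1 : ℝ) = ∫ _, (1 : ℝ) ∂μ := by simp
  conv_lhs => rw [hone]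
  rw [← integral_sub (integrable_exp_indicator hs hm hC) (integrable_const _),
    ← integral_indicator hs]
  refine integral_congr_ae (Eventually.of_forall fun x => ?_)
  by_cases hx : x ∈ s <;> simp [hx]

theorem pi_le_sum_indicator_le {N : ℕ} (μ : Measure S) [IsProbabilityMeasure μ] {s : Set S}
    (hs : MeasurableSet s) {ψ : S → ℝ} (hm : Measurable ψ) {C : ℝ} (hC : ∀ x ∈ s, |ψ x| ≤ C)
    (c : ℝ) {r : ℝ} (hr : 0 ≤ r) :
    Measure.pi (fun _ : Fin N => μ) {x | c ≤ ∑ i, s.indicator ψ (x i)}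
      ≤ ENNReal.ofReal (Real.exp (-(r * c) + N * ∫ x in s, (Real.exp (r * ψ x) - 1) ∂μ)) := by
  have hbound : ∀ x ∈ s, |r * ψ x| ≤ r * C := fun x hx => by
    rw [abs_mul, abs_of_nonneg hr]
    exact mul_le_mul_of_nonneg_left (hC x hx) hr
  have hm' : Measurable fun x => r * ψ x := hm.const_mul r
  rw [← integral_exp_indicator_sub_one hs hm' hbound]
  refine (measure_mono fun x hx => ?_).trans
    (chernoff μ (integrable_exp_indicator hs hm' hbound) (r * c))
  refine (mul_le_mul_of_nonneg_left hx hr).trans_eq ?_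
  rw [Finset.mul_sum]
  exact Finset.sum_congr rfl fun i _ => (Set.indicator_const_mul s ψ r (x i)).symm

theorem pi_exists_le {N : ℕ} (Q : Measure S) [IsProbabilityMeasure Q] (s : Set S) :
    Measure.pi (fun _ : Fin N => Q) {x | ∃ i, x i ∈ s} ≤ N * Q s := by
  have hcoord (i : Fin N) : Measure.pi (fun _ : Fin N => Q) {x | x i ∈ s} ≤ Q s := by
    rw [← measure_toMeasurable s, ← (measurePreserving_eval (fun _ : Fin N => Q) i).measure_preimage
      (measurableSet_toMeasurable _ _).nullMeasurableSet]
    exact measure_mono fun x hx => subset_toMeasurable _ _ hx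
  rw [Set.ofPred_exists]
  calc _ ≤ ∑ i, Measure.pi (fun _ : Fin N => Q) {x | x i ∈ s} := measure_iUnion_fintype_le _ _
    _ ≤ ∑ _i : Fin N, Q s := Finset.sum_le_sum fun i _ => hcoord i
    _ = N * Q s := by simp

/-- The filter of the sets of samples whose complement has superexponentially small probability;
its elements are samples of arbitrary size, so that `∀ᶠ w in superexp Q hb` also lets the sample
size `w.1` tend to infinity. -/
def superexp (Q : ℕ → Measure S) {b : ℕ → ℝ} (hb : Normalizing b) : Filter (Σ n, Fin n → S) where
  sets := {A | SuperSmall b fun n => Measure.pi (fun _ : Fin n => Q n) {x | ⟨n, x⟩ ∉ A}}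
  univ_sets := fun a => by simp [ExpBound]
  sets_of_superset := fun {A B} hA hAB => SuperSmall.mono hA
    (Eventually.of_forall fun n => measure_mono fun x hx hx' => hx (hAB hx'))
  inter_sets := fun {A B} hA hB => (SuperSmall.add hb hA hB).mono <| by
    refine Eventually.of_forall fun n => (measure_mono ?_).trans (measure_union_le _ _)
    intro x hx
    by_cases h : (⟨n, x⟩ : Σ n, Fin n → S) ∈ A
    · exact Or.inr fun h' => hx ⟨h, h'⟩
    · exact Or.inl h

theorem eventually_superexp_iff {Q : ℕ → Measure S} {b : ℕ → ℝ} {hb : Normalizing b}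
    {p : (Σ n, Fin n → S) → Prop} : (∀ᶠ w in superexp Q hb, p w) ↔
      SuperSmall b fun n => Measure.pi (fun _ : Fin n => Q n) {x | ¬ p ⟨n, x⟩} := Iff.rfl

theorem tendsto_fst_superexp (Q : ℕ → Measure S) {b : ℕ → ℝ} (hb : Normalizing b) :
    Tendsto Sigma.fst (superexp Q hb) atTop := by
  rw [tendsto_atTop]
  intro N
  rw [eventually_superexp_iff]
  intro a
  filter_upwards [eventually_ge_atTop N] with n hn
  simp [hn]

namespace RegularArray

variable {P : Measure S} {b : ℕ → ℝ} {Q : ℕ → Measure S} {F : S → ℝ}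

theorem mul_le_one (h : RegularArray P b Q F) {n : ℕ} (hn : 1 ≤ n) {x : S}
    (hx : F x ≤ (b n)⁻¹) : b n * F x ≤ 1 := by
  have hbn := h.normalizing.pos n hn
  have := mul_le_mul_of_nonneg_left hx hbn.le
  rwa [mul_inv_cancel₀ hbn.ne'] at this

theorem abs_le_of_le_sq (h : RegularArray P b Q F) {n : ℕ} {ψ : S → ℝ} {C : ℝ}
    (hψ : ∀ x, F x ≤ (b n)⁻¹ → |ψ x| ≤ C * F x ^ 2) {x : S} (hx : F x ≤ (b n)⁻¹) :
    |ψ x| ≤ |C| * (b n)⁻¹ ^ 2 :=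
  (hψ x hx).trans (mul_le_mul (le_abs_self _)
    (pow_le_pow_left₀ (zero_le_one.trans (h.one_le x)) hx 2) (sq_nonneg _) (abs_nonneg _))

variable [∀ n, IsProbabilityMeasure (Q n)]

theorem eventually_trunc (h : RegularArray P b Q F) :
    ∀ᶠ w in superexp Q h.normalizing, ∀ i, F (w.2 i) ≤ (b w.1)⁻¹ := by
  rw [eventually_superexp_iff]
  refine h.tail.mono (Eventually.of_forall fun n => ?_)
  refine le_trans (measure_mono fun x hx => ?_) (pi_exists_le (Q n) {x | (b n)⁻¹ < F x})
  simpa using hx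

theorem integrableOn_trunc (h : RegularArray P b Q F) {n : ℕ} {ψ : S → ℝ} {C : ℝ}
    (hψm : Measurable ψ) (hψ : ∀ x, F x ≤ (b n)⁻¹ → |ψ x| ≤ C * F x ^ 2) :
    IntegrableOn ψ {x | F x ≤ (b n)⁻¹} (Q n) :=
  integrableOn_of_bound (h.measurableSet_trunc n) hψm fun _ hx => h.abs_le_of_le_sq hψ hx

variable [IsProbabilityMeasure P]

theorem tendsto_setIntegral_exp (h : RegularArray P b Q F) {ψ : ℕ → S → ℝ} {C L : ℝ}
    (hψm : ∀ n, Measurable (ψ n))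
    (hψ : ∀ᶠ n in atTop, ∀ x, F x ≤ (b n)⁻¹ → |ψ n x| ≤ C * F x ^ 2)
    (hL : Tendsto (fun n => ∫ x in {x | F x ≤ (b n)⁻¹}, ψ n x ∂Q n) atTop (𝓝 L))
    {t : ℝ} (ht : 0 ≤ t) :
    Tendsto (fun n => ∫ x in {x | F x ≤ (b n)⁻¹}, (Real.exp (t * b n ^ 2 * ψ n x) - 1) / b n ^ 2
      ∂Q n) atTop (𝓝 (t * L)) := by
  set R : ℕ → S → ℝ := fun n x => (Real.exp (t * b n ^ 2 * ψ n x) - 1) / b n ^ 2 - t * ψ n x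
    with hR
  have hRm : ∀ n, Measurable (R n) := fun n =>
    ((((hψm n).const_mul _).exp.sub_const 1).div_const _).sub ((hψm n).const_mul t)
  set K : ℝ := t ^ 2 * C ^ 2 * Real.exp (t * |C|)
  have hK0 : 0 ≤ K := by positivity
  have hF0 : ∀ x, 0 ≤ F x := fun x => zero_le_one.trans (h.one_le x)
  have hRb : ∀ᶠ n in atTop, ∀ x, F x ≤ (b n)⁻¹ → |R n x| ≤ K * (b n ^ 2 * F x ^ 4) := by
    filter_upwards [hψ, eventually_ge_atTop 1] with n hn hn1 x hx
    exact abs_exp_mul_sub_one_div_sub_le ht (h.normalizing.pos n hn1) (hF0 x)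
      (h.mul_le_one hn1 hx) (hn x hx)
  have hRsq : ∀ᶠ n in atTop, ∀ x, F x ≤ (b n)⁻¹ → |R n x| ≤ K * F x ^ 2 := by
    filter_upwards [hRb, eventually_ge_atTop 1] with n hn hn1 x hx
    refine (hn x hx).trans (mul_le_mul_of_nonneg_left ?_ hK0)
    have hone : (b n * F x) ^ 2 ≤ 1 :=
      pow_le_one₀ (mul_nonneg (h.normalizing.pos n hn1).le (hF0 x)) (h.mul_le_one hn1 hx)
    calc b n ^ 2 * F x ^ 4 = (b n * F x) ^ 2 * F x ^ 2 := by ring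
      _ ≤ F x ^ 2 := mul_le_of_le_one_left (sq_nonneg _) hone
  have hR0 : Tendsto (fun n => ∫ x in {x | F x ≤ (b n)⁻¹}, R n x ∂Q n) atTop (𝓝 0) := by
    have hlim := h.tendsto_setIntegral (φ := fun _ => 0) hRm measurable_const hRsq
      (fun x => by simpa using mul_nonneg hK0 (sq_nonneg _)) fun T ε hε => ?_
    · simpa using hlim
    have hzero : Tendsto (fun n => K * (b n ^ 2 * T ^ 4)) atTop (𝓝 0) := by
      simpa using ((h.normalizing.zero.pow 2).mul_const (T ^ 4)).const_mul K
    filter_upwards [hRb, hzero.eventually_le_const hε,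
      h.normalizing.tendsto_inv_atTop.eventually_ge_atTop T] with n hn hnε hnT x hx
    rw [sub_zero]
    refine (hn x (hx.trans hnT)).trans (le_trans ?_ hnε)
    gcongr
    exact hF0 x
  have hsum := hR0.add (hL.const_mul t)
  rw [zero_add] at hsum
  refine hsum.congr' ?_
  filter_upwards [hψ, hRsq] with n hψn hRn
  rw [← integral_const_mul, ← integral_add (h.integrableOn_trunc (hRm n) hRn)
    ((h.integrableOn_trunc (hψm n) hψn).const_mul t)]
  simp only [hR, sub_add_cancel]

theorem superSmall_le_sum_indicator (h : RegularArray P b Q F) {ψ : ℕ → S → ℝ} {C L : ℝ}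
    (hψm : ∀ n, Measurable (ψ n))
    (hψ : ∀ᶠ n in atTop, ∀ x, F x ≤ (b n)⁻¹ → |ψ n x| ≤ C * F x ^ 2)
    (hL : Tendsto (fun n => ∫ x in {x | F x ≤ (b n)⁻¹}, ψ n x ∂Q n) atTop (𝓝 L))
    {δ : ℝ} (hδ : 0 < δ) :
    SuperSmall b fun n => Measure.pi (fun _ : Fin n => Q n)
      {x | n * (L + δ) ≤ ∑ i, {x | F x ≤ (b n)⁻¹}.indicator (ψ n) (x i)} := by
  intro a
  -- `t` is chosen so that the Chernoff exponent `t * L + t * (δ / 2) - t * (L + δ)` is below `a`.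
  set t : ℝ := 2 * (|a| + 1) / δ with ht
  have ht0 : 0 < t := by positivity
  have htδ : t * (δ / 2) = |a| + 1 := by
    rw [ht]
    field_simp
  filter_upwards [hψ, (h.tendsto_setIntegral_exp hψm hψ hL ht0.le).eventually_le_const
    (lt_add_of_pos_right (t * L) (mul_pos ht0 (half_pos hδ))), eventually_ge_atTop 1]
    with n hψn hexp hn
  have hbn := h.normalizing.pos n hn
  refine (pi_le_sum_indicator_le (Q n) (h.measurableSet_trunc n) (hψm n)
    (fun x hx => h.abs_le_of_le_sq hψn hx) _ (show 0 ≤ t * b n ^ 2 by positivity)).trans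
    (ENNReal.ofReal_le_ofReal (Real.exp_le_exp.2 ?_))
  rw [integral_div, div_le_iff₀ (by positivity)] at hexp
  calc _ ≤ -(t * b n ^ 2 * (n * (L + δ))) + n * ((t * L + t * (δ / 2)) * b n ^ 2) := by gcongr
    _ = n * b n ^ 2 * -(t * (δ / 2)) := by ring
    _ ≤ n * b n ^ 2 * -a := by
      rw [htδ]
      gcongr
      linarith [le_abs_self a]
    _ = _ := by ring

theorem eventually_avg_lt (h : RegularArray P b Q F) {ψ : ℕ → S → ℝ} {C L : ℝ}
    (hψm : ∀ n, Measurable (ψ n))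
    (hψ : ∀ᶠ n in atTop, ∀ x, F x ≤ (b n)⁻¹ → |ψ n x| ≤ C * F x ^ 2)
    (hL : Tendsto (fun n => ∫ x in {x | F x ≤ (b n)⁻¹}, ψ n x ∂Q n) atTop (𝓝 L))
    {δ : ℝ} (hδ : 0 < δ) :
    ∀ᶠ w in superexp Q h.normalizing, avg w.2 (ψ w.1) < L + δ := by
  have hsum : ∀ᶠ w in superexp Q h.normalizing,
      ¬ (((w.1 : ℝ) * (L + δ)) ≤ ∑ i, {x | F x ≤ (b w.1)⁻¹}.indicator (ψ w.1) (w.2 i)) := by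
    rw [eventually_superexp_iff]
    simpa only [not_not] using h.superSmall_le_sum_indicator hψm hψ hL hδ
  filter_upwards [hsum, h.eventually_trunc, (tendsto_fst_superexp Q h.normalizing).eventually
    (eventually_ge_atTop 1)] with w hlt htrunc hw
  rw [not_le, Finset.sum_congr rfl fun i _ =>
    Set.indicator_of_mem (s := {x | F x ≤ (b w.1)⁻¹}) (htrunc i) _, ← natCast_mul_avg hw] at hlt
  exact lt_of_mul_lt_mul_left hlt (Nat.cast_nonneg _)

theorem tendsto_avg (h : RegularArray P b Q F) {ψ : ℕ → S → ℝ} {C L : ℝ}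
    (hψm : ∀ n, Measurable (ψ n))
    (hψ : ∀ᶠ n in atTop, ∀ x, F x ≤ (b n)⁻¹ → |ψ n x| ≤ C * F x ^ 2)
    (hL : Tendsto (fun n => ∫ x in {x | F x ≤ (b n)⁻¹}, ψ n x ∂Q n) atTop (𝓝 L)) :
    Tendsto (fun w : Σ n, Fin n → S => avg w.2 (ψ w.1)) (superexp Q h.normalizing) (𝓝 L) := by
  rw [Metric.tendsto_nhds]
  intro δ hδ
  have h2 := h.eventually_avg_lt (ψ := fun n x => -ψ n x) (C := C) (L := -L)
    (fun n => (hψm n).neg) (by simpa using hψ) (by simpa [integral_neg] using hL.neg) hδ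
  filter_upwards [h.eventually_avg_lt hψm hψ hL hδ, h2] with w h3 h4
  rw [avg_neg] at h4
  rw [Real.dist_eq, abs_lt]
  constructor <;> linarith

theorem tendsto_setIntegral_const (h : RegularArray P b Q F) {ψ : S → ℝ} {C : ℝ}
    (hψm : Measurable ψ) (hψ : ∀ x, |ψ x| ≤ C * F x ^ 2) :
    Tendsto (fun n => ∫ x in {x | F x ≤ (b n)⁻¹}, ψ x ∂Q n) atTop (𝓝 (∫ x, ψ x ∂P)) :=
  h.tendsto_setIntegral (fun _ => hψm) hψm (Eventually.of_forall fun _ x _ => hψ x) hψ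
    fun T ε hε => Eventually.of_forall fun _ x _ => by simpa using hε.le

theorem tendsto_avg_const (h : RegularArray P b Q F) {ψ : S → ℝ} {C : ℝ}
    (hψm : Measurable ψ) (hψ : ∀ x, |ψ x| ≤ C * F x ^ 2) :
    Tendsto (fun w : Σ n, Fin n → S => avg w.2 ψ) (superexp Q h.normalizing)
      (𝓝 (∫ x, ψ x ∂P)) :=
  h.tendsto_avg (ψ := fun _ => ψ) (fun _ => hψm) (Eventually.of_forall fun _ x _ => hψ x)
    (h.tendsto_setIntegral_const hψm hψ)

end RegularArray

/-! ### The exponential bound for half-spaces -/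

theorem bootstrapKernel_apply {n k : ℕ} (x : Fin n → S) :
    bootstrapKernel S n k x = Measure.pi fun _ => empirical x := rfl

theorem avg_add {S : Type*} {n : ℕ} (x : Fin n → S) (f g : S → ℝ) :
    avg x (fun y => f y + g y) = avg x f + avg x g := by
  simp [avg, Finset.sum_add_distrib, mul_add]

theorem avg_const_mul {S : Type*} {n : ℕ} (x : Fin n → S) (c : ℝ) (f : S → ℝ) :
    avg x (fun y => c * f y) = c * avg x f := by
  simp only [avg, ← Finset.mul_sum]
  ring

theorem avg_const {S : Type*} {n : ℕ} (hn : 1 ≤ n) (x : Fin n → S) (c : ℝ) :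
    avg x (fun _ => c) = c := by
  have hn0 : (n : ℝ) ≠ 0 := by positivity
  simp [avg, hn0]

/-- The remainder of the first-order expansion of `exp (s * β * y)`, normalized by `β ^ 2` so that
it tends to `s ^ 2 / 2 * y ^ 2` as `β → 0`. -/
def expRemainder (β s y : ℝ) : ℝ := (Real.exp (s * β * y) - 1 - s * β * y) / β ^ 2

theorem exp_eq_expRemainder_add {β : ℝ} (hβ : β ≠ 0) (s y : ℝ) :
    Real.exp (s * β * y) = β ^ 2 * expRemainder β s y + (s * β * y + 1) := by
  rw [expRemainder]
  field_simp
  ring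

theorem measurable_expRemainder {f : S → ℝ} (hf : Measurable f) (β s : ℝ) :
    Measurable fun x => expRemainder β s (f x) :=
  (((hf.const_mul _).exp.sub_const 1).sub (hf.const_mul _)).div_const _

section

variable {β s M C y u : ℝ}

theorem abs_mul_mul_le (hβ : 0 ≤ β) (hs : |s| ≤ M) (hu : 0 ≤ u) (hy : |y| ≤ C * u) :
    |s * β * y| ≤ M * |C| * (β * u) := by
  rw [abs_mul, abs_mul, abs_of_nonneg hβ]
  have hM : 0 ≤ M := (abs_nonneg _).trans hs
  calc |s| * β * |y| ≤ M * β * (|C| * u) := by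
        gcongr
        exact hy.trans (mul_le_mul_of_nonneg_right (le_abs_self C) hu)
    _ = M * |C| * (β * u) := by ring

theorem abs_expRemainder_le (hβ : 0 < β) (hs : |s| ≤ M) (hu : 0 ≤ u) (hβu : β * u ≤ 1)
    (hy : |y| ≤ C * u) :
    |expRemainder β s y| ≤ M ^ 2 * C ^ 2 * Real.exp (M * |C|) * u ^ 2 := by
  have hM : 0 ≤ M := (abs_nonneg _).trans hs
  have hexponent := abs_mul_mul_le hβ.le hs hu hy
  rw [expRemainder, abs_div, abs_of_pos (show 0 < β ^ 2 by positivity),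
    div_le_iff₀ (by positivity)]
  calc _ ≤ |s * β * y| ^ 2 * Real.exp |s * β * y| := by
        rw [sq_abs]
        exact abs_exp_sub_one_sub_le _
    _ ≤ (M * |C| * (β * u)) ^ 2 * Real.exp (M * |C|) := by
        gcongr
        exact hexponent.trans (mul_le_of_le_one_right (by positivity) hβu)
    _ = M ^ 2 * C ^ 2 * Real.exp (M * |C|) * u ^ 2 * β ^ 2 := by
        rw [← sq_abs C]
        ring

theorem abs_expRemainder_sub_le (hβ : 0 < β) (hs : |s| ≤ M) (hu : 0 ≤ u) (hβu : β * u ≤ 1)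
    (hy : |y| ≤ C * u) :
    |expRemainder β s y - s ^ 2 / 2 * y ^ 2| ≤ (M * |C| * u) ^ 3 * Real.exp (M * |C|) * β := by
  have hM : 0 ≤ M := (abs_nonneg _).trans hs
  have hexponent := abs_mul_mul_le hβ.le hs hu hy
  have hrem : expRemainder β s y - s ^ 2 / 2 * y ^ 2
      = (Real.exp (s * β * y) - 1 - s * β * y - (s * β * y) ^ 2 / 2) / β ^ 2 := by
    rw [expRemainder]
    field_simp
  rw [hrem, abs_div, abs_of_pos (show 0 < β ^ 2 by positivity), div_le_iff₀ (by positivity)]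
  calc _ ≤ |s * β * y| ^ 3 * Real.exp |s * β * y| := abs_exp_sub_quadratic_le _
    _ ≤ (M * |C| * (β * u)) ^ 3 * Real.exp (M * |C|) := by
        gcongr
        exact hexponent.trans (mul_le_of_le_one_right (by positivity) hβu)
    _ = (M * |C| * u) ^ 3 * Real.exp (M * |C|) * β * β ^ 2 := by ring

end

theorem lintegral_pi_exp_sum_indicator_le {Q : Measure S} [IsProbabilityMeasure Q] {s : Set S}
    (hs : MeasurableSet s) {g : S → ℝ} (hg : Measurable g) {C : ℝ} (hgC : ∀ x ∈ s, |g x| ≤ C)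
    {β : ℝ} (hβ : β ≠ 0) (t c : ℝ) (n : ℕ) :
    ∫⁻ x : Fin n → S, ENNReal.ofReal (Real.exp (c + ∑ i, s.indicator (fun y => t * β * g y) (x i)))
      ∂(Measure.pi fun _ => Q) ≤ ENNReal.ofReal (Real.exp (c + n *
        (β ^ 2 * ∫ x in s, expRemainder β t (g x) ∂Q + t * β * ∫ x in s, g x ∂Q))) := by
  have hm : Measurable fun y => t * β * g y := hg.const_mul (t * β)
  have hbound : ∀ x ∈ s, |t * β * g x| ≤ |t * β| * C := fun x hx => by
    rw [abs_mul]
    exact mul_le_mul_of_nonneg_left (hgC x hx) (abs_nonneg _)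
  have ig : IntegrableOn g s Q := integrableOn_of_bound hs hg hgC
  have iexp : IntegrableOn (fun x => Real.exp (t * β * g x)) s Q :=
    integrableOn_of_bound hs hm.exp fun x hx => by
      rw [Real.abs_exp]
      exact Real.exp_le_exp.2 ((le_abs_self _).trans (hbound x hx))
  have irem : IntegrableOn (fun x => expRemainder β t (g x)) s Q :=
    ((iexp.sub (integrable_const 1)).sub (ig.const_mul (t * β))).div_const (β ^ 2)
  have hexpand : ∫ x in s, (Real.exp (t * β * g x) - 1) ∂Q
      = β ^ 2 * ∫ x in s, expRemainder β t (g x) ∂Q + t * β * ∫ x in s, g x ∂Q := by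
    rw [← integral_const_mul, ← integral_const_mul, ← integral_add (irem.const_mul _)
      (ig.const_mul _)]
    refine integral_congr_ae (Eventually.of_forall fun x => ?_)
    simp only [exp_eq_expRemainder_add hβ]
    ring
  rw [lintegral_pi_exp _ (integrable_exp_indicator hs hm hbound), ← hexpand,
    ← integral_exp_indicator_sub_one hs hm hbound, Real.exp_add]
  exact ENNReal.ofReal_le_ofReal (mul_le_mul_of_nonneg_left (pow_le_exp_mul_sub_one
    (integral_nonneg fun _ => (Real.exp_pos _).le) n) (Real.exp_pos _).le)

theorem bootstrap_chernoff {n k : ℕ} (hn : 1 ≤ n) (hk : 1 ≤ k) (x : Fin n → S) {f : S → ℝ}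
    (hf : Measurable f) {β s : ℝ} (hβ : 0 < β) (hs : 0 ≤ s) (z : ℝ) :
    bootstrapKernel S n k x {y | z ≤ avg y f - avg x f}
      ≤ ENNReal.ofReal (Real.exp
        (k * β ^ 2 * avg x (fun y => expRemainder β s (f y)) - k * s * β * z)) := by
  have : NeZero n := ⟨by omega⟩
  have hm : Measurable fun y => Real.exp (s * β * f y) := (hf.const_mul _).exp
  rw [bootstrapKernel_apply]
  refine (measure_mono fun y hy => ?_).trans ((chernoff (N := k) (empirical x)
    (h := fun y => s * β * f y) (integrable_empirical x hm)
    (k * s * β * (z + avg x f))).trans (le_of_eq ?_))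
  · have hy' : z + avg x f ≤ avg y f := by
      have : z ≤ avg y f - avg x f := hy
      linarith
    change _ ≤ ∑ i, s * β * f (y i)
    rw [← Finset.mul_sum, ← natCast_mul_avg hk]
    calc k * s * β * (z + avg x f) ≤ k * s * β * avg y f := by gcongr
      _ = s * β * (k * avg y f) := by ring
  · rw [integral_empirical x hm]
    simp only [exp_eq_expRemainder_add hβ.ne', avg_add, avg_const_mul, avg_const hn]
    ring_nf

theorem eventually_one_le_of_tendsto_div {k : ℕ → ℕ} {ν : ℝ} (hν : 0 < ν)
    (hk : Tendsto (fun n : ℕ => (k n : ℝ) / (n : ℝ)) atTop (𝓝 ν)) : ∀ᶠ n in atTop, 1 ≤ k n := by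
  filter_upwards [hk.eventually_const_lt hν] with n hn
  by_contra hkn
  simp [show k n = 0 by omega] at hn

theorem sampleLaw_le_add_lintegral (Q : ProbabilityMeasure S) {n : ℕ} (hn : 1 ≤ n) (k : ℕ)
    {E : Set ((Fin n → S) × (Fin k → S))} (hE : MeasurableSet E) (B : Set (Fin n → S))
    (φ : (Fin n → S) → ℝ≥0∞) (hφ : ∀ x ∉ B, bootstrapKernel S n k x (Prod.mk x ⁻¹' E) ≤ φ x) :
    sampleLaw Q n k E ≤ Measure.pi (fun _ : Fin n => (Q : Measure S)) B
      + ∫⁻ x, φ x ∂(Measure.pi fun _ : Fin n => (Q : Measure S)) := by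
  have : NeZero n := ⟨by omega⟩
  set π := Measure.pi fun _ : Fin n => (Q : Measure S)
  have hsplit (x : Fin n → S) :
      bootstrapKernel S n k x (Prod.mk x ⁻¹' E) ≤ (toMeasurable π B).indicator 1 x + φ x := by
    by_cases hx : x ∈ B
    · rw [Set.indicator_of_mem (subset_toMeasurable _ _ hx), bootstrapKernel_apply]
      exact le_add_right prob_le_one
    · exact le_add_left (hφ x hx)
  rw [sampleLaw, Measure.compProd_apply hE]
  refine (lintegral_mono hsplit).trans_eq ?_
  rw [lintegral_add_left (measurable_one.indicator (measurableSet_toMeasurable _ _)),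
    lintegral_indicator_one (measurableSet_toMeasurable _ _), measure_toMeasurable]

theorem measurableSet_halfspace {n k : ℕ} {f g : S → ℝ} (hf : Measurable f) (hg : Measurable g)
    (c m : ℝ) : MeasurableSet {w : (Fin n → S) × (Fin k → S) |
      c ≤ avg w.2 f - avg w.1 f + (avg w.1 g - m)} :=
  measurableSet_le measurable_const ((((measurable_avg hf).comp measurable_snd).sub
    ((measurable_avg hf).comp measurable_fst)).add
    (((measurable_avg hg).comp measurable_fst).sub_const _))

theorem sampleLaw_halfspace_le (Q : ProbabilityMeasure S) {n k : ℕ} (hn : 1 ≤ n) (hk : 1 ≤ k)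
    {s : Set S} (hs : MeasurableSet s) {f g : S → ℝ} (hf : Measurable f) (hg : Measurable g)
    {C : ℝ} (hgC : ∀ x ∈ s, |g x| ≤ C) {β t : ℝ} (hβ : 0 < β) (ht : 0 ≤ t) (c m r : ℝ) :
    sampleLaw Q n k {w | c * β ≤ avg w.2 f - avg w.1 f + (avg w.1 g - m)}
      ≤ Measure.pi (fun _ : Fin n => (Q : Measure S)) {x | ¬ ((∀ i, x i ∈ s) ∧
          avg x (fun y => expRemainder β (t * ((k : ℝ) / n)⁻¹) (f y)) < r)}
        + ENNReal.ofReal (Real.exp (n * β ^ 2 * ((k : ℝ) / n * r - t * c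
          + (∫ x in s, expRemainder β t (g x) ∂(Q : Measure S)
            + t * ((∫ x in s, g x ∂(Q : Measure S) - m) / β))))) := by
  have : (0 : ℝ) < n := by exact_mod_cast hn
  have : (0 : ℝ) < k := by exact_mod_cast hk
  -- With this tilt, the `k` resampled terms and the `n` original terms carry the same weight `t n`.
  set σ : ℝ := t * ((k : ℝ) / n)⁻¹ with hσ
  have hkσ : k * σ = t * n := by
    rw [hσ]
    field_simp
  set c₀ : ℝ := k * β ^ 2 * r - t * n * β * (c * β + m) with hc₀
  refine (sampleLaw_le_add_lintegral Q hn k (measurableSet_halfspace hf hg _ m) _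
    (fun x => ENNReal.ofReal (Real.exp (c₀ + ∑ i, s.indicator (fun y => t * β * g y) (x i))))
    fun x hx => ?_).trans (add_le_add le_rfl
      ((lintegral_pi_exp_sum_indicator_le hs hg hgC hβ.ne' t c₀ n).trans_eq ?_))
  · obtain ⟨hxs, hxr⟩ := not_not.1 hx
    have hsection : Prod.mk x ⁻¹' {w : (Fin n → S) × (Fin k → S) |
        c * β ≤ avg w.2 f - avg w.1 f + (avg w.1 g - m)}
        = {y | c * β - (avg x g - m) ≤ avg y f - avg x f} := by
      ext y
      simp only [Set.mem_preimage, Set.mem_ofPred_eq, sub_le_iff_le_add]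
    have hsum : ∑ i, s.indicator (fun y => t * β * g y) (x i) = t * β * (n * avg x g) := by
      rw [natCast_mul_avg hn, Finset.mul_sum]
      exact Finset.sum_congr rfl fun i _ => Set.indicator_of_mem (hxs i) _
    rw [hsection, hsum]
    refine (bootstrap_chernoff hn hk x hf hβ (show 0 ≤ σ by positivity) _).trans
      (ENNReal.ofReal_le_ofReal (Real.exp_le_exp.2 ?_))
    rw [hkσ, hc₀]
    calc _ ≤ k * β ^ 2 * r - t * n * β * (c * β - (avg x g - m)) := by gcongr
      _ = _ := by ring
  · rw [hc₀]
    congr 2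
    field_simp
    ring

namespace RegularArray

variable {P : Measure S} {b : ℕ → ℝ} {F : S → ℝ}

theorem eventually_abs_expRemainder_le {Q : ℕ → Measure S} (h : RegularArray P b Q F)
    {f : S → ℝ} {C : ℝ} (hfC : ∀ x, |f x| ≤ C * F x) {s : ℕ → ℝ} {M : ℝ}
    (hs : ∀ᶠ n in atTop, |s n| ≤ M) :
    ∀ᶠ n in atTop, ∀ x, F x ≤ (b n)⁻¹ →
      |expRemainder (b n) (s n) (f x)| ≤ M ^ 2 * C ^ 2 * Real.exp (M * |C|) * F x ^ 2 := by
  filter_upwards [hs, eventually_ge_atTop 1] with n hsn hn x hx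
  exact abs_expRemainder_le (h.normalizing.pos n hn) hsn (zero_le_one.trans (h.one_le x))
    (h.mul_le_one hn hx) (hfC x)

theorem eventually_abs_expRemainder_sub_le {Q : ℕ → Measure S} (h : RegularArray P b Q F)
    {f : S → ℝ} {C : ℝ} (hfC : ∀ x, |f x| ≤ C * F x) {s : ℕ → ℝ} {s₀ : ℝ}
    (hs : Tendsto s atTop (𝓝 s₀)) (T : ℝ) {ε : ℝ} (hε : 0 < ε) :
    ∀ᶠ n in atTop, ∀ x, F x ≤ T →
      |expRemainder (b n) (s n) (f x) - s₀ ^ 2 / 2 * f x ^ 2| ≤ ε := by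
  set M : ℝ := |s₀| + 1
  have hremainder : Tendsto (fun n => (M * |C| * T) ^ 3 * Real.exp (M * |C|) * b n)
      atTop (𝓝 0) := by
    simpa using h.normalizing.zero.const_mul ((M * |C| * T) ^ 3 * Real.exp (M * |C|))
  have hslope : Tendsto (fun n => |s n ^ 2 / 2 - s₀ ^ 2 / 2| * (C * T) ^ 2) atTop (𝓝 0) := by
    have hlim := ((((hs.pow 2).div_const 2).sub_const (s₀ ^ 2 / 2)).abs).mul_const ((C * T) ^ 2)
    rwa [sub_self, abs_zero, zero_mul] at hlim
  filter_upwards [hs.abs.eventually_le_const (lt_add_one |s₀|), eventually_ge_atTop 1,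
    hremainder.eventually_le_const (half_pos hε), hslope.eventually_le_const (half_pos hε),
    h.normalizing.tendsto_inv_atTop.eventually_ge_atTop T] with n hsn hn hrem hslope hnT x hx
  have hF := zero_le_one.trans (h.one_le x)
  have hbn := h.normalizing.pos n hn
  calc |expRemainder (b n) (s n) (f x) - s₀ ^ 2 / 2 * f x ^ 2|
      ≤ |expRemainder (b n) (s n) (f x) - s n ^ 2 / 2 * f x ^ 2|
        + |s n ^ 2 / 2 * f x ^ 2 - s₀ ^ 2 / 2 * f x ^ 2| := abs_sub_le _ _ _
    _ ≤ (M * |C| * T) ^ 3 * Real.exp (M * |C|) * b n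
        + |s n ^ 2 / 2 - s₀ ^ 2 / 2| * (C * T) ^ 2 := by
        refine add_le_add ((abs_expRemainder_sub_le hbn hsn hF (h.mul_le_one hn (hx.trans hnT))
          (hfC x)).trans (by gcongr)) ?_
        rw [← sub_mul, abs_mul, abs_pow, mul_pow, ← sq_abs C, ← mul_pow]
        gcongr
        exact (hfC x).trans (by gcongr; exact le_abs_self C)
    _ ≤ ε / 2 + ε / 2 := add_le_add hrem hslope
    _ = ε := add_halves ε

variable [IsProbabilityMeasure P]

theorem tendsto_setIntegral_expRemainder {Q : ℕ → Measure S} [∀ n, IsProbabilityMeasure (Q n)]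
    (h : RegularArray P b Q F) {f : S → ℝ} (hf : Measurable f)
    {C : ℝ} (hfC : ∀ x, |f x| ≤ C * F x) {s : ℕ → ℝ} {s₀ : ℝ} (hs : Tendsto s atTop (𝓝 s₀)) :
    Tendsto (fun n => ∫ x in {x | F x ≤ (b n)⁻¹}, expRemainder (b n) (s n) (f x) ∂Q n) atTop
      (𝓝 (s₀ ^ 2 / 2 * ∫ x, f x ^ 2 ∂P)) := by
  rw [← integral_const_mul]
  set M : ℝ := |s₀| + 1
  have hs₀ : s₀ ^ 2 ≤ M ^ 2 := by
    rw [← sq_abs]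
    gcongr
    exact (lt_add_one _).le
  refine h.tendsto_setIntegral (fun n => measurable_expRemainder hf _ _)
    ((hf.pow_const 2).const_mul _)
    (h.eventually_abs_expRemainder_le hfC (hs.abs.eventually_le_const (lt_add_one |s₀|)))
    (fun x => ?_) fun T ε hε =>
      h.eventually_abs_expRemainder_sub_le hfC hs T hε
  have hexp : 1 ≤ Real.exp (M * |C|) := Real.one_le_exp (by positivity)
  rw [abs_of_nonneg (by positivity)]
  calc s₀ ^ 2 / 2 * f x ^ 2 ≤ M ^ 2 * (C * F x) ^ 2 := by
        refine mul_le_mul (by linarith [sq_nonneg s₀]) ?_ (sq_nonneg _) (sq_nonneg _)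
        rw [← sq_abs]
        exact pow_le_pow_left₀ (abs_nonneg _) (hfC x) 2
    _ = M ^ 2 * C ^ 2 * 1 * F x ^ 2 := by ring
    _ ≤ _ := by gcongr

theorem expBound_halfspace {Pn : ℕ → ProbabilityMeasure S}
    (h : RegularArray P b (fun n => (Pn n : Measure S)) F) {f g : S → ℝ}
    (hf : Measurable f) (hg : Measurable g) {C : ℝ} (hfC : ∀ x, |f x| ≤ C * F x)
    (hgC : ∀ x, |g x| ≤ C * F x) {D : ℝ}
    (hD : Tendsto (fun n => (∫ x in {x | F x ≤ (b n)⁻¹}, g x ∂(Pn n : Measure S)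
      - ∫ x, g x ∂P) / b n) atTop (𝓝 D)) {k : ℕ → ℕ} {ν : ℝ} (hν : 0 < ν)
    (hk : Tendsto (fun n : ℕ => (k n : ℝ) / (n : ℝ)) atTop (𝓝 ν)) {t c a : ℝ} (ht : 0 ≤ t)
    (ha : a < t * (c - D) - t ^ 2 / 2 * ((∫ x, f x ^ 2 ∂P) / ν + ∫ x, g x ^ 2 ∂P)) :
    ExpBound b (fun n => sampleLaw (Pn n) n (k n)
      {w | c * b n ≤ avg w.2 f - avg w.1 f + (avg w.1 g - ∫ x, g x ∂P)}) a := by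
  set L : ℝ := (t / ν) ^ 2 / 2 * ∫ x, f x ^ 2 ∂P with hL
  set V : ℝ := ∫ x, g x ^ 2 ∂P
  have hs : Tendsto (fun n => t * ((k n : ℝ) / n)⁻¹) atTop (𝓝 (t / ν)) :=
    (hk.inv₀ hν.ne').const_mul t
  have hexponent : ν * L - t * c + (t ^ 2 / 2 * V + t * D) < -a := by
    have hνL : ν * L = t ^ 2 / 2 * ((∫ x, f x ^ 2 ∂P) / ν) := by
      rw [hL]
      field_simp
    rw [hνL]
    linarith
  obtain ⟨a', hlim, haa'⟩ := exists_between hexponent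
  obtain ⟨δ, hδ, hδa'⟩ : ∃ δ > 0, ν * (L + δ) - t * c + (t ^ 2 / 2 * V + t * D) < a' :=
    ⟨(a' - (ν * L - t * c + (t ^ 2 / 2 * V + t * D))) / (2 * ν), by
      have := sub_pos.2 hlim
      positivity, by
      field_simp
      linarith⟩
  have hgood := h.eventually_trunc.and (h.eventually_avg_lt
    (fun n => measurable_expRemainder hf (b n) _) (h.eventually_abs_expRemainder_le hfC
      (hs.abs.eventually_le_const (lt_add_one |t / ν|)))
    (h.tendsto_setIntegral_expRemainder hf hfC hs) hδ)
  rw [eventually_superexp_iff] at hgood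
  have hrate := ((hk.mul_const (L + δ)).sub_const (t * c)).add
    ((h.tendsto_setIntegral_expRemainder hg hgC (tendsto_const_nhds (x := t))).add
      (hD.const_mul t))
  refine ((hgood (-a')).add h.normalizing (a' := a)
    (q := fun n => ENNReal.ofReal (Real.exp (n * b n ^ 2 * a'))) ?_ (by linarith)).mono ?_
  · exact Eventually.of_forall fun n => by rw [neg_neg]
  filter_upwards [hrate.eventually_le_const hδa', eventually_one_le_of_tendsto_div hν hk,
    eventually_ge_atTop 1]
    with n hn hkn hn1
  refine (sampleLaw_halfspace_le (Pn n) hn1 hkn (h.measurableSet_trunc n) hf hg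
    (C := |C| * (b n)⁻¹) (fun x hx => (hgC x).trans ?_) (h.normalizing.pos n hn1) ht c _
    (L + δ)).trans (add_le_add le_rfl (ENNReal.ofReal_le_ofReal (Real.exp_le_exp.2
      (mul_le_mul_of_nonneg_left hn (by positivity)))))
  exact mul_le_mul (le_abs_self _) hx (zero_le_one.trans (h.one_le x)) (abs_nonneg _)

end RegularArray

/-! ### The linear span of the test functions -/

/-- The measurable functions dominated by a multiple of a test function that is at least `1`. This
is the linear span of `Φ`, which is itself not obviously closed under scalar multiplication. -/
def testSpace (P : ProbabilityMeasure S) {b : ℕ → ℝ} (hb : Normalizing b) :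
    Submodule ℝ (S → ℝ) where
  carrier := {f | Measurable f ∧ ∃ F ∈ Phi P b, (∀ x, 1 ≤ F x) ∧ ∃ C > 0, ∀ x, |f x| ≤ C * F x}
  zero_mem' := ⟨measurable_const, fun _ => 1,
    mem_Phi_of_bounded hb measurable_const (C := 1) (by simp), by simp, 1, one_pos, by simp⟩
  add_mem' := by
    rintro f g ⟨hf, F, hF, hF1, C, hC, hfC⟩ ⟨hg, G, hG, _, C', hC', hgC⟩
    refine ⟨hf.add hg, _, max_abs_mem_Phi hb hF hG, fun x => le_max_of_le_left ((hF1 x).trans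
      (le_abs_self _)), C + C', add_pos hC hC', fun x => (abs_add_le _ _).trans ?_⟩
    rw [add_mul]
    refine add_le_add ((hfC x).trans ?_) ((hgC x).trans ?_)
    · exact mul_le_mul_of_nonneg_left ((le_abs_self _).trans (le_max_left _ _)) hC.le
    · exact mul_le_mul_of_nonneg_left ((le_abs_self _).trans (le_max_right _ _)) hC'.le
  smul_mem' := by
    rintro c f ⟨hf, F, hF, hF1, C, hC, hfC⟩
    refine ⟨hf.const_smul c, F, hF, hF1, (|c| + 1) * C, by positivity, fun x => ?_⟩
    simp only [Pi.smul_apply, smul_eq_mul, abs_mul, mul_assoc]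
    exact mul_le_mul (by linarith) (hfC x) (abs_nonneg _) (by positivity)

namespace testSpace

variable {P : ProbabilityMeasure S} {b : ℕ → ℝ} {hb : Normalizing b}

theorem mem_of_mem_Phi {f : S → ℝ} (hf : f ∈ Phi P b) : f ∈ testSpace P hb := by
  obtain ⟨F, hF, hF1, hfF⟩ := exists_dominating_mem_Phi hb {f} (by simpa using hf)
  exact ⟨((mem_Phi_iff hb).1 hf).1, F, hF, hF1, 1, one_pos, by simpa using hfF⟩

theorem mem_of_bounded {f : S → ℝ} (hf : Measurable f) {C : ℝ} (hC : ∀ x, |f x| ≤ C) :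
    f ∈ testSpace P hb := mem_of_mem_Phi (mem_Phi_of_bounded hb hf hC)

theorem exists_dominating (f g : testSpace P hb) : ∃ F ∈ Phi P b, (∀ x, 1 ≤ F x) ∧
    ∃ C > 0, (∀ x, |(f : S → ℝ) x| ≤ C * F x) ∧ ∀ x, |(g : S → ℝ) x| ≤ C * F x := by
  obtain ⟨-, F, hF, hF1, C, hC, hfC⟩ := f.2
  obtain ⟨-, F', hF', hF1', C', _, hgC⟩ := g.2
  refine ⟨_, max_abs_mem_Phi hb hF hF', fun x => le_max_of_le_left ((hF1 x).trans (le_abs_self _)),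
    max C C', lt_max_of_lt_left hC, fun x => (hfC x).trans ?_, fun x => (hgC x).trans ?_⟩
  · exact mul_le_mul (le_max_left _ _) ((le_abs_self _).trans (le_max_left _ _))
      (zero_le_one.trans (hF1 x)) (hC.le.trans (le_max_left _ _))
  · exact mul_le_mul (le_max_right _ _) ((le_abs_self _).trans (le_max_right _ _))
      (zero_le_one.trans (hF1' x)) (hC.le.trans (le_max_left _ _))

theorem memLp (f : testSpace P hb) : MemLp (f : S → ℝ) 2 (P : Measure S) := by
  obtain ⟨hf, F, hF, _, C, _, hfC⟩ := f.2
  refine (((mem_Phi_iff hb).1 hF).2.1.const_mul C).mono hf.aestronglyMeasurable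
    (Eventually.of_forall fun x => (hfC x).trans (le_abs_self _))

theorem integrable_variation (f : testSpace P hb) (G : Lambda0 (Phi P b)) :
    Integrable (f : S → ℝ) (G : SignedMeasure S).variation := by
  obtain ⟨hf, F, hF, _, C, _, hfC⟩ := f.2
  exact integrable_variation_of_abs_le G hF hf hfC

/-- The map sending a test function to its class in `L²(P)`. -/
def toL2 (P : ProbabilityMeasure S) {b : ℕ → ℝ} (hb : Normalizing b) :
    testSpace P hb →ₗ[ℝ] Lp ℝ 2 (P : Measure S) where
  toFun f := (memLp f).toLp _
  map_add' _ _ := rfl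
  map_smul' _ _ := rfl

theorem inner_toL2 (g : Lp ℝ 2 (P : Measure S)) (f : testSpace P hb) :
    inner ℝ g (toL2 P hb f) = ∫ x, (f : S → ℝ) x * g x ∂(P : Measure S) := by
  rw [L2.inner_def]
  refine integral_congr_ae ?_
  filter_upwards [(memLp f).coeFn_toLp] with x hx
  change inner ℝ (g x) ((memLp f).toLp _ x) = _
  rw [hx]
  simp

theorem norm_toL2_sq (f : testSpace P hb) :
    ‖toL2 P hb f‖ ^ 2 = ∫ x, (f : S → ℝ) x ^ 2 ∂(P : Measure S) := by
  rw [← real_inner_self_eq_norm_sq, inner_toL2]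
  refine integral_congr_ae ?_
  filter_upwards [(memLp f).coeFn_toLp] with x hx
  change _ * (memLp f).toLp _ x = _
  rw [hx, sq]

theorem denseRange_toL2 : DenseRange (toL2 P hb) := by
  refine (Lp.simpleFunc.denseRange (E := ℝ) (μ := (P : Measure S)) (p := 2) (by simp)).mono ?_
  rintro _ ⟨f, rfl⟩
  have hm := (Lp.simpleFunc.toSimpleFunc f).measurable
  obtain ⟨C, hC⟩ := (Lp.simpleFunc.toSimpleFunc f).exists_forall_norm_le
  refine ⟨⟨_, mem_of_bounded hm hC⟩, ?_⟩
  refine Lp.ext ?_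
  refine (MemLp.coeFn_toLp (memLp (P := P) (hb := hb) ⟨_, mem_of_bounded hm hC⟩)).trans ?_
  exact Lp.simpleFunc.toSimpleFunc_eq_toFun f

theorem exists_eq_inner_toL2 (ξ : testSpace P hb →ₗ[ℝ] ℝ) {C : ℝ}
    (hξ : ∀ f, |ξ f| ≤ C * ‖toL2 P hb f‖) :
    ∃ g : Lp ℝ 2 (P : Measure S), ∀ f, ξ f = inner ℝ g (toL2 P hb f) := by
  refine ⟨(InnerProductSpace.toDual ℝ _).symm (ξ.extendOfNorm (toL2 P hb)), fun f => ?_⟩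
  rw [InnerProductSpace.toDual_symm_apply, LinearMap.extendOfNorm_eq denseRange_toL2 ⟨C, hξ⟩]

theorem norm_sq_le_of_inner_le {ν α : ℝ} (hν : 0 < ν) (hα : 0 ≤ α)
    {g₂ g₁ : Lp ℝ 2 (P : Measure S)}
    (h : ∀ f g : testSpace P hb, inner ℝ g₂ (toL2 P hb f) + inner ℝ g₁ (toL2 P hb g)
      ≤ √(2 * α * (‖toL2 P hb f‖ ^ 2 / ν + ‖toL2 P hb g‖ ^ 2))) :
    ν * ‖g₂‖ ^ 2 + ‖g₁‖ ^ 2 ≤ 2 * α := by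
  have hall : ∀ p : Lp ℝ 2 (P : Measure S) × Lp ℝ 2 (P : Measure S),
      inner ℝ g₂ p.1 + inner ℝ g₁ p.2 ≤ √(2 * α * (‖p.1‖ ^ 2 / ν + ‖p.2‖ ^ 2)) := by
    intro p
    refine (denseRange_toL2 (P := P) (hb := hb)).prodMap (denseRange_toL2 (P := P) (hb := hb))
      |>.induction_on p ?_ fun q => h q.1 q.2
    exact isClosed_le (by fun_prop) (by fun_prop)
  set X := ν * ‖g₂‖ ^ 2 + ‖g₁‖ ^ 2
  have le_sqrt : X ≤ √(2 * α * X) := by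
    have h := hall (ν • g₂, g₁)
    simp only [inner_smul_right, real_inner_self_eq_norm_sq, norm_smul, Real.norm_eq_abs, mul_pow,
      sq_abs] at h
    rwa [show ν ^ 2 * ‖g₂‖ ^ 2 / ν = ν * ‖g₂‖ ^ 2 by field_simp] at h
  have X_nonneg : 0 ≤ X := by positivity
  rcases X_nonneg.eq_or_lt with h0 | h0
  · rw [← h0]; positivity
  · have sq_le : X ^ 2 ≤ 2 * α * X := (Real.le_sqrt' h0).1 le_sqrt
    nlinarith

end testSpace

theorem rho0sq_withDensity {P : ProbabilityMeasure S} {g : S → ℝ}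
    (hg : MemLp g 2 (P : Measure S)) :
    rho0sq ((P : Measure S).withDensityᵥ g) P
      = ENNReal.ofReal (2⁻¹ * ∫ x, g x ^ 2 ∂(P : Measure S)) := by
  have hac := Measure.withDensityᵥ_absolutelyContinuous (P : Measure S) g
  have hgi : Integrable g (P : Measure S) := hg.integrable (by norm_num)
  rw [rho0sq, if_pos hac, ENNReal.ofReal_mul (by norm_num), ofReal_integral_eq_lintegral_ofReal
    hg.integrable_sq (Eventually.of_forall fun x => sq_nonneg _)]
  congr 1
  · rw [ENNReal.ofReal_inv_of_pos (by norm_num)]; simp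
  · refine lintegral_congr_ae ?_
    filter_upwards [(SignedMeasure.integrable_rnDeriv _ _).ae_eq_of_withDensityᵥ_eq hgi
      (SignedMeasure.withDensityᵥ_rnDeriv_eq _ _ hac)] with x hx
    rw [hx]

theorem rho0bsq_eq {P : ProbabilityMeasure S} {Φ : Set (S → ℝ)} {ν : ℝ} (hν : 0 < ν)
    {G : Lambda0 Φ × Lambda0 Φ} {g₂ g₁ : S → ℝ} (hg₂ : MemLp g₂ 2 (P : Measure S))
    (hg₁ : MemLp g₁ 2 (P : Measure S))
    (h₂ : (G.1 : SignedMeasure S) = (P : Measure S).withDensityᵥ g₂)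
    (h₁ : (G.2 : SignedMeasure S) = (P : Measure S).withDensityᵥ g₁) :
    rho0bsq ν P G = ENNReal.ofReal (2⁻¹ * (ν * ∫ x, g₂ x ^ 2 ∂(P : Measure S)
      + ∫ x, g₁ x ^ 2 ∂(P : Measure S))) := by
  rw [rho0bsq, h₂, h₁, rho0sq_withDensity hg₂, rho0sq_withDensity hg₁, ← ENNReal.ofReal_mul hν.le,
    ← ENNReal.ofReal_add (by positivity) (by positivity)]
  congr 1
  ring

theorem sint_one {G : SignedMeasure S} : sint G (fun _ => 1) = G Set.univ := by
  rw [sint, VectorMeasure.integral_const]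
  simp

theorem withDensity_mem_Lambda0 {P : ProbabilityMeasure S} {b : ℕ → ℝ} (hb : Normalizing b)
    {g : S → ℝ} (hg : MemLp g 2 (P : Measure S)) (h0 : ∫ x, g x ∂(P : Measure S) = 0) :
    (P : Measure S).withDensityᵥ g ∈ Lambda0 (Phi P b) := by
  have hgi : Integrable g (P : Measure S) := hg.integrable (by norm_num)
  refine ⟨?_, fun f hf => ?_⟩
  · rw [withDensityᵥ_apply hgi MeasurableSet.univ]
    simpa using h0
  · have hf' := (mem_Phi_iff hb).1 hf
    exact integrable_variation_withDensity hgi hf'.1 (hf'.2.1.integrable_mul hg)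

/-! ### Covering closed sets by half-spaces -/

theorem exists_tendsto_of_bounded {ι : Type*} (u : Ultrafilter ι) {f : ι → ℝ} {M : ℝ}
    (h : ∀ᶠ i in (u : Filter ι), |f i| ≤ M) : ∃ l, Tendsto f u (𝓝 l) := by
  obtain ⟨l, _, hl⟩ := (isCompact_Icc (a := -M) (b := M)).ultrafilter_le_nhds (u.map f) (by
    rw [le_principal_iff]
    exact h.mono fun i hi => abs_le.1 hi)
  exact ⟨l, hl⟩

theorem tendsto_Lambda0_iff {Φ : Set (S → ℝ)} {ι : Type*} {l : Filter ι} {G : ι → Lambda0 Φ}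
    {G₀ : Lambda0 Φ} : Tendsto G l (𝓝 G₀) ↔
      ∀ f ∈ Φ, Tendsto (fun i => sint (G i : SignedMeasure S) f) l
        (𝓝 (sint (G₀ : SignedMeasure S) f)) := by
  rw [nhds_induced, tendsto_comap_iff, tendsto_pi_nhds]
  exact ⟨fun h f hf => h ⟨f, hf⟩, fun h f => h f f.2⟩

theorem exists_ultrafilter_mem {X ι : Type*} {K : Set X} {U : ι → Set X}
    (h : ∀ s : Finset ι, ∃ x ∈ K, ∀ i ∈ s, x ∈ U i) :
    ∃ u : Ultrafilter X, K ∈ u ∧ ∀ i, U i ∈ u := by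
  have hne : NeBot ((⨅ i, 𝓟 (U i)) ⊓ 𝓟 K) := by
    refine ((hasBasis_iInf_principal_finite U).inf_principal K).neBot_iff.2 fun {t} ht => ?_
    obtain ⟨x, hxK, hx⟩ := h ht.toFinset
    exact ⟨x, Set.mem_iInter₂.2 fun i hi => hx i (ht.mem_toFinset.2 hi), hxK⟩
  obtain ⟨u, hu⟩ := Ultrafilter.exists_le ((⨅ i, 𝓟 (U i)) ⊓ 𝓟 K)
  exact ⟨u, le_principal_iff.1 (hu.trans inf_le_right),
    fun i => le_principal_iff.1 (hu.trans (inf_le_left.trans (iInf_le _ i)))⟩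

theorem sint_zero_right (G : SignedMeasure S) : sint G (0 : S → ℝ) = 0 :=
  VectorMeasure.integral_zero

section Cover

variable {P : ProbabilityMeasure S} {b : ℕ → ℝ} {hb : Normalizing b}

/-- Integration against `G` as a linear functional of the test function. -/
def sintLinear (G : Lambda0 (Phi P b)) : testSpace P hb →ₗ[ℝ] ℝ where
  toFun f := sint (G : SignedMeasure S) f
  map_add' f g := sint_add (testSpace.integrable_variation f G) (testSpace.integrable_variation g G)
  map_smul' c f := sint_const_mul (G : SignedMeasure S) c (f : S → ℝ)

theorem exists_linear_limit {ι V : Type*} [AddCommGroup V] [Module ℝ V] (u : Ultrafilter ι)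
    (L : ι → V →ₗ[ℝ] ℝ) {N : V → ℝ} (hN : ∀ v, N (-v) = N v)
    (h : ∀ (v : V) (c : ℝ), N v < c → ∀ᶠ i in (u : Filter ι), L i v < c) :
    ∃ ξ : V →ₗ[ℝ] ℝ, (∀ v, |ξ v| ≤ N v) ∧ ∀ v, Tendsto (fun i => L i v) u (𝓝 (ξ v)) := by
  have hlim : ∀ v, ∃ l, Tendsto (fun i => L i v) u (𝓝 l) := by
    intro v
    refine exists_tendsto_of_bounded u (M := N v + 1) ?_
    filter_upwards [h v _ (lt_add_one _), h (-v) _ (lt_add_one _)] with i h1 h2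
    rw [map_neg, hN] at h2
    exact abs_le.2 ⟨by linarith, h1.le⟩
  choose ξ hξ using hlim
  have le_N : ∀ v, ξ v ≤ N v := fun v => le_of_forall_gt_imp_ge_of_dense fun c hc =>
    le_of_tendsto (hξ v) ((h v c hc).mono fun i hi => hi.le)
  let ξL : V →ₗ[ℝ] ℝ :=
    { toFun := ξ
      map_add' := fun v w => tendsto_nhds_unique (hξ (v + w))
        (by simpa only [map_add] using (hξ v).add (hξ w))
      map_smul' := fun c v => tendsto_nhds_unique (hξ (c • v))
        (by simpa only [map_smul, RingHom.id_apply] using (hξ v).const_smul c) }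
  refine ⟨ξL, fun v => abs_le.2 ⟨?_, le_N v⟩, hξ⟩
  have neg_le : ξL (-v) ≤ N (-v) := le_N (-v)
  rw [map_neg, hN] at neg_le
  linarith

theorem exists_tendsto_withDensity {X : Type*} (u : Ultrafilter X)
    (m : X → Lambda0 (Phi P b)) {C : ℝ}
    (h : ∀ (f : testSpace P hb) (c : ℝ), C * ‖testSpace.toL2 P hb f‖ < c →
      ∀ᶠ i in (u : Filter X), sint (m i : SignedMeasure S) f < c) :
    ∃ (g : Lp ℝ 2 (P : Measure S)) (G : Lambda0 (Phi P b)),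
      (G : SignedMeasure S) = (P : Measure S).withDensityᵥ g ∧ Tendsto m u (𝓝 G) ∧
      ∀ f : testSpace P hb, Tendsto (fun i => sint (m i : SignedMeasure S) f) u
        (𝓝 (inner ℝ g (testSpace.toL2 P hb f))) := by
  obtain ⟨ξ, hξN, hξ⟩ := exists_linear_limit u (fun i => sintLinear (hb := hb) (m i))
    (N := fun f => C * ‖testSpace.toL2 P hb f‖) (fun f => by rw [map_neg, norm_neg]) h
  obtain ⟨g, hg⟩ := testSpace.exists_eq_inner_toL2 ξ hξN
  have hξg : ∀ f : testSpace P hb, Tendsto (fun i => sint (m i : SignedMeasure S) f) u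
      (𝓝 (inner ℝ g (testSpace.toL2 P hb f))) := fun f => hg f ▸ hξ f
  have mg : MemLp g 2 (P : Measure S) := Lp.memLp g
  have integral_zero : ∫ x, g x ∂(P : Measure S) = 0 := by
    have h1 := hξg ⟨fun _ => 1, testSpace.mem_of_bounded measurable_const (C := 1) (by simp)⟩
    have h2 : ∀ i, sint (m i : SignedMeasure S) (fun _ => 1) = 0 :=
      fun i => sint_one.trans (m i).2.1
    simp only [h2, testSpace.inner_toL2, one_mul] at h1
    exact tendsto_nhds_unique h1 tendsto_const_nhds
  refine ⟨g, ⟨_, withDensity_mem_Lambda0 hb mg integral_zero⟩, rfl, ?_, hξg⟩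
  rw [tendsto_Lambda0_iff]
  intro f hf
  have hf' := (mem_Phi_iff hb).1 hf
  have h1 := hξg ⟨f, testSpace.mem_of_mem_Phi hf⟩
  rw [testSpace.inner_toL2] at h1
  rwa [sint_withDensity (mg.integrable (by norm_num)) hf'.1 (hf'.2.1.integrable_mul mg)]

theorem exists_tendsto_rho0bsq_le {ν α : ℝ} (hν : 0 < ν) (hα : 0 ≤ α)
    (u : Ultrafilter (Lambda0 (Phi P b) × Lambda0 (Phi P b)))
    (hu : ∀ (f g : testSpace P hb) (c : ℝ),
      √(2 * α * (‖testSpace.toL2 P hb f‖ ^ 2 / ν + ‖testSpace.toL2 P hb g‖ ^ 2)) < c →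
      ∀ᶠ G in (u : Filter (Lambda0 (Phi P b) × Lambda0 (Phi P b))),
        sint (G.1 : SignedMeasure S) f + sint (G.2 : SignedMeasure S) g < c) :
    ∃ G, (u : Filter (Lambda0 (Phi P b) × Lambda0 (Phi P b))) ≤ 𝓝 G ∧
      rho0bsq ν P G ≤ ENNReal.ofReal α := by
  obtain ⟨g₂, G₂, hG₂, hconv₂, hlim₂⟩ := exists_tendsto_withDensity (hb := hb) u (fun G => G.1)
    (C := √(2 * α / ν)) fun f c hc => by
      filter_upwards [hu f 0 c (by
        rwa [map_zero, norm_zero, zero_pow two_ne_zero, add_zero, ← mul_div_assoc,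
          mul_div_right_comm, Real.sqrt_mul (by positivity), Real.sqrt_sq (norm_nonneg _)])]
        with G hG
      rwa [Submodule.coe_zero, sint_zero_right, add_zero] at hG
  obtain ⟨g₁, G₁, hG₁, hconv₁, hlim₁⟩ := exists_tendsto_withDensity (hb := hb) u (fun G => G.2)
    (C := √(2 * α)) fun f c hc => by
      filter_upwards [hu 0 f c (by
        rwa [map_zero, norm_zero, zero_pow two_ne_zero, zero_div, zero_add,
          Real.sqrt_mul (by positivity), Real.sqrt_sq (norm_nonneg _)])] with G hG
      rwa [Submodule.coe_zero, sint_zero_right, zero_add] at hG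
  refine ⟨(G₂, G₁), hconv₂.prodMk_nhds hconv₁, ?_⟩
  have norm_sq_le : ν * ‖g₂‖ ^ 2 + ‖g₁‖ ^ 2 ≤ 2 * α :=
    testSpace.norm_sq_le_of_inner_le hν hα (hb := hb) fun f g =>
      le_of_forall_gt_imp_ge_of_dense fun c hc =>
        le_of_tendsto ((hlim₂ f).add (hlim₁ g)) ((hu f g c hc).mono fun G hG => hG.le)
  have integral_sq : ∀ g : Lp ℝ 2 (P : Measure S), ∫ x, g x ^ 2 ∂(P : Measure S) = ‖g‖ ^ 2 := by
    intro g
    rw [← real_inner_self_eq_norm_sq, L2.inner_def]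
    simp [sq]
  rw [rho0bsq_eq hν (Lp.memLp g₂) (Lp.memLp g₁) hG₂ hG₁, integral_sq, integral_sq]
  exact ENNReal.ofReal_le_ofReal (by linarith)

theorem exists_halfspace_cover (hb : Normalizing b) {ν α : ℝ} (hν : 0 < ν) (hα : 0 ≤ α)
    {K : Set (Lambda0 (Phi P b) × Lambda0 (Phi P b))} (hK : IsClosed K)
    (hKα : ENNReal.ofReal α < rho0bsqSet ν P K) :
    ∃ s : Finset (testSpace P hb × testSpace P hb × ℝ),
      (∀ i ∈ s, √(2 * α * ((∫ x, (i.1 : S → ℝ) x ^ 2 ∂(P : Measure S)) / ν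
        + ∫ x, (i.2.1 : S → ℝ) x ^ 2 ∂(P : Measure S))) < i.2.2) ∧
      ∀ G ∈ K, ∃ i ∈ s, i.2.2 ≤ sint (G.1 : SignedMeasure S) i.1
        + sint (G.2 : SignedMeasure S) i.2.1 := by
  classical
  by_contra! hcon
  obtain ⟨u, huK, hu⟩ := exists_ultrafilter_mem (K := K)
    (ι := {i : testSpace P hb × testSpace P hb × ℝ // √(2 * α *
      ((∫ x, (i.1 : S → ℝ) x ^ 2 ∂(P : Measure S)) / ν
        + ∫ x, (i.2.1 : S → ℝ) x ^ 2 ∂(P : Measure S))) < i.2.2})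
    (U := fun i => {G | sint (G.1 : SignedMeasure S) i.1.1
      + sint (G.2 : SignedMeasure S) i.1.2.1 < i.1.2.2}) (fun s => by
    obtain ⟨G, hG, hGs⟩ := hcon (s.image Subtype.val) fun i hi => by
      obtain ⟨j, _, rfl⟩ := Finset.mem_image.1 hi
      exact j.2
    exact ⟨G, hG, fun i hi => hGs i.1 (Finset.mem_image_of_mem _ hi)⟩)
  obtain ⟨G, huG, hGα⟩ := exists_tendsto_rho0bsq_le (hb := hb) hν hα u fun f g c hc =>
    hu ⟨(f, g, c), by rwa [testSpace.norm_toL2_sq, testSpace.norm_toL2_sq] at hc⟩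
  have hGK : G ∈ K := isClosed_iff_ultrafilter.1 hK G u huG huK
  exact (hKα.trans_le (iInf₂_le G hGK)).not_ge hGα

end Cover

/-! ### The upper bound -/

section UpperBound

variable {P : ProbabilityMeasure S} {b : ℕ → ℝ} {Pn : ℕ → ProbabilityMeasure S}
  {Hn : ℕ → Lambda0 (Phi P b)} {H : Lambda0 (Phi P b)} {k : ℕ → ℕ} {ν : ℝ}

theorem sampleLaw_le_one (Q : ProbabilityMeasure S) (n k : ℕ)
    (s : Set ((Fin n → S) × (Fin k → S))) :
    sampleLaw Q n k s ≤ 1 := by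
  refine (measure_mono (Set.subset_univ s)).trans ?_
  rw [sampleLaw, Measure.compProd_apply MeasurableSet.univ]
  refine (lintegral_mono (g := fun _ => 1) fun x => ?_).trans (by simp)
  change Measure.pi (fun _ : Fin k => empirical x) _ ≤ 1
  refine (measure_mono (Set.subset_univ _)).trans ?_
  rw [Measure.pi_univ]
  exact Finset.prod_le_one' fun i _ => empirical_univ_le x

theorem exists_lt_mul_sub_sq {α c V : ℝ} (hα : 0 ≤ α) (hV : 0 ≤ V) (h : √(2 * α * V) < c) :
    ∃ t > 0, α < t * c - t ^ 2 / 2 * V := by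
  have hc : 0 < c := (Real.sqrt_nonneg _).trans_lt h
  rw [Real.sqrt_lt' hc] at h
  rcases hV.eq_or_lt with rfl | hV
  · refine ⟨(α + 1) / c, by positivity, ?_⟩
    rw [div_mul_cancel₀ _ hc.ne']
    linarith
  · refine ⟨c / V, by positivity, ?_⟩
    have optimum : c / V * c - (c / V) ^ 2 / 2 * V = c ^ 2 / (2 * V) := by field_simp; ring
    rw [optimum, lt_div_iff₀ (by positivity)]
    linarith

theorem testSpace.expBound_halfspace (hb : Normalizing b)
    (hA : LocalAlternatives P b Pn Hn H) (hν : 0 < ν)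
    (hk : Tendsto (fun n : ℕ => (k n : ℝ) / (n : ℝ)) atTop (𝓝 ν)) {α c : ℝ} (hα : 0 ≤ α)
    (f g : testSpace P hb)
    (hc : √(2 * α * ((∫ x, (f : S → ℝ) x ^ 2 ∂(P : Measure S)) / ν
        + ∫ x, (g : S → ℝ) x ^ 2 ∂(P : Measure S))) < c) :
    ∃ a > α, ExpBound b (fun n => sampleLaw (Pn n) n (k n)
      {w | (c + sint (H : SignedMeasure S) g) * b n
        ≤ avg w.2 f - avg w.1 f + (avg w.1 g - ∫ x, (g : S → ℝ) x ∂(P : Measure S))}) a := by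
  obtain ⟨F, hF, hF1, C, hC, hfC, hgC⟩ := testSpace.exists_dominating f g
  have hV : 0 ≤ (∫ x, (f : S → ℝ) x ^ 2 ∂(P : Measure S)) / ν
      + ∫ x, (g : S → ℝ) x ^ 2 ∂(P : Measure S) := by positivity
  obtain ⟨t, ht, htα⟩ := exists_lt_mul_sub_sq hα hV hc
  obtain ⟨a, ha, hat⟩ := exists_between htα
  refine ⟨a, ha, (hA.regularArray hb hF hF1).expBound_halfspace f.2.1 g.2.1 hfC hgC
    (hA.tendsto_drift hb hF (fun x => zero_le_one.trans (hF1 x)) g.2.1 hC hgC) hν hk ht.le ?_⟩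
  rwa [add_sub_cancel_right]

theorem mul_sint_of_sub_eq {μ₂ μ₁ : Measure S} [IsFiniteMeasure μ₂] [IsFiniteMeasure μ₁]
    {G : SignedMeasure S} {β : ℝ} (h : μ₂.toSignedMeasure - μ₁.toSignedMeasure = β • G)
    {f : S → ℝ} (h₂ : Integrable f μ₂) (h₁ : Integrable f μ₁) :
    β * sint G f = ∫ x, f x ∂μ₂ - ∫ x, f x ∂μ₁ := by
  rw [← sint_smul_left, ← h, sint_sub_left (by simpa using h₂) (by simpa using h₁),
    sint_toSignedMeasure, sint_toSignedMeasure]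

theorem le_of_mem_deviationEvent (hb : Normalizing b) {β : ℝ} (hβ : 0 < β) {n k : ℕ}
    {Ω : Set (Lambda0 (Phi P b) × Lambda0 (Phi P b))} {w : (Fin n → S) × (Fin k → S)}
    (hw : w ∈ deviationEvent P β Ω n k) :
    ∃ G ∈ (fun G => G - (0, H)) '' Ω, ∀ (f g : testSpace P hb) (c : ℝ),
      c ≤ sint (G.1 : SignedMeasure S) f + sint (G.2 : SignedMeasure S) g →
      (c + sint (H : SignedMeasure S) g) * β
        ≤ avg w.2 f - avg w.1 f + (avg w.1 g - ∫ x, (g : S → ℝ) x ∂(P : Measure S)) := by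
  obtain ⟨G, hG, eq_fst, eq_snd⟩ := hw
  refine ⟨_, ⟨G, hG, rfl⟩, fun f g c hc => ?_⟩
  have mul_sint_fst :=
    mul_sint_of_sub_eq eq_fst (integrable_empirical _ f.2.1) (integrable_empirical _ f.2.1)
  have mul_sint_snd := mul_sint_of_sub_eq eq_snd (integrable_empirical _ g.2.1)
    ((testSpace.memLp g).integrable (by norm_num))
  rw [integral_empirical _ f.2.1, integral_empirical _ f.2.1] at mul_sint_fst
  rw [integral_empirical _ g.2.1] at mul_sint_snd
  have sint_snd_sub : sint ((G - (0, H)).2 : SignedMeasure S) g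
      = sint (G.2 : SignedMeasure S) g - sint (H : SignedMeasure S) g :=
    sint_sub_left (testSpace.integrable_variation g G.2) (testSpace.integrable_variation g H)
  have fst_sub : (G - (0, H)).1 = G.1 := sub_zero G.1
  rw [sint_snd_sub, fst_sub] at hc
  rw [← mul_sint_fst, ← mul_sint_snd, ← mul_add, mul_comm]
  exact mul_le_mul_of_nonneg_left (by linarith) hβ.le

theorem limsup_scaledLog_le (hb : Normalizing b) (hA : LocalAlternatives P b Pn Hn H)
    (hν : 0 < ν)
    (hk : Tendsto (fun n : ℕ => (k n : ℝ) / (n : ℝ)) atTop (𝓝 ν))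
    (Ω : Set (Lambda0 (Phi P b) × Lambda0 (Phi P b))) :
    limsup (fun n : ℕ => scaledLog n (b n) (sampleLaw (Pn n) n (k n)
      (deviationEvent P (b n) Ω n (k n)))) atTop
        ≤ -((rho0bsqSet ν P (closure ((fun G => G - (0, H)) '' Ω)) : ℝ≥0∞) : EReal) := by
  rw [← EReal.le_of_forall_lt_iff_le]
  intro z hz
  suffices h : ExpBound b (fun n => sampleLaw (Pn n) n (k n)
      (deviationEvent P (b n) Ω n (k n))) (-z) by
    refine limsup_le_of_le (by isBoundedDefault) ?_
    filter_upwards [h, hb.eventually_speed_pos] with n hn hpos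
    rw [scaledLog_le_iff hpos]
    simpa using hn
  rcases le_or_gt 0 z with hz0 | hz0
  · refine Eventually.of_forall fun n => (sampleLaw_le_one _ _ _ _).trans ?_
    rw [neg_neg, ENNReal.one_le_ofReal, Real.one_le_exp_iff]
    positivity
  · have hα : ENNReal.ofReal (-z) < rho0bsqSet ν P (closure ((fun G => G - (0, H)) '' Ω)) := by
      rw [EReal.neg_lt_comm] at hz
      rw [← EReal.coe_ennreal_lt_coe_ennreal_iff, EReal.coe_ennreal_ofReal,
        max_eq_left (by linarith)]
      simpa using hz
    obtain ⟨s, hs, hcover⟩ := exists_halfspace_cover hb hν (by linarith) isClosed_closure hα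
    obtain ⟨a, ha, hbound⟩ := ExpBound.finset_sum hb s fun i hi =>
      testSpace.expBound_halfspace hb hA hν hk (by linarith) i.1 i.2.1 (hs i hi)
    refine (hbound.anti ha.le).mono ?_
    filter_upwards [hb.eventually_pos] with n hn
    refine (measure_mono fun w hw => ?_).trans (measure_biUnion_finset_le s _)
    obtain ⟨G, hG, hGle⟩ := le_of_mem_deviationEvent (H := H) hb hn hw
    obtain ⟨i, hi, hGi⟩ := hcover G (subset_closure hG)
    exact Set.mem_iUnion₂.2 ⟨i, hi, hGle _ _ _ hGi⟩

end UpperBound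

/-! ### Exponential tilting of product measures -/

theorem pi_tilted {N : ℕ} (Q : Measure S) [IsProbabilityMeasure Q] {h : S → ℝ}
    (hexp : Integrable (fun x => Real.exp (h x)) Q) :
    Measure.pi (fun _ : Fin N => Q.tilted h) = (Measure.pi fun _ : Fin N => Q).withDensity
      fun x => ENNReal.ofReal (∏ i, (Real.exp (h (x i)) / ∫ y, Real.exp (h y) ∂Q)) := by
  have := isProbabilityMeasure_tilted hexp
  refine Measure.pi_eq fun s hs => ?_
  rw [withDensity_apply _ (MeasurableSet.univ_pi hs), Measure.restrict_pi_pi,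
    ← ofReal_integral_eq_lintegral_ofReal]
  · rw [integral_fintype_prod_eq_prod
      (f := fun (_ : Fin N) y => Real.exp (h y) / ∫ y, Real.exp (h y) ∂Q),
      ENNReal.ofReal_prod_of_nonneg]
    · exact Finset.prod_congr rfl fun i _ => (tilted_apply_eq_ofReal_integral' h (hs i)).symm
    · exact fun i _ => integral_nonneg fun y => by positivity
  · exact Integrable.fintype_prod
      (f := fun (_ : Fin N) y => Real.exp (h y) / ∫ y, Real.exp (h y) ∂Q)
      fun i => (hexp.div_const _).restrict
  · exact Eventually.of_forall fun x => Finset.prod_nonneg fun i _ => by positivity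

theorem pi_tilted_le {N : ℕ} (Q : Measure S) [IsProbabilityMeasure Q] {h : S → ℝ}
    (hexp : Integrable (fun x => Real.exp (h x)) Q) {E : Set (Fin N → S)} (hE : MeasurableSet E)
    {R : ℝ} (hR : ∀ x ∈ E, ∑ i, h (x i) - N * Real.log (∫ y, Real.exp (h y) ∂Q) ≤ R) :
    Measure.pi (fun _ : Fin N => Q.tilted h) E
      ≤ ENNReal.ofReal (Real.exp R) * Measure.pi (fun _ : Fin N => Q) E := by
  have hZ : 0 < ∫ y, Real.exp (h y) ∂Q := integral_exp_pos hexp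
  rw [pi_tilted Q hexp, withDensity_apply _ hE, ← setLIntegral_const]
  refine setLIntegral_mono measurable_const fun x hx => ENNReal.ofReal_le_ofReal ?_
  rw [Finset.prod_div_distrib, ← Real.exp_sum, Finset.prod_const, Finset.card_univ,
    Fintype.card_fin, div_le_iff₀ (by positivity), ← Real.exp_log (pow_pos hZ N), ← Real.exp_add,
    Real.log_pow, Real.exp_le_exp]
  linarith [hR x hx]

theorem chebyshev_avg {N : ℕ} (hN : 1 ≤ N) (Q : Measure S) [IsProbabilityMeasure Q] {φ : S → ℝ}
    (hφ : MemLp φ 2 Q) {t : ℝ} (ht : 0 < t) :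
    Measure.pi (fun _ : Fin N => Q) {x | t ≤ |avg x φ - ∫ y, φ y ∂Q|}
      ≤ ENNReal.ofReal ((∫ y, φ y ^ 2 ∂Q) / (N * t ^ 2)) := by
  have hN0 : (0 : ℝ) < N := by positivity
  have hφi : ∀ i : Fin N, MemLp (fun x : Fin N → S => φ (x i)) 2 (Measure.pi fun _ => Q) :=
    fun i => hφ.comp_measurePreserving (measurePreserving_eval (fun _ : Fin N => Q) i)
  have memLp_sum : MemLp (∑ i, fun x : Fin N → S => φ (x i)) 2 (Measure.pi fun _ => Q) :=
    memLp_finsetSum' _ fun i _ => hφi i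
  have mean_sum : ∫ x : Fin N → S, (∑ i, fun x : Fin N → S => φ (x i)) x ∂(Measure.pi fun _ => Q)
      = N * ∫ y, φ y ∂Q := by
    simp only [Finset.sum_apply]
    rw [integral_finsetSum _ fun i _ => (hφi i).integrable (by norm_num)]
    have integral_eval : ∀ i, ∫ x : Fin N → S, φ (x i) ∂(Measure.pi fun _ => Q) = ∫ y, φ y ∂Q :=
      fun i => integral_comp_eval (μ := fun _ : Fin N => Q) hφ.aestronglyMeasurable
    simp [integral_eval]
  have chebyshev := meas_ge_le_variance_div_sq memLp_sum (c := N * t) (by positivity)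
  rw [mean_sum, variance_sum_pi (μ := fun _ : Fin N => Q) (X := fun _ => φ) fun _ => hφ]
    at chebyshev
  refine (measure_mono fun x hx => ?_).trans (chebyshev.trans (ENNReal.ofReal_le_ofReal ?_))
  · have hx' : t ≤ |avg x φ - ∫ y, φ y ∂Q| := hx
    have sum_sub : (∑ i, fun x : Fin N → S => φ (x i)) x - N * ∫ y, φ y ∂Q
        = N * (avg x φ - ∫ y, φ y ∂Q) := by
      rw [mul_sub, natCast_mul_avg hN]
      simp
    change N * t ≤ |_ - _|
    rw [sum_sub, abs_mul, abs_of_pos hN0]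
    gcongr
  · simp only [Finset.sum_const, Finset.card_univ, Fintype.card_fin, nsmul_eq_mul]
    calc N * variance φ Q / (N * t) ^ 2 = variance φ Q / (N * t ^ 2) := by field_simp
      _ ≤ _ := by
        gcongr
        exact variance_le_expectation_sq hφ.aestronglyMeasurable

section TiltedMoments

variable {Q : Measure S} {g φ : S → ℝ} {M β : ℝ}

theorem integrable_exp_mul_mul (hφ : Integrable φ Q) (hg : Measurable g) (hM : ∀ x, |g x| ≤ M)
    (hβ : 0 ≤ β) : Integrable (fun x => Real.exp (β * g x) * φ x) Q := by
  refine hφ.bdd_mul (c := Real.exp (β * M)) (by fun_prop) (Eventually.of_forall fun x => ?_)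
  rw [Real.norm_eq_abs, Real.abs_exp, Real.exp_le_exp]
  exact mul_le_mul_of_nonneg_left ((le_abs_self _).trans (hM x)) hβ

theorem integrable_exp_mul [IsFiniteMeasure Q] (hg : Measurable g) (hM : ∀ x, |g x| ≤ M)
    (hβ : 0 ≤ β) : Integrable (fun x => Real.exp (β * g x)) Q := by
  simpa only [mul_one] using integrable_exp_mul_mul (integrable_const (1 : ℝ)) hg hM hβ

theorem abs_mul_le_mul_of_abs_le {x : ℝ} (hx : |x| ≤ M) (hβ : 0 ≤ β) : |β * x| ≤ β * M := by
  rw [abs_mul, abs_of_nonneg hβ]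
  exact mul_le_mul_of_nonneg_left hx hβ

theorem abs_integral_exp_sub_quadratic_le [IsProbabilityMeasure Q] (hg : Measurable g)
    (hM : ∀ x, |g x| ≤ M) (hβ : 0 ≤ β) (hβM : β * M ≤ 1) (h0 : ∫ x, g x ∂Q = 0) :
    |∫ x, Real.exp (β * g x) ∂Q - 1 - β ^ 2 / 2 * ∫ x, g x ^ 2 ∂Q|
      ≤ (β * M) ^ 3 * Real.exp 1 := by
  have ig : Integrable g Q := Integrable.of_bound (by fun_prop) M (Eventually.of_forall hM)
  have ig2 : Integrable (fun x => g x ^ 2) Q := by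
    refine Integrable.of_bound (by fun_prop) (M ^ 2) (Eventually.of_forall fun x => ?_)
    rw [Real.norm_eq_abs, abs_pow]
    exact pow_le_pow_left₀ (abs_nonneg _) (hM x) 2
  have ie := integrable_exp_mul (Q := Q) hg hM hβ
  have remainder_eq : ∫ x, Real.exp (β * g x) ∂Q - 1 - β ^ 2 / 2 * ∫ x, g x ^ 2 ∂Q
      = ∫ x, (Real.exp (β * g x) - 1 - β * g x - (β * g x) ^ 2 / 2) ∂Q := by
    have sq_div_two : ∀ x, (β * g x) ^ 2 / 2 = β ^ 2 / 2 * g x ^ 2 := fun x => by ring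
    simp only [sq_div_two]
    have i1 : Integrable (fun x => Real.exp (β * g x) - 1) Q := ie.sub (integrable_const 1)
    have i2 : Integrable (fun x => Real.exp (β * g x) - 1 - β * g x) Q := i1.sub (ig.const_mul β)
    rw [integral_sub i2 (ig2.const_mul _), integral_sub i1 (ig.const_mul β),
      integral_sub ie (integrable_const 1), integral_const_mul, integral_const_mul, h0]
    simp
  have remainder_le : ∀ x, ‖Real.exp (β * g x) - 1 - β * g x - (β * g x) ^ 2 / 2‖
      ≤ (β * M) ^ 3 * Real.exp 1 := fun x => by
    have hx := abs_mul_le_mul_of_abs_le (hM x) hβ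
    have h0 : 0 ≤ β * M := (abs_nonneg _).trans hx
    refine (abs_exp_sub_quadratic_le _).trans ?_
    gcongr
    exact hx.trans hβM
  rw [remainder_eq]
  simpa using norm_integral_le_of_norm_le_const (μ := Q) (Eventually.of_forall remainder_le)

theorem abs_integral_exp_mul_sub_linear_le (hφ : Integrable φ Q) (hg : Measurable g)
    (hM : ∀ x, |g x| ≤ M) (hβ : 0 ≤ β) (hβM : β * M ≤ 1) :
    |∫ x, Real.exp (β * g x) * φ x ∂Q - ∫ x, φ x ∂Q - β * ∫ x, φ x * g x ∂Q|
      ≤ (β * M) ^ 2 * Real.exp 1 * ∫ x, |φ x| ∂Q := by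
  have ie := integrable_exp_mul_mul hφ hg hM hβ
  have ig : Integrable (fun x => φ x * g x) Q :=
    hφ.mul_bdd (c := M) (by fun_prop) (Eventually.of_forall hM)
  have remainder_eq : ∫ x, Real.exp (β * g x) * φ x ∂Q - ∫ x, φ x ∂Q - β * ∫ x, φ x * g x ∂Q
      = ∫ x, (Real.exp (β * g x) - 1 - β * g x) * φ x ∂Q := by
    have expand : ∀ x, (Real.exp (β * g x) - 1 - β * g x) * φ x
      = Real.exp (β * g x) * φ x - φ x - β * (φ x * g x) := fun x => by ring
    simp only [expand]
    have i1 : Integrable (fun x => Real.exp (β * g x) * φ x - φ x) Q := ie.sub hφ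
    rw [integral_sub i1 (ig.const_mul β), integral_sub ie hφ, integral_const_mul]
  rw [remainder_eq, ← integral_const_mul, ← Real.norm_eq_abs]
  refine norm_integral_le_of_norm_le (hφ.abs.const_mul _) (Eventually.of_forall fun x => ?_)
  rw [norm_mul, Real.norm_eq_abs, Real.norm_eq_abs]
  have hx := abs_mul_le_mul_of_abs_le (hM x) hβ
  refine mul_le_mul_of_nonneg_right ((abs_exp_sub_one_sub_le _).trans ?_) (abs_nonneg _)
  rw [← sq_abs (β * g x)]
  gcongr
  exact hx.trans hβM

theorem one_le_integral_exp [IsProbabilityMeasure Q] (hg : Measurable g) (hM : ∀ x, |g x| ≤ M)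
    (hβ : 0 ≤ β) (h0 : ∫ x, g x ∂Q = 0) : 1 ≤ ∫ x, Real.exp (β * g x) ∂Q := by
  have ig : Integrable g Q := Integrable.of_bound (by fun_prop) M (Eventually.of_forall hM)
  calc (1 : ℝ) = ∫ x, (β * g x + 1) ∂Q := by
        rw [integral_add (ig.const_mul β) (integrable_const 1), integral_const_mul, h0]
        simp
    _ ≤ _ := integral_mono ((ig.const_mul β).add (integrable_const 1))
        (integrable_exp_mul hg hM hβ) fun x => Real.add_one_le_exp _

theorem integral_tilted_eq (g φ : S → ℝ) (β : ℝ) : ∫ x, φ x ∂(Q.tilted fun x => β * g x)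
    = (∫ x, Real.exp (β * g x) * φ x ∂Q) / ∫ x, Real.exp (β * g x) ∂Q := by
  rw [integral_tilted, ← integral_div]
  refine integral_congr_ae (Eventually.of_forall fun x => ?_)
  simp only [smul_eq_mul]
  ring

theorem memLp_tilted [IsFiniteMeasure Q] (hφ : MemLp φ 2 Q) (hg : Measurable g)
    (hM : ∀ x, |g x| ≤ M) (hβ : 0 ≤ β) : MemLp φ 2 (Q.tilted fun x => β * g x) := by
  have hm : AEStronglyMeasurable φ (Q.tilted fun x => β * g x) :=
    hφ.aestronglyMeasurable.mono_ac (tilted_absolutelyContinuous _ _)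
  rw [memLp_two_iff_integrable_sq hm, integrable_tilted_iff (integrable_exp_mul hg hM hβ)]
  simpa using integrable_exp_mul_mul hφ.integrable_sq hg hM hβ

theorem integral_sq_tilted_le [IsProbabilityMeasure Q] (hφ : MemLp φ 2 Q) (hg : Measurable g)
    (hM : ∀ x, |g x| ≤ M) (hβ : 0 ≤ β) (hβM : β * M ≤ 1) (h0 : ∫ x, g x ∂Q = 0) :
    ∫ x, φ x ^ 2 ∂(Q.tilted fun x => β * g x) ≤ Real.exp 1 * ∫ x, φ x ^ 2 ∂Q := by
  rw [integral_tilted_eq]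
  refine (div_le_self (integral_nonneg fun x => by positivity)
    (one_le_integral_exp hg hM hβ h0)).trans ?_
  rw [← integral_const_mul]
  refine integral_mono (integrable_exp_mul_mul hφ.integrable_sq hg hM hβ)
    (hφ.integrable_sq.const_mul _) fun x => ?_
  refine mul_le_mul_of_nonneg_right (Real.exp_le_exp.2 ?_) (sq_nonneg _)
  exact (mul_le_mul_of_nonneg_left ((le_abs_self _).trans (hM x)) hβ).trans hβM

end TiltedMoments

/-- Data for a change of measure at the scale `β i → 0`: the law `Q i` is tilted by
`exp (β i * g i)`, where `g i` is bounded by `M`, centred, and of asymptotic variance `σsq`, and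
`N i` is the sample size drawn from the tilted law. -/
structure TiltScheme {ι : Type*} (l : Filter ι) (N : ι → ℕ) (β : ι → ℝ) (Q : ι → Measure S)
    (g : ι → S → ℝ) (M σsq : ℝ) : Prop where
  pos : ∀ᶠ i in l, 0 < β i
  zero : Tendsto β l (𝓝 0)
  speed : Tendsto (fun i => (N i : ℝ) * β i ^ 2) l atTop
  prob : ∀ᶠ i in l, IsProbabilityMeasure (Q i)
  meas : ∀ i, Measurable (g i)
  bound : ∀ᶠ i in l, ∀ x, |g i x| ≤ M
  mean : ∀ᶠ i in l, ∫ x, g i x ∂Q i = 0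
  var : Tendsto (fun i => ∫ x, g i x ^ 2 ∂Q i) l (𝓝 σsq)

/-- Functions `φ i` whose mean is steered by tilting `Q i`: relative to the centering `a i → A`,
the mean of `φ i` has drift `s` at the scale `β i` under `Q i`, and the asymptotic covariance `c`
with `g i` is the additional drift caused by the tilting. The second moment tends to `v`. -/
structure TiltObservable {ι : Type*} (l : Filter ι) (β : ι → ℝ) (Q : ι → Measure S)
    (g : ι → S → ℝ) (φ : ι → S → ℝ) (a : ι → ℝ) (A s c v : ℝ) : Prop where
  meas : ∀ i, Measurable (φ i)
  memLp : ∀ᶠ i in l, MemLp (φ i) 2 (Q i)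
  drift : Tendsto (fun i => (∫ x, φ i x ∂Q i - a i) / β i) l (𝓝 s)
  center : Tendsto a l (𝓝 A)
  cov : Tendsto (fun i => ∫ x, φ i x * g i x ∂Q i) l (𝓝 c)
  second : Tendsto (fun i => ∫ x, φ i x ^ 2 ∂Q i) l (𝓝 v)

theorem integral_abs_le_one_add_integral_sq {Q : Measure S} [IsProbabilityMeasure Q] {φ : S → ℝ}
    (hφ : MemLp φ 2 Q) : ∫ x, |φ x| ∂Q ≤ 1 + ∫ x, φ x ^ 2 ∂Q :=
  calc ∫ x, |φ x| ∂Q ≤ ∫ x, (1 + φ x ^ 2) ∂Q := by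
        refine integral_mono (hφ.integrable (by norm_num)).abs
          ((integrable_const 1).add hφ.integrable_sq) fun x => ?_
        change |φ x| ≤ 1 + φ x ^ 2
        nlinarith [sq_nonneg (|φ x| - 1), sq_abs (φ x), abs_nonneg (φ x)]
    _ = 1 + ∫ x, φ x ^ 2 ∂Q := by
        rw [integral_add (integrable_const _) hφ.integrable_sq]
        simp

theorem measurableSet_forall_abs_avg_le {n : ℕ} {κ : Type*} (J : Finset κ) {φ : κ → S → ℝ}
    (hφ : ∀ j ∈ J, Measurable (φ j)) (m : κ → ℝ) (r : ℝ) :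
    MeasurableSet {x : Fin n → S | ∀ j ∈ J, |avg x (φ j) - m j| ≤ r} := by
  simp only [Set.ofPred_forall]
  exact Finset.measurableSet_biInter J fun j hj =>
    measurableSet_le ((measurable_avg (hφ j hj)).sub_const _).abs measurable_const

theorem two_mul_exp_neg_le {T r η : ℝ} (h : Real.log 2 ≤ T * η) :
    2 * Real.exp (-(T * (r + η))) ≤ Real.exp (-(T * r)) := by
  rw [← Real.exp_log (x := 2) two_pos, ← Real.exp_add, Real.exp_le_exp]
  linarith

namespace TiltScheme

variable {ι : Type*} {l : Filter ι} {N : ι → ℕ} {β : ι → ℝ} {Q : ι → Measure S}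
  {g : ι → S → ℝ} {M σsq : ℝ} {φ : ι → S → ℝ} {a : ι → ℝ} {A s c v : ℝ}

theorem eventually_mul_le_one (h : TiltScheme l N β Q g M σsq) : ∀ᶠ i in l, β i * M ≤ 1 := by
  have tendsto_mul : Tendsto (fun i => β i * M) l (𝓝 0) := by simpa using h.zero.mul_const M
  exact tendsto_mul.eventually_le_const one_pos

theorem eventually_one_le (h : TiltScheme l N β Q g M σsq) : ∀ᶠ i in l, 1 ≤ N i := by
  filter_upwards [h.speed.eventually_gt_atTop 0] with i hi
  rcases Nat.eq_zero_or_pos (N i) with h0 | h0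
  · simp [h0] at hi
  · exact h0

theorem tendsto_mass (h : TiltScheme l N β Q g M σsq) :
    Tendsto (fun i => (∫ x, Real.exp (β i * g i x) ∂Q i - 1) / β i ^ 2) l (𝓝 (σsq / 2)) := by
  have half_var : Tendsto (fun i => (∫ x, g i x ^ 2 ∂Q i) / 2) l (𝓝 (σsq / 2)) :=
    h.var.div_const 2
  have error_tendsto : Tendsto (fun i => β i * M ^ 3 * Real.exp 1) l (𝓝 0) := by
    simpa using (h.zero.mul_const (M ^ 3)).mul_const (Real.exp 1)
  refine tendsto_of_tendsto_of_dist half_var (squeeze_zero' (Eventually.of_forall fun i =>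
    dist_nonneg) ?_ error_tendsto)
  filter_upwards [h.pos, h.prob, h.bound, h.mean, h.eventually_mul_le_one] with i hβ hQ hM h0 h1
  have taylor := abs_integral_exp_sub_quadratic_le (h.meas i) hM hβ.le h1 h0
  have difference_eq : (∫ x, g i x ^ 2 ∂Q i) / 2
        - (∫ x, Real.exp (β i * g i x) ∂Q i - 1) / β i ^ 2
      = -(∫ x, Real.exp (β i * g i x) ∂Q i - 1 - β i ^ 2 / 2 * ∫ x, g i x ^ 2 ∂Q i)
        / β i ^ 2 := by
    field_simp
    ring
  rw [Real.dist_eq, difference_eq, abs_div, abs_neg, abs_of_pos (pow_pos hβ 2),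
    div_le_iff₀ (by positivity)]
  refine taylor.trans (le_of_eq ?_)
  ring

theorem tendsto_mass_one (h : TiltScheme l N β Q g M σsq) :
    Tendsto (fun i => ∫ x, Real.exp (β i * g i x) ∂Q i) l (𝓝 1) := by
  have expansion := ((h.zero.pow 2).mul h.tendsto_mass).const_add 1
  simp only [ne_eq, OfNat.ofNat_ne_zero, not_false_eq_true, zero_pow, zero_mul, add_zero]
    at expansion
  refine expansion.congr' ?_
  filter_upwards [h.pos] with i hi
  field_simp
  ring

theorem eventually_le_log_mass (h : TiltScheme l N β Q g M σsq) {δ : ℝ} (hδ : 0 < δ) :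
    ∀ᶠ i in l, β i ^ 2 * (σsq / 2 - δ) ≤ Real.log (∫ x, Real.exp (β i * g i x) ∂Q i) := by
  have ratio_tendsto : Tendsto (fun i => (∫ x, Real.exp (β i * g i x) ∂Q i - 1) / β i ^ 2
      / ∫ x, Real.exp (β i * g i x) ∂Q i) l (𝓝 (σsq / 2)) := by
    simpa only [div_one, Pi.div_def] using h.tendsto_mass.div h.tendsto_mass_one one_ne_zero
  filter_upwards [ratio_tendsto.eventually_const_le (u := σsq / 2 - δ) (by linarith), h.pos,
    h.tendsto_mass_one.eventually_const_lt one_half_lt_one] with i hi hβ hZ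
  have hZ0 : 0 < ∫ x, Real.exp (β i * g i x) ∂Q i := by linarith
  calc β i ^ 2 * (σsq / 2 - δ) ≤ β i ^ 2 * ((∫ x, Real.exp (β i * g i x) ∂Q i - 1) / β i ^ 2
        / ∫ x, Real.exp (β i * g i x) ∂Q i) := by gcongr
    _ = 1 - (∫ x, Real.exp (β i * g i x) ∂Q i)⁻¹ := by field_simp
    _ ≤ _ := Real.one_sub_inv_le_log_of_pos hZ0

theorem tendsto_integral_exp_mul_sub_div (h : TiltScheme l N β Q g M σsq)
    (hφ : TiltObservable l β Q g φ a A s c v) :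
    Tendsto (fun i => (∫ x, Real.exp (β i * g i x) * φ i x ∂Q i - ∫ x, φ i x ∂Q i) / β i) l
      (𝓝 c) := by
  have error_tendsto : Tendsto (fun i => β i * (M ^ 2 * Real.exp 1
      * (1 + ∫ x, φ i x ^ 2 ∂Q i))) l (𝓝 0) := by
    simpa using h.zero.mul ((hφ.second.const_add 1).const_mul (M ^ 2 * Real.exp 1))
  refine tendsto_of_tendsto_of_dist hφ.cov (squeeze_zero' (Eventually.of_forall fun i =>
    dist_nonneg) ?_ error_tendsto)
  filter_upwards [h.pos, h.prob, h.bound, hφ.memLp, h.eventually_mul_le_one] with i hβ hQ hM hL h1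
  have difference_eq : ∫ x, φ i x * g i x ∂Q i - (∫ x, Real.exp (β i * g i x) * φ i x ∂Q i
      - ∫ x, φ i x ∂Q i) / β i = -(∫ x, Real.exp (β i * g i x) * φ i x ∂Q i
      - ∫ x, φ i x ∂Q i - β i * ∫ x, φ i x * g i x ∂Q i) / β i := by
    field_simp
    ring
  rw [Real.dist_eq, difference_eq, abs_div, abs_neg, abs_of_pos hβ, div_le_iff₀ hβ]
  calc _ ≤ (β i * M) ^ 2 * Real.exp 1 * ∫ x, |φ i x| ∂Q i :=
        abs_integral_exp_mul_sub_linear_le (hL.integrable (by norm_num)) (h.meas i) hM hβ.le h1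
    _ ≤ (β i * M) ^ 2 * Real.exp 1 * (1 + ∫ x, φ i x ^ 2 ∂Q i) := by
        gcongr
        exact integral_abs_le_one_add_integral_sq hL
    _ = _ := by ring

theorem tendsto_tilted_mean (h : TiltScheme l N β Q g M σsq)
    (hφ : TiltObservable l β Q g φ a A s c v) :
    Tendsto (fun i => (∫ x, φ i x ∂((Q i).tilted fun x => β i * g i x) - a i) / β i) l
      (𝓝 (s + c)) := by
  have quotient_tendsto := (((h.tendsto_integral_exp_mul_sub_div hφ).add hφ.drift).sub
    ((hφ.center.mul h.zero).mul h.tendsto_mass)).div h.tendsto_mass_one one_ne_zero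
  have limit_eq : (c + s - A * 0 * (σsq / 2)) / 1 = s + c := by ring
  rw [limit_eq] at quotient_tendsto
  refine quotient_tendsto.congr' ?_
  filter_upwards [h.pos, h.tendsto_mass_one.eventually_const_lt one_half_lt_one] with i hβ hZ
  have hZ0 : ∫ x, Real.exp (β i * g i x) ∂Q i ≠ 0 := by linarith
  simp only [Pi.div_apply]
  rw [integral_tilted_eq]
  generalize (∫ x, Real.exp (β i * g i x) ∂Q i) = Z at *
  field_simp
  ring

theorem eventually_pi_tilted_le (h : TiltScheme l N β Q g M σsq)
    (hφ : TiltObservable l β Q g φ a A s c v) {ε δ : ℝ} (hε : 0 < ε) (hδ : 0 < δ) :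
    ∀ᶠ i in l, Measure.pi (fun _ : Fin (N i) => (Q i).tilted fun x => β i * g i x)
      {x | ε * β i < |avg x (φ i) - a i - β i * (s + c)|} ≤ ENNReal.ofReal δ := by
  have bound_tendsto : Tendsto (fun i => Real.exp 1 * (∫ x, φ i x ^ 2 ∂Q i) / (ε / 2) ^ 2
      / ((N i : ℝ) * β i ^ 2)) l (𝓝 0) :=
    ((hφ.second.const_mul _).div_const _).div_atTop h.speed
  filter_upwards [h.pos, h.prob, h.bound, h.mean, h.eventually_mul_le_one, hφ.memLp,
    h.eventually_one_le, bound_tendsto.eventually_le_const hδ,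
    Metric.tendsto_nhds.1 (h.tendsto_tilted_mean hφ) (ε / 2) (half_pos hε)]
    with i hβ hQ hM h0 h1 hL hN hδi hmean
  have := isProbabilityMeasure_tilted (integrable_exp_mul (Q := Q i) (h.meas i) hM hβ.le)
  have chebyshev := chebyshev_avg hN _ (memLp_tilted hL (h.meas i) hM hβ.le)
    (t := ε / 2 * β i) (by positivity)
  refine (measure_mono fun x hx => ?_).trans (chebyshev.trans (ENNReal.ofReal_le_ofReal ?_))
  · have far : ε * β i < |avg x (φ i) - a i - β i * (s + c)| := hx
    rw [Real.dist_eq] at hmean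
    set m := ∫ x, φ i x ∂((Q i).tilted fun x => β i * g i x)
    have mean_close : |m - a i - β i * (s + c)| < ε / 2 * β i := by
      have factor : m - a i - β i * (s + c) = ((m - a i) / β i - (s + c)) * β i := by field_simp
      rw [factor, abs_mul, abs_of_pos hβ]
      exact mul_lt_mul_of_pos_right hmean hβ
    have triangle := abs_sub_abs_le_abs_sub (avg x (φ i) - a i - β i * (s + c))
      (m - a i - β i * (s + c))
    rw [sub_sub_sub_cancel_right, sub_sub_sub_cancel_right] at triangle
    change ε / 2 * β i ≤ |avg x (φ i) - m|
    linarith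
  · refine le_trans ?_ hδi
    calc _ ≤ Real.exp 1 * (∫ x, φ i x ^ 2 ∂Q i) / (N i * (ε / 2 * β i) ^ 2) := by
          gcongr
          exact integral_sq_tilted_le hL (h.meas i) hM hβ.le h1 h0
      _ = _ := by field_simp

theorem observable_self (h : TiltScheme l N β Q g M σsq) :
    TiltObservable l β Q g g (fun _ => 0) 0 0 σsq σsq where
  meas := h.meas
  memLp := by
    filter_upwards [h.prob, h.bound] with i hQ hM
    exact MemLp.of_bound (h.meas i).aestronglyMeasurable M (Eventually.of_forall hM)
  drift := by
    refine tendsto_const_nhds.congr' ?_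
    filter_upwards [h.mean] with i hi
    simp [hi]
  center := tendsto_const_nhds
  cov := by simpa only [sq] using h.var
  second := h.var

theorem eventually_half_le_pi_tilted (h : TiltScheme l N β Q g M σsq) {κ : Type*} (J : Finset κ)
    {φ : κ → ι → S → ℝ} {a : κ → ι → ℝ} {A s c v : κ → ℝ}
    (hφ : ∀ j ∈ J, TiltObservable l β Q g (φ j) (a j) (A j) (s j) (c j) (v j))
    {ε : ℝ} (hε : 0 < ε) :
    ∀ᶠ i in l, ENNReal.ofReal 2⁻¹
      ≤ Measure.pi (fun _ : Fin (N i) => (Q i).tilted fun x => β i * g i x)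
        {x | ∀ j ∈ J, |avg x (φ j i) - a j i - β i * (s j + c j)| ≤ ε * β i} := by
  set δ : ℝ := 2⁻¹ * ((J.card : ℝ) + 1)⁻¹ with hδ
  have hδ0 : 0 < δ := by positivity
  filter_upwards [(eventually_all_finset J).2 fun j hj =>
      h.eventually_pi_tilted_le (hφ j hj) hε hδ0, h.pos, h.prob, h.bound] with i bad_le hβ hQ hM
  have := isProbabilityMeasure_tilted (integrable_exp_mul (Q := Q i) (h.meas i) hM hβ.le)
  set μ := Measure.pi (fun _ : Fin (N i) => (Q i).tilted fun x => β i * g i x)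
  set good : Set (Fin (N i) → S) :=
    {x | ∀ j ∈ J, |avg x (φ j i) - a j i - β i * (s j + c j)| ≤ ε * β i} with good_def
  have measurableSet_good : MeasurableSet good := by
    simpa only [good_def, sub_sub] using measurableSet_forall_abs_avg_le J
      (fun j hj => (hφ j hj).meas i) (fun j => a j i + β i * (s j + c j)) (ε * β i)
  have compl_good_le : μ goodᶜ ≤ ENNReal.ofReal 2⁻¹ := by
    have compl_good_eq : goodᶜ
        = ⋃ j ∈ J, {x | ε * β i < |avg x (φ j i) - a j i - β i * (s j + c j)|} := by
      ext x
      simp [good_def]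
    calc μ goodᶜ ≤ ∑ _j ∈ J, ENNReal.ofReal δ := by
          rw [compl_good_eq]
          exact (measure_biUnion_finset_le J _).trans (Finset.sum_le_sum bad_le)
      _ = ENNReal.ofReal (J.card * δ) := by
          rw [Finset.sum_const, nsmul_eq_mul, ENNReal.ofReal_mul (Nat.cast_nonneg _),
            ENNReal.ofReal_natCast]
      _ ≤ ENNReal.ofReal 2⁻¹ := by
          refine ENNReal.ofReal_le_ofReal ?_
          rw [hδ, mul_left_comm, ← div_eq_mul_inv]
          exact mul_le_of_le_one_right (by norm_num) ((div_le_one (by positivity)).2 (by linarith))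
  calc ENNReal.ofReal 2⁻¹ = 1 - ENNReal.ofReal 2⁻¹ := by
        rw [← ENNReal.ofReal_one, ← ENNReal.ofReal_sub _ (by norm_num)]
        norm_num
    _ ≤ 1 - μ goodᶜ := tsub_le_tsub_left compl_good_le 1
    _ = μ good := by rw [← prob_compl_eq_one_sub measurableSet_good.compl, compl_compl]

theorem eventually_le_pi_of_half_le (h : TiltScheme l N β Q g M σsq) {ε : ℝ} (hε : 0 < ε) :
    ∀ᶠ i in l, ∀ E : Set (Fin (N i) → S), MeasurableSet E →
      (∀ x ∈ E, avg x (g i) ≤ β i * (σsq + ε / 4)) →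
      ENNReal.ofReal 2⁻¹ ≤ Measure.pi (fun _ : Fin (N i) => (Q i).tilted fun x => β i * g i x) E →
      ENNReal.ofReal (Real.exp (-(N i * β i ^ 2 * (σsq / 2 + ε))))
        ≤ Measure.pi (fun _ : Fin (N i) => Q i) E := by
  filter_upwards [h.pos, h.prob, h.bound, h.eventually_le_log_mass (δ := ε / 4) (by linarith),
    h.eventually_one_le, h.speed.eventually_ge_atTop (Real.log 2 / (ε / 2))]
    with i hβ hQ hM hlog hN hspeed E hE avg_le half_le
  set R : ℝ := N i * β i ^ 2 * (σsq / 2 + ε / 2) with hR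
  have tilted_le : Measure.pi (fun _ : Fin (N i) => (Q i).tilted fun x => β i * g i x) E
      ≤ ENNReal.ofReal (Real.exp R) * Measure.pi (fun _ : Fin (N i) => Q i) E := by
    refine pi_tilted_le (Q i) (integrable_exp_mul (h.meas i) hM hβ.le) hE fun x hx => ?_
    rw [← Finset.mul_sum, ← natCast_mul_avg hN]
    have sum_le : β i * (N i * avg x (g i)) ≤ β i * (N i * (β i * (σsq + ε / 4))) := by
      gcongr
      exact avg_le x hx
    have le_log : (N i : ℝ) * (β i ^ 2 * (σsq / 2 - ε / 4))
        ≤ N i * Real.log (∫ y, Real.exp (β i * g i y) ∂Q i) := by gcongr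
    rw [hR]
    nlinarith
  have exp_le : Real.exp (-(N i * β i ^ 2 * (σsq / 2 + ε))) ≤ Real.exp (-R) * 2⁻¹ := by
    rw [div_le_iff₀ (by linarith)] at hspeed
    have := two_mul_exp_neg_le (r := σsq / 2 + ε / 2) hspeed
    rw [add_assoc, add_halves] at this
    linarith
  calc ENNReal.ofReal (Real.exp (-(N i * β i ^ 2 * (σsq / 2 + ε))))
      ≤ ENNReal.ofReal (Real.exp (-R)) * ENNReal.ofReal 2⁻¹ := by
        rw [← ENNReal.ofReal_mul (Real.exp_pos _).le]
        exact ENNReal.ofReal_le_ofReal exp_le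
    _ ≤ ENNReal.ofReal (Real.exp (-R)) * (ENNReal.ofReal (Real.exp R)
        * Measure.pi (fun _ : Fin (N i) => Q i) E) := by
        gcongr
        exact half_le.trans tilted_le
    _ = Measure.pi (fun _ : Fin (N i) => Q i) E := by
        rw [← mul_assoc, ← ENNReal.ofReal_mul (Real.exp_pos _).le, ← Real.exp_add, neg_add_cancel,
          Real.exp_zero, ENNReal.ofReal_one, one_mul]

theorem le_pi_avg (h : TiltScheme l N β Q g M σsq) {κ : Type*} (J : Finset κ)
    {φ : κ → ι → S → ℝ} {a : κ → ι → ℝ} {A s c v : κ → ℝ}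
    (hφ : ∀ j ∈ J, TiltObservable l β Q g (φ j) (a j) (A j) (s j) (c j) (v j))
    {ε : ℝ} (hε : 0 < ε) :
    ∀ᶠ i in l, ENNReal.ofReal (Real.exp (-(N i * β i ^ 2 * (σsq / 2 + ε))))
      ≤ Measure.pi (fun _ : Fin (N i) => Q i)
        {x | ∀ j ∈ J, |avg x (φ j i) - a j i - β i * (s j + c j)| ≤ ε * β i} := by
  -- `none` stands for the tilting function itself, whose average enters the likelihood ratio.
  have observable : ∀ o ∈ J.insertNone, TiltObservable l β Q g (o.elim g φ)
      (o.elim (fun _ => 0) a) (o.elim 0 A) (o.elim 0 s) (o.elim σsq c) (o.elim σsq v) :=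
    Finset.forall_mem_insertNone.2 ⟨h.observable_self, hφ⟩
  filter_upwards [h.eventually_half_le_pi_tilted J.insertNone observable (ε := ε / 4) (by linarith),
    h.eventually_le_pi_of_half_le hε, h.pos] with i half_le le_of_half_le hβ
  refine (le_of_half_le _ ?_ (fun x hx => ?_) half_le).trans (measure_mono fun x hx j hj => ?_)
  · simpa only [sub_sub] using measurableSet_forall_abs_avg_le J.insertNone
      (fun o ho => (observable o ho).meas i)
      (fun o : Option κ => o.elim (fun _ => 0) a i + β i * (o.elim 0 s + o.elim σsq c)) _
  · have self_close : |avg x (g i) - 0 - β i * (0 + σsq)| ≤ ε / 4 * β i :=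
      hx none Finset.none_mem_insertNone
    linarith [(abs_le.1 self_close).2]
  · have close : |avg x (φ j i) - a j i - β i * (s j + c j)| ≤ ε / 4 * β i :=
      hx (some j) (Finset.some_mem_insertNone.2 hj)
    refine close.trans ?_
    gcongr
    linarith

end TiltScheme

section Centering

variable {ι : Type*} {l : Filter ι} {N : ι → ℕ} {β : ι → ℝ} {Q : ι → Measure S}
  {g : S → ℝ} {M σsq : ℝ} {φ : ι → S → ℝ} {a : ι → ℝ} {A s c v : ℝ}

theorem TiltScheme.of_tendsto_zero (hpos : ∀ᶠ i in l, 0 < β i) (hzero : Tendsto β l (𝓝 0))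
    (hspeed : Tendsto (fun i => (N i : ℝ) * β i ^ 2) l atTop)
    (hQ : ∀ᶠ i in l, IsProbabilityMeasure (Q i)) (hg : Measurable g) (hM : ∀ x, |g x| ≤ M)
    (hmean : Tendsto (fun i => ∫ x, g x ∂Q i) l (𝓝 0))
    (hvar : Tendsto (fun i => ∫ x, g x ^ 2 ∂Q i) l (𝓝 σsq)) :
    TiltScheme l N β Q (fun i x => g x - ∫ y, g y ∂Q i) (2 * M) σsq where
  pos := hpos
  zero := hzero
  speed := hspeed
  prob := hQ
  meas _ := hg.sub_const _
  bound := by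
    filter_upwards [hQ] with i hi x
    have abs_mean_le := norm_integral_le_of_norm_le_const (μ := Q i) (f := g)
      (Eventually.of_forall hM)
    rw [probReal_univ, mul_one, Real.norm_eq_abs] at abs_mean_le
    exact (abs_sub _ _).trans (by linarith [hM x])
  mean := by
    filter_upwards [hQ] with i hi
    have ig : Integrable g (Q i) := Integrable.of_bound (by fun_prop) M (Eventually.of_forall hM)
    rw [integral_sub ig (integrable_const _)]
    simp
  var := by
    have variance_tendsto := hvar.sub (hmean.pow 2)
    rw [zero_pow two_ne_zero, sub_zero] at variance_tendsto
    refine variance_tendsto.congr' ?_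
    filter_upwards [hQ] with i hi
    have mg : MemLp g 2 (Q i) :=
      MemLp.of_bound hg.aestronglyMeasurable M (Eventually.of_forall hM)
    rw [← variance_eq_integral hg.aemeasurable, variance_eq_sub mg]
    simp

theorem TiltObservable.tendsto_integral (h : TiltObservable l β Q (fun _ => g) φ a A s c v)
    (hpos : ∀ᶠ i in l, 0 < β i) (hzero : Tendsto β l (𝓝 0)) :
    Tendsto (fun i => ∫ x, φ i x ∂Q i) l (𝓝 A) := by
  have expansion := h.center.add (hzero.mul h.drift)
  rw [zero_mul, add_zero] at expansion
  refine expansion.congr' ?_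
  filter_upwards [hpos] with i hi
  field_simp
  ring

theorem TiltObservable.sub_integral (h : TiltObservable l β Q (fun _ => g) φ a A s c v)
    (hpos : ∀ᶠ i in l, 0 < β i) (hzero : Tendsto β l (𝓝 0))
    (hQ : ∀ᶠ i in l, IsProbabilityMeasure (Q i)) (hg : Measurable g) (hM : ∀ x, |g x| ≤ M)
    (hmean : Tendsto (fun i => ∫ x, g x ∂Q i) l (𝓝 0)) :
    TiltObservable l β Q (fun i x => g x - ∫ y, g y ∂Q i) φ a A s c v where
  meas := h.meas
  memLp := h.memLp
  drift := h.drift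
  center := h.center
  second := h.second
  cov := by
    have covariance_tendsto := h.cov.sub ((h.tendsto_integral hpos hzero).mul hmean)
    rw [mul_zero, sub_zero] at covariance_tendsto
    refine covariance_tendsto.congr' ?_
    filter_upwards [hQ, h.memLp] with i hi hLi
    have iφ : Integrable (φ i) (Q i) := hLi.integrable (by norm_num)
    have iφg : Integrable (fun x => φ i x * g x) (Q i) :=
      iφ.mul_bdd (c := M) (by fun_prop) (Eventually.of_forall hM)
    simp only [mul_sub]
    rw [integral_sub iφg (iφ.mul_const _), integral_mul_const]

end Centering

namespace RegularArray

variable {P : Measure S} {b : ℕ → ℝ} {Q : ℕ → Measure S} {F : S → ℝ}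

theorem abs_mul_le_mul_sq (h : RegularArray P b Q F) {f g : S → ℝ} {M : ℝ}
    (hf : ∀ x, |f x| ≤ F x) (hM : ∀ x, |g x| ≤ M) (x : S) : |f x * g x| ≤ M * F x ^ 2 := by
  have hM0 : 0 ≤ M := (abs_nonneg _).trans (hM x)
  rw [abs_mul, mul_comm]
  exact mul_le_mul (hM x) ((hf x).trans (h.le_sq x)) (abs_nonneg _) hM0

theorem abs_pow_le_mul_sq (h : RegularArray P b Q F) {g : S → ℝ} {M : ℝ} (hM : ∀ x, |g x| ≤ M)
    (m : ℕ) (x : S) : |g x ^ m| ≤ M ^ m * F x ^ 2 := by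
  have hM0 : 0 ≤ M := (abs_nonneg _).trans (hM x)
  rw [abs_pow]
  exact (pow_le_pow_left₀ (abs_nonneg _) (hM x) m).trans
    (le_mul_of_one_le_right (by positivity) (h.one_le_sq x))

variable {f g : S → ℝ} {M : ℝ}

theorem tendsto_integral_zero (h : RegularArray P b Q F) (hg : Measurable g)
    (hM : ∀ x, |g x| ≤ M) (h0 : ∫ x, g x ∂P = 0) :
    Tendsto (fun n => ∫ x, g x ∂Q n) atTop (𝓝 0) :=
  h0 ▸ h.bdd g hg ⟨M, hM⟩

theorem eventually_isProbabilityMeasure_empirical (h : RegularArray P b Q F) :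
    ∀ᶠ w in superexp Q h.normalizing, IsProbabilityMeasure (empirical w.2) := by
  filter_upwards [(tendsto_fst_superexp Q h.normalizing).eventually_ge_atTop 1] with w hw
  have : NeZero w.1 := ⟨by omega⟩
  infer_instance

variable [∀ n, IsProbabilityMeasure (Q n)]

theorem tiltScheme_sample (h : RegularArray P b Q F) (hg : Measurable g) (hM : ∀ x, |g x| ≤ M)
    (h0 : ∫ x, g x ∂P = 0) :
    TiltScheme atTop (fun n : ℕ => n) b Q (fun n x => g x - ∫ y, g y ∂Q n) (2 * M)
      (∫ x, g x ^ 2 ∂P) :=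
  TiltScheme.of_tendsto_zero h.normalizing.eventually_pos h.normalizing.zero h.normalizing.speed
    (Eventually.of_forall inferInstance) hg hM (h.tendsto_integral_zero hg hM h0)
    (h.bdd (fun x => g x ^ 2) (hg.pow_const 2) ⟨M ^ 2, fun x => by
      rw [abs_pow]
      exact pow_le_pow_left₀ (abs_nonneg _) (hM x) 2⟩)

variable [IsProbabilityMeasure P]

theorem tiltObservable_sample (h : RegularArray P b Q F) (hf : Measurable f)
    (hfF : ∀ x, |f x| ≤ F x) {D : ℝ}
    (hD : Tendsto (fun n => (∫ x in {x | F x ≤ (b n)⁻¹}, f x ∂Q n - ∫ x, f x ∂P) / b n) atTop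
      (𝓝 D)) (hg : Measurable g) (hM : ∀ x, |g x| ≤ M) :
    TiltObservable atTop b Q (fun _ => g) (fun n => {x | F x ≤ (b n)⁻¹}.indicator f)
      (fun _ => ∫ x, f x ∂P) (∫ x, f x ∂P) D (∫ x, f x * g x ∂P) (∫ x, f x ^ 2 ∂P) where
  meas n := hf.indicator (h.measurableSet_trunc n)
  memLp := by
    filter_upwards [h.normalizing.eventually_pos] with n hn
    refine MemLp.of_bound (hf.indicator (h.measurableSet_trunc n)).aestronglyMeasurable (b n)⁻¹
      (Eventually.of_forall fun x => ?_)
    rw [Set.indicator_apply]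
    split_ifs with hx
    · exact (hfF x).trans hx
    · rw [norm_zero]
      positivity
  drift := by simpa only [integral_indicator (h.measurableSet_trunc _)] using hD
  center := tendsto_const_nhds
  cov := by
    simp only [← Set.indicator_mul_left, integral_indicator (h.measurableSet_trunc _)]
    exact h.tendsto_setIntegral_const (hf.mul hg) (h.abs_mul_le_mul_sq hfF hM)
  second := by
    have sq_indicator : ∀ n x, {x | F x ≤ (b n)⁻¹}.indicator f x ^ 2
        = {x | F x ≤ (b n)⁻¹}.indicator (fun x => f x ^ 2) x := fun n x => by
      simp only [Set.indicator_apply, ite_pow, zero_pow two_ne_zero]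
    simp only [sq_indicator, integral_indicator (h.measurableSet_trunc _)]
    refine h.tendsto_setIntegral_const (hf.pow_const 2) (C := 1) fun x => ?_
    rw [one_mul, abs_pow]
    exact pow_le_pow_left₀ (abs_nonneg _) (hfF x) 2

theorem le_pi_sample (h : RegularArray P b Q F) (J : Finset (S → ℝ)) (hJm : ∀ f ∈ J, Measurable f)
    (hJF : ∀ f ∈ J, ∀ x, |f x| ≤ F x) {D : (S → ℝ) → ℝ}
    (hD : ∀ f ∈ J, Tendsto (fun n => (∫ x in {x | F x ≤ (b n)⁻¹}, f x ∂Q n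
      - ∫ x, f x ∂P) / b n) atTop (𝓝 (D f)))
    (hg : Measurable g) (hM : ∀ x, |g x| ≤ M) (h0 : ∫ x, g x ∂P = 0) {ε : ℝ} (hε : 0 < ε) :
    ∀ᶠ n : ℕ in atTop,
      ENNReal.ofReal (Real.exp (-(n * b n ^ 2 * ((∫ x, g x ^ 2 ∂P) / 2 + ε))))
        ≤ Measure.pi (fun _ : Fin n => Q n)
          {x | ∀ f ∈ J, |avg x ({x | F x ≤ (b n)⁻¹}.indicator f) - ∫ x, f x ∂P
            - b n * (D f + ∫ x, f x * g x ∂P)| ≤ ε * b n} :=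
  (h.tiltScheme_sample hg hM h0).le_pi_avg J (fun f hf =>
    (h.tiltObservable_sample (hJm f hf) (hJF f hf) (hD f hf) hg hM).sub_integral
      h.normalizing.eventually_pos h.normalizing.zero (Eventually.of_forall inferInstance) hg hM
      (h.tendsto_integral_zero hg hM h0)) hε

theorem tendsto_integral_empirical_zero (h : RegularArray P b Q F) (hg : Measurable g)
    (hM : ∀ x, |g x| ≤ M) (h0 : ∫ x, g x ∂P = 0) :
    Tendsto (fun w : Σ n, Fin n → S => ∫ x, g x ∂empirical w.2) (superexp Q h.normalizing)
      (𝓝 0) := by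
  simp only [integral_empirical _ hg]
  exact h0 ▸ h.tendsto_avg_const hg fun x => by
    simpa only [pow_one] using h.abs_pow_le_mul_sq hM 1 x

theorem tiltScheme_bootstrap (h : RegularArray P b Q F) {k : ℕ → ℕ} {ν : ℝ} (hν : 0 < ν)
    (hk : Tendsto (fun n : ℕ => (k n : ℝ) / (n : ℝ)) atTop (𝓝 ν)) (hg : Measurable g)
    (hM : ∀ x, |g x| ≤ M) (h0 : ∫ x, g x ∂P = 0) :
    TiltScheme (superexp Q h.normalizing) (fun w => k w.1) (fun w => b w.1)
      (fun w => empirical w.2) (fun w x => g x - ∫ y, g y ∂empirical w.2) (2 * M)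
      (∫ x, g x ^ 2 ∂P) := by
  have hfst := tendsto_fst_superexp Q h.normalizing
  have speed : Tendsto (fun n : ℕ => (k n : ℝ) * b n ^ 2) atTop atTop := by
    refine (hk.pos_mul_atTop hν h.normalizing.speed).congr' ?_
    filter_upwards [eventually_ge_atTop 1] with n hn
    have hn0 : (n : ℝ) ≠ 0 := by positivity
    field_simp
  refine TiltScheme.of_tendsto_zero (hfst.eventually h.normalizing.eventually_pos)
    (h.normalizing.zero.comp hfst) (speed.comp hfst) h.eventually_isProbabilityMeasure_empirical
    hg hM (h.tendsto_integral_empirical_zero hg hM h0) ?_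
  simp only [integral_empirical _ (hg.pow_const 2)]
  exact h.tendsto_avg_const (hg.pow_const 2) (h.abs_pow_le_mul_sq hM 2)

theorem tiltObservable_bootstrap (h : RegularArray P b Q F) (hf : Measurable f)
    (hfF : ∀ x, |f x| ≤ F x) (hg : Measurable g) (hM : ∀ x, |g x| ≤ M) :
    TiltObservable (superexp Q h.normalizing) (fun w => b w.1) (fun w => empirical w.2)
      (fun _ => g) (fun _ => f) (fun w => avg w.2 f) (∫ x, f x ∂P) 0 (∫ x, f x * g x ∂P)
      (∫ x, f x ^ 2 ∂P) where
  meas _ := hf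
  memLp := Eventually.of_forall fun w => by
    rw [memLp_two_iff_integrable_sq hf.aestronglyMeasurable]
    exact integrable_empirical w.2 (hf.pow_const 2)
  drift := by simpa [integral_empirical _ hf] using tendsto_const_nhds
  center := h.tendsto_avg_const hf (C := 1) fun x => by
    rw [one_mul]
    exact (hfF x).trans (h.le_sq x)
  cov := by
    have hfg : Measurable fun x => f x * g x := hf.mul hg
    simp only [integral_empirical _ hfg]
    exact h.tendsto_avg_const hfg (h.abs_mul_le_mul_sq hfF hM)
  second := by
    simp only [integral_empirical _ (hf.pow_const 2)]
    refine h.tendsto_avg_const (hf.pow_const 2) (C := 1) fun x => ?_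
    rw [one_mul, abs_pow]
    exact pow_le_pow_left₀ (abs_nonneg _) (hfF x) 2

theorem le_pi_bootstrap (h : RegularArray P b Q F) {k : ℕ → ℕ} {ν : ℝ} (hν : 0 < ν)
    (hk : Tendsto (fun n : ℕ => (k n : ℝ) / (n : ℝ)) atTop (𝓝 ν))
    (J : Finset (S → ℝ)) (hJm : ∀ f ∈ J, Measurable f) (hJF : ∀ f ∈ J, ∀ x, |f x| ≤ F x)
    (hg : Measurable g) (hM : ∀ x, |g x| ≤ M) (h0 : ∫ x, g x ∂P = 0) {ε : ℝ} (hε : 0 < ε) :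
    ∀ᶠ w in superexp Q h.normalizing,
      ENNReal.ofReal (Real.exp (-(k w.1 * b w.1 ^ 2 * ((∫ x, g x ^ 2 ∂P) / 2 + ε))))
        ≤ Measure.pi (fun _ : Fin (k w.1) => empirical w.2)
          {y | ∀ f ∈ J, |avg y f - avg w.2 f - b w.1 * ∫ x, f x * g x ∂P| ≤ ε * b w.1} := by
  have hfst := tendsto_fst_superexp Q h.normalizing
  simpa only [zero_add] using (h.tiltScheme_bootstrap hν hk hg hM h0).le_pi_avg J (fun f hf =>
    (h.tiltObservable_bootstrap (hJm f hf) (hJF f hf) hg hM).sub_integral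
      (hfst.eventually h.normalizing.eventually_pos) (h.normalizing.zero.comp hfst)
      h.eventually_isProbabilityMeasure_empirical hg hM
      (h.tendsto_integral_empirical_zero hg hM h0)) hε

end RegularArray

/-! ### The lower bound -/

theorem exists_pos_rate_lt {ν x y I ε : ℝ} (hI : ν * x + y < I) (hε : 0 < ε) :
    ∃ η, 0 < η ∧ η ≤ ε ∧ (ν + η) * (x + η) + (y + η + η) < I := by
  have tendsto_rate : Tendsto (fun η : ℝ => (ν + η) * (x + η) + (y + η + η)) (𝓝[>] 0)
      (𝓝 ((ν + 0) * (x + 0) + (y + 0 + 0))) :=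
    (Continuous.tendsto (by fun_prop) 0).mono_left nhdsWithin_le_nhds
  simp only [add_zero] at tendsto_rate
  obtain ⟨η, ⟨rate_lt, η_mem⟩, η_pos⟩ := (((tendsto_rate.eventually_lt_const hI).and
    (Ioc_mem_nhdsGT hε)).and self_mem_nhdsWithin).exists
  exact ⟨η, η_pos, η_mem.2, rate_lt⟩

theorem eventually_exp_neg_le_mul {b : ℕ → ℝ} {k : ℕ → ℕ} {ν : ℝ}
    (hk : Tendsto (fun n : ℕ => (k n : ℝ) / (n : ℝ)) atTop (𝓝 ν)) {x y I η : ℝ} (hx : 0 ≤ x)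
    (hη : 0 < η) (hI : (ν + η) * x + y ≤ I) :
    ∀ᶠ n : ℕ in atTop, ENNReal.ofReal (Real.exp (n * b n ^ 2 * (-I)))
      ≤ ENNReal.ofReal (Real.exp (-(k n * b n ^ 2 * x)))
        * ENNReal.ofReal (Real.exp (-(n * b n ^ 2 * y))) := by
  filter_upwards [hk.eventually_le_const (lt_add_of_pos_right ν hη), eventually_gt_atTop 0]
    with n hkn hn
  have k_le : (k n : ℝ) ≤ (ν + η) * n := by rwa [div_le_iff₀ (by exact_mod_cast hn)] at hkn
  have exponent_le : k n * b n ^ 2 * x + n * b n ^ 2 * y ≤ n * b n ^ 2 * I :=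
    calc k n * b n ^ 2 * x + n * b n ^ 2 * y
        ≤ (ν + η) * n * b n ^ 2 * x + n * b n ^ 2 * y := by gcongr
      _ = n * b n ^ 2 * ((ν + η) * x + y) := by ring
      _ ≤ n * b n ^ 2 * I := by gcongr
  rw [← ENNReal.ofReal_mul (Real.exp_pos _).le, ← Real.exp_add]
  exact ENNReal.ofReal_le_ofReal (Real.exp_le_exp.2 (by linarith))

theorem le_sampleLaw {b : ℕ → ℝ} (hb : Normalizing b) {Pn : ℕ → ProbabilityMeasure S} {k : ℕ → ℕ}
    {W : ∀ n, Set ((Fin n → S) × (Fin (k n) → S))} (hW : ∀ n, MeasurableSet (W n))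
    {A : ∀ n, Set (Fin n → S)} {p : ℕ → ℝ≥0∞} {r η : ℝ} (hη : 0 < η)
    (hA : ∀ᶠ n : ℕ in atTop, ENNReal.ofReal (Real.exp (-(n * b n ^ 2 * r)))
      ≤ Measure.pi (fun _ : Fin n => (Pn n : Measure S)) (A n))
    (hgood : ∀ᶠ w in superexp (fun n => (Pn n : Measure S)) hb,
      w.2 ∈ A w.1 → p w.1 ≤ Measure.pi (fun _ : Fin (k w.1) => empirical w.2)
        (Prod.mk w.2 ⁻¹' W w.1)) :
    ∀ᶠ n : ℕ in atTop, p n * ENNReal.ofReal (Real.exp (-(n * b n ^ 2 * (r + η))))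
      ≤ sampleLaw (Pn n) n (k n) (W n) := by
  rw [eventually_superexp_iff] at hgood
  filter_upwards [hA, hgood (r + η), hb.speed.eventually_ge_atTop (Real.log 2 / η)]
    with n le_measure_A bad_le hspeed
  set T : ℝ := n * b n ^ 2
  set μ := Measure.pi (fun _ : Fin n => (Pn n : Measure S))
  set good := {x : Fin n → S | p n ≤ bootstrapKernel S n (k n) x (Prod.mk x ⁻¹' W n)}
  set q := ENNReal.ofReal (Real.exp (-(T * (r + η)))) with hq
  have le_measure_good : q ≤ μ good := by
    refine (ENNReal.add_le_add_iff_right (a := q) ENNReal.ofReal_ne_top).1 ?_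
    calc q + q = ENNReal.ofReal (2 * Real.exp (-(T * (r + η)))) := by
          rw [hq, ← ENNReal.ofReal_add (Real.exp_pos _).le (Real.exp_pos _).le, two_mul]
      _ ≤ ENNReal.ofReal (Real.exp (-(T * r))) := ENNReal.ofReal_le_ofReal
          (two_mul_exp_neg_le (by rwa [div_le_iff₀ hη] at hspeed))
      _ ≤ μ (good ∪ {x | ¬ (x ∈ A n → x ∈ good)}) := le_measure_A.trans
          (measure_mono fun x hx => (em (x ∈ good)).imp_right fun hxg himp => hxg (himp hx))
      _ ≤ μ good + q := (measure_union_le _ _).trans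
          (add_le_add le_rfl (bad_le.trans_eq (by rw [mul_neg])))
  calc p n * q ≤ p n * μ good := by gcongr
    _ ≤ ∫⁻ x, bootstrapKernel S n (k n) x (Prod.mk x ⁻¹' W n) ∂μ :=
        mul_meas_ge_le_lintegral (Kernel.measurable_kernel_prodMk_left (hW n)) (p n)
    _ = sampleLaw (Pn n) n (k n) (W n) := (Measure.compProd_apply (hW n)).symm

/-- The pairs of samples whose deviations, divided by `β`, are within `ε` of the values `d₂ f` (for
the bootstrap sample) and `d₁ f` (for the original one), for all `f ∈ J`. -/
def nearSet (J : Finset (S → ℝ)) (P : Measure S) (β ε : ℝ) (d₂ d₁ : (S → ℝ) → ℝ) (n k : ℕ) :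
    Set ((Fin n → S) × (Fin k → S)) :=
  {w | ∀ f ∈ J, |avg w.2 f - avg w.1 f - β * d₂ f| ≤ ε * β ∧
    |avg w.1 f - ∫ x, f x ∂P - β * d₁ f| ≤ ε * β}

theorem measurableSet_nearSet {J : Finset (S → ℝ)} (hJ : ∀ f ∈ J, Measurable f) (P : Measure S)
    (β ε : ℝ) (d₂ d₁ : (S → ℝ) → ℝ) (n k : ℕ) : MeasurableSet (nearSet J P β ε d₂ d₁ n k) := by
  simp only [nearSet, Set.ofPred_forall]
  refine Finset.measurableSet_biInter J fun f hf => ?_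
  have measurable_avg_fst : Measurable fun w : (Fin n → S) × (Fin k → S) => avg w.1 f :=
    (measurable_avg (hJ f hf)).comp measurable_fst
  have measurable_avg_snd : Measurable fun w : (Fin n → S) × (Fin k → S) => avg w.2 f :=
    (measurable_avg (hJ f hf)).comp measurable_snd
  exact (measurableSet_le ((measurable_avg_snd.sub measurable_avg_fst).sub_const _).abs
    measurable_const).inter
    (measurableSet_le ((measurable_avg_fst.sub_const _).sub_const _).abs measurable_const)

section Approximation

variable {μ : Measure S} {f g : S → ℝ}

theorem tendsto_truncation {α : Type*} (g : α → ℝ) (x : α) :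
    Tendsto (fun n : ℕ => truncation g n x) atTop (𝓝 (g x)) := by
  refine tendsto_const_nhds.congr' ?_
  filter_upwards [tendsto_natCast_atTop_atTop.eventually_gt_atTop |g x|] with n hn
  exact (truncation_eq_self hn).symm

theorem tendsto_integral_mul_truncation (hf : MemLp f 2 μ) (hg : MemLp g 2 μ) :
    Tendsto (fun n : ℕ => ∫ x, f x * truncation g n x ∂μ) atTop (𝓝 (∫ x, f x * g x ∂μ)) := by
  refine tendsto_integral_of_dominated_convergence (fun x => |f x * g x|)
    (fun n => hf.aestronglyMeasurable.mul hg.aestronglyMeasurable.truncation)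
    (hf.integrable_mul hg).abs (fun n => Eventually.of_forall fun x => ?_)
    (Eventually.of_forall fun x => (tendsto_truncation g x).const_mul _)
  rw [Real.norm_eq_abs, abs_mul, abs_mul]
  exact mul_le_mul_of_nonneg_left (abs_truncation_le_abs_self g n x) (abs_nonneg _)

variable [IsProbabilityMeasure μ]

theorem tendsto_integral_mul_centered_truncation (hf : MemLp f 2 μ) (hg : MemLp g 2 μ)
    (h0 : ∫ x, g x ∂μ = 0) :
    Tendsto (fun n : ℕ => ∫ x, f x * (truncation g n x - ∫ y, truncation g n y ∂μ) ∂μ) atTop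
      (𝓝 (∫ x, f x * g x ∂μ)) := by
  have mean_tendsto : Tendsto (fun n : ℕ => ∫ x, truncation g n x ∂μ) atTop (𝓝 0) := by
    simpa only [one_mul, h0] using tendsto_integral_mul_truncation (memLp_const 1) hg
  have product_tendsto :=
    (tendsto_integral_mul_truncation hf hg).sub (mean_tendsto.const_mul (∫ x, f x ∂μ))
  rw [mul_zero, sub_zero] at product_tendsto
  refine product_tendsto.congr fun n => ?_
  have integrable_f : Integrable f μ := hf.integrable (by norm_num)
  have integrable_mul : Integrable (fun x => f x * truncation g n x) μ :=
    hf.integrable_mul (q := 2) hg.aestronglyMeasurable.memLp_truncation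
  simp only [mul_sub]
  rw [integral_sub integrable_mul (integrable_f.mul_const _), integral_mul_const]

theorem integral_sq_centered_truncation_le (hg : MemLp g 2 μ) (A : ℝ) :
    ∫ x, (truncation g A x - ∫ y, truncation g A y ∂μ) ^ 2 ∂μ ≤ ∫ x, g x ^ 2 ∂μ := by
  rw [← variance_eq_integral hg.aestronglyMeasurable.truncation.aemeasurable]
  refine (variance_le_expectation_sq hg.aestronglyMeasurable.truncation).trans ?_
  exact integral_mono_of_nonneg (Eventually.of_forall fun x => sq_nonneg _) hg.integrable_sq
    (Eventually.of_forall fun x => sq_le_sq.2 (abs_truncation_le_abs_self g A x))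

theorem exists_bounded_approx (hg : Measurable g) (hgL : MemLp g 2 μ) (h0 : ∫ x, g x ∂μ = 0)
    (J : Finset (S → ℝ)) (hJ : ∀ f ∈ J, MemLp f 2 μ) {δ : ℝ} (hδ : 0 < δ) :
    ∃ g' : S → ℝ, Measurable g' ∧ (∃ M, ∀ x, |g' x| ≤ M) ∧ ∫ x, g' x ∂μ = 0 ∧
      ∫ x, g' x ^ 2 ∂μ ≤ ∫ x, g x ^ 2 ∂μ ∧
      ∀ f ∈ J, |∫ x, f x * g' x ∂μ - ∫ x, f x * g x ∂μ| < δ := by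
  obtain ⟨n, close⟩ : ∃ n : ℕ, ∀ f ∈ J,
      |∫ x, f x * (truncation g n x - ∫ y, truncation g n y ∂μ) ∂μ - ∫ x, f x * g x ∂μ| < δ :=
    ((eventually_all_finset J).2 fun f hf => Metric.tendsto_nhds.1
      (tendsto_integral_mul_centered_truncation (hJ f hf) hgL h0) δ hδ).exists
  refine ⟨fun x => truncation g n x - ∫ y, truncation g n y ∂μ,
    ((measurable_id.indicator measurableSet_Ioc).comp hg).sub_const _,
    ⟨|(n : ℝ)| + |∫ y, truncation g n y ∂μ|, fun x => (abs_sub _ _).trans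
      (add_le_add (abs_truncation_le_bound g n x) le_rfl)⟩,
    ?_, integral_sq_centered_truncation_le hgL n, close⟩
  rw [integral_sub hgL.aestronglyMeasurable.integrable_truncation (integrable_const _)]
  simp

end Approximation

section Topology

variable {Φ : Set (S → ℝ)}

theorem exists_finset_of_mem_nhds {G₀ : Lambda0 Φ} {U : Set (Lambda0 Φ)} (hU : U ∈ 𝓝 G₀) :
    ∃ J : Finset (S → ℝ), (∀ f ∈ J, f ∈ Φ) ∧ ∃ ε > 0, ∀ G : Lambda0 Φ,
      (∀ f ∈ J, |sint (G : SignedMeasure S) f - sint (G₀ : SignedMeasure S) f| < ε) → G ∈ U := by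
  classical
  rw [nhds_induced, nhds_pi] at hU
  obtain ⟨⟨I, r⟩, ⟨hI, hr⟩, ball_subset⟩ :=
    ((hasBasis_pi fun f : Φ => Metric.nhds_basis_ball (x := pairing Φ G₀ f)).comap
      (pairing Φ)).mem_iff.1 hU
  obtain ⟨ε, hε, ε_le⟩ : ∃ ε > 0, ∀ f ∈ I, ε ≤ r f := by
    rcases I.eq_empty_or_nonempty with rfl | I_nonempty
    · exact ⟨1, one_pos, by simp⟩
    · obtain ⟨f₀, hf₀, hmin⟩ := Set.exists_min_image I r hI I_nonempty
      exact ⟨r f₀, hr f₀ hf₀, hmin⟩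
  refine ⟨hI.toFinset.image Subtype.val, fun f hf => ?_, ε, hε,
    fun G hG => ball_subset fun f hf => ?_⟩
  · obtain ⟨f', _, rfl⟩ := Finset.mem_image.1 hf
    exact f'.2
  · exact (hG f (Finset.mem_image_of_mem _ (hI.mem_toFinset.2 hf))).trans_le (ε_le f hf)

theorem exists_finset_of_mem_nhds_prod {G₀ : Lambda0 Φ × Lambda0 Φ}
    {U : Set (Lambda0 Φ × Lambda0 Φ)} (hU : U ∈ 𝓝 G₀) :
    ∃ J : Finset (S → ℝ), (∀ f ∈ J, f ∈ Φ) ∧ ∃ ε > 0, ∀ G : Lambda0 Φ × Lambda0 Φ,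
      (∀ f ∈ J, |sint (G.1 : SignedMeasure S) f - sint (G₀.1 : SignedMeasure S) f| < ε ∧
        |sint (G.2 : SignedMeasure S) f - sint (G₀.2 : SignedMeasure S) f| < ε) → G ∈ U := by
  classical
  obtain ⟨U₂, hU₂, U₁, hU₁, prod_subset⟩ := mem_nhds_prod_iff.1 hU
  obtain ⟨J₂, hJ₂, ε₂, hε₂, near₂⟩ := exists_finset_of_mem_nhds hU₂
  obtain ⟨J₁, hJ₁, ε₁, hε₁, near₁⟩ := exists_finset_of_mem_nhds hU₁
  refine ⟨J₂ ∪ J₁, fun f hf => (Finset.mem_union.1 hf).elim (hJ₂ f) (hJ₁ f), min ε₂ ε₁,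
    lt_min hε₂ hε₁, fun G hG => prod_subset ⟨near₂ _ fun f hf => ?_, near₁ _ fun f hf => ?_⟩⟩
  · exact (hG f (Finset.mem_union_left _ hf)).1.trans_le (min_le_left _ _)
  · exact (hG f (Finset.mem_union_right _ hf)).2.trans_le (min_le_right _ _)

theorem exists_finset_of_mem_interior_image_sub {H : Lambda0 Φ} {Ω : Set (Lambda0 Φ × Lambda0 Φ)}
    {G : Lambda0 Φ × Lambda0 Φ} (hG : G ∈ interior ((fun G => G - (0, H)) '' Ω)) :
    ∃ J : Finset (S → ℝ), (∀ f ∈ J, f ∈ Φ) ∧ ∃ ε > 0, ∀ G' : Lambda0 Φ × Lambda0 Φ,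
      (∀ f ∈ J, |sint (G'.1 : SignedMeasure S) f - sint (G.1 : SignedMeasure S) f| < ε ∧
        |sint (G'.2 : SignedMeasure S) f
          - (sint (H : SignedMeasure S) f + sint (G.2 : SignedMeasure S) f)| < ε) → G' ∈ Ω := by
  obtain ⟨J, hJ, ε, hε, near⟩ := exists_finset_of_mem_nhds_prod (mem_interior_iff_mem_nhds.1 hG)
  refine ⟨J, hJ, ε, hε, fun G' hG' => ?_⟩
  obtain ⟨G'', hG'', heq⟩ := near (G' - (0, H)) fun f hf => by
    have fst_eq : (G' - (0, H)).1 = G'.1 := sub_zero G'.1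
    have sint_snd : sint ((G' - (0, H)).2 : SignedMeasure S) f
        = sint (G'.2 : SignedMeasure S) f - sint (H : SignedMeasure S) f :=
      sint_sub_left (G'.2.2.2 f (hJ f hf)) (H.2.2 f (hJ f hf))
    rw [fst_eq, sint_snd, sub_sub]
    exact hG' f hf
  rwa [← sub_left_injective (b := ((0 : Lambda0 Φ), H)) heq]

theorem exists_Lambda0_of_sub {μ₂ μ₁ : Measure S} [IsProbabilityMeasure μ₂]
    [IsProbabilityMeasure μ₁] (h₂ : ∀ f ∈ Φ, Integrable f μ₂) (h₁ : ∀ f ∈ Φ, Integrable f μ₁)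
    {β : ℝ} (hβ : β ≠ 0) :
    ∃ G : Lambda0 Φ, μ₂.toSignedMeasure - μ₁.toSignedMeasure = β • (G : SignedMeasure S) := by
  have sub_mem : μ₂.toSignedMeasure - μ₁.toSignedMeasure ∈ Lambda0 Φ := by
    refine ⟨by simp, fun f hf => ?_⟩
    have i₂ : Integrable f μ₂.toSignedMeasure.variation := by simpa using h₂ f hf
    have i₁ : Integrable f μ₁.toSignedMeasure.variation := by simpa using h₁ f hf
    exact VectorMeasure.Integrable.sub_vectorMeasure i₂ i₁
  exact ⟨β⁻¹ • ⟨_, sub_mem⟩, by simp [smul_smul, hβ]⟩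

end Topology

theorem abs_sint_sub_le {μ₂ μ₁ : Measure S} [IsFiniteMeasure μ₂] [IsFiniteMeasure μ₁]
    {G : SignedMeasure S} {β : ℝ} (hβ : 0 < β)
    (h : μ₂.toSignedMeasure - μ₁.toSignedMeasure = β • G) {f : S → ℝ}
    (h₂ : Integrable f μ₂) (h₁ : Integrable f μ₁) {d ε : ℝ}
    (hd : |∫ x, f x ∂μ₂ - ∫ x, f x ∂μ₁ - β * d| ≤ ε * β) : |sint G f - d| ≤ ε := by
  rw [← mul_sint_of_sub_eq h h₂ h₁, ← mul_sub, abs_mul, abs_of_pos hβ, mul_comm] at hd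
  exact le_of_mul_le_mul_right hd hβ

theorem exists_density_of_rho0sq_ne_top {P : ProbabilityMeasure S} {G : SignedMeasure S}
    (h : rho0sq G P ≠ ⊤) : ∃ g : S → ℝ, Measurable g ∧ MemLp g 2 (P : Measure S) ∧
      G = (P : Measure S).withDensityᵥ g := by
  have hac : G ≪ᵥ (P : Measure S).toENNRealVectorMeasure := by
    by_contra hac
    exact h (if_neg hac)
  rw [rho0sq, if_pos hac] at h
  have measurable_rnDeriv := SignedMeasure.measurable_rnDeriv G (P : Measure S)
  refine ⟨G.rnDeriv (P : Measure S), measurable_rnDeriv, ?_,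
    (SignedMeasure.withDensityᵥ_rnDeriv_eq _ _ hac).symm⟩
  rw [memLp_two_iff_integrable_sq measurable_rnDeriv.aestronglyMeasurable]
  refine ⟨(measurable_rnDeriv.pow_const 2).aestronglyMeasurable, ?_⟩
  rw [hasFiniteIntegral_iff_ofReal (Eventually.of_forall fun x => sq_nonneg _)]
  refine lt_top_iff_ne_top.2 fun htop => h ?_
  rw [htop]
  exact ENNReal.mul_top (by simp)

section LowerBound

variable {P : ProbabilityMeasure S} {b : ℕ → ℝ} {Pn : ℕ → ProbabilityMeasure S}
  {Hn : ℕ → Lambda0 (Phi P b)} {H : Lambda0 (Phi P b)} {k : ℕ → ℕ} {ν : ℝ}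

theorem exists_density_of_rho0bsq_lt (hν : 0 < ν) {Φ : Set (S → ℝ)} {G : Lambda0 Φ × Lambda0 Φ}
    {I : ℝ} (hI : rho0bsq ν P G < ENNReal.ofReal I) :
    ∃ g₂ g₁ : S → ℝ, (Measurable g₂ ∧ MemLp g₂ 2 (P : Measure S) ∧
        (G.1 : SignedMeasure S) = (P : Measure S).withDensityᵥ g₂) ∧
      (Measurable g₁ ∧ MemLp g₁ 2 (P : Measure S) ∧
        (G.2 : SignedMeasure S) = (P : Measure S).withDensityᵥ g₁) ∧
      ν * ((∫ x, g₂ x ^ 2 ∂(P : Measure S)) / 2) + (∫ x, g₁ x ^ 2 ∂(P : Measure S)) / 2 < I := by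
  have sum_ne_top : ENNReal.ofReal ν * rho0sq (G.1 : SignedMeasure S) P
      + rho0sq (G.2 : SignedMeasure S) P ≠ ⊤ := (hI.trans ENNReal.ofReal_lt_top).ne
  obtain ⟨mul_ne_top, ne_top₁⟩ := ENNReal.add_ne_top.1 sum_ne_top
  have ne_top₂ : rho0sq (G.1 : SignedMeasure S) P ≠ ⊤ := fun htop =>
    mul_ne_top (by rw [htop, ENNReal.mul_top (by simpa using hν)])
  obtain ⟨g₂, hg₂, hL₂, hd₂⟩ := exists_density_of_rho0sq_ne_top ne_top₂
  obtain ⟨g₁, hg₁, hL₁, hd₁⟩ := exists_density_of_rho0sq_ne_top ne_top₁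
  rw [rho0bsq_eq hν hL₂ hL₁ hd₂ hd₁] at hI
  have rate_lt := (ENNReal.ofReal_lt_ofReal_iff_of_nonneg (by positivity)).1 hI
  exact ⟨g₂, g₁, ⟨hg₂, hL₂, hd₂⟩, ⟨hg₁, hL₁, hd₁⟩, by linarith⟩

theorem exists_bounded_approx_sint (hb : Normalizing b) {G : Lambda0 (Phi P b)} {g : S → ℝ}
    (hg : Measurable g ∧ MemLp g 2 (P : Measure S) ∧
      (G : SignedMeasure S) = (P : Measure S).withDensityᵥ g)
    {J : Finset (S → ℝ)} (hJ : ∀ f ∈ J, f ∈ Phi P b) {δ : ℝ} (hδ : 0 < δ) :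
    ∃ g' : S → ℝ, Measurable g' ∧ (∃ M, ∀ x, |g' x| ≤ M) ∧ ∫ x, g' x ∂(P : Measure S) = 0 ∧
      ∫ x, g' x ^ 2 ∂(P : Measure S) ≤ ∫ x, g x ^ 2 ∂(P : Measure S) ∧
      ∀ f ∈ J, |∫ x, f x * g' x ∂(P : Measure S) - sint (G : SignedMeasure S) f| < δ := by
  obtain ⟨hgm, hgL, hGg⟩ := hg
  have integrable_g : Integrable g (P : Measure S) := hgL.integrable (by norm_num)
  have mean_zero : ∫ x, g x ∂(P : Measure S) = 0 := by
    have total_mass := G.2.1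
    rw [hGg, withDensityᵥ_apply integrable_g MeasurableSet.univ] at total_mass
    simpa using total_mass
  have memLp : ∀ f ∈ J, MemLp f 2 (P : Measure S) := fun f hf =>
    ((mem_Phi_iff hb).1 (hJ f hf)).2.1
  obtain ⟨g', hg', bdd, mean_zero', sq_le, close⟩ :=
    exists_bounded_approx hgm hgL mean_zero J memLp hδ
  refine ⟨g', hg', bdd, mean_zero', sq_le, fun f hf => ?_⟩
  rw [hGg, sint_withDensity integrable_g ((mem_Phi_iff hb).1 (hJ f hf)).1
    ((memLp f hf).integrable_mul hgL)]
  exact close f hf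

theorem le_sampleLaw_nearSet (hb : Normalizing b) (hA : LocalAlternatives P b Pn Hn H)
    (hν : 0 < ν) (hk : Tendsto (fun n : ℕ => (k n : ℝ) / (n : ℝ)) atTop (𝓝 ν))
    {J : Finset (S → ℝ)} (hJ : ∀ f ∈ J, f ∈ Phi P b) {g₂ g₁ : S → ℝ} {M₂ M₁ : ℝ}
    (hg₂ : Measurable g₂) (hM₂ : ∀ x, |g₂ x| ≤ M₂) (h₂ : ∫ x, g₂ x ∂(P : Measure S) = 0)
    (hg₁ : Measurable g₁) (hM₁ : ∀ x, |g₁ x| ≤ M₁) (h₁ : ∫ x, g₁ x ∂(P : Measure S) = 0)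
    {I ε : ℝ} (hε : 0 < ε) (hI : ν * ((∫ x, g₂ x ^ 2 ∂(P : Measure S)) / 2)
      + (∫ x, g₁ x ^ 2 ∂(P : Measure S)) / 2 < I) :
    ∀ᶠ n : ℕ in atTop, ENNReal.ofReal (Real.exp (n * b n ^ 2 * (-I)))
      ≤ sampleLaw (Pn n) n (k n) (nearSet J P (b n) ε
        (fun f => ∫ x, f x * g₂ x ∂(P : Measure S))
        (fun f => sint (H : SignedMeasure S) f + ∫ x, f x * g₁ x ∂(P : Measure S)) n (k n)) := by
  obtain ⟨F, hF, hF1, hJF⟩ := exists_dominating_mem_Phi hb J hJ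
  have h := hA.regularArray hb hF hF1
  have hJm : ∀ f ∈ J, Measurable f := fun f hf => ((mem_Phi_iff hb).1 (hJ f hf)).1
  obtain ⟨η, hη, hηε, hηI⟩ := exists_pos_rate_lt hI hε
  have sample := h.le_pi_sample J hJm hJF (D := fun f => sint (H : SignedMeasure S) f)
    (fun f hf => hA.tendsto_drift hb hF (fun x => zero_le_one.trans (hF1 x)) (hJm f hf) one_pos
      (by simpa using hJF f hf)) hg₁ hM₁ h₁ hη
  have bootstrap := h.le_pi_bootstrap hν hk J hJm hJF hg₂ hM₂ h₂ hη
  have eventually_pos := (tendsto_fst_superexp (fun n => (Pn n : Measure S))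
    h.normalizing).eventually hb.eventually_pos
  have two_stage := le_sampleLaw hb (fun n => measurableSet_nearSet hJm P (b n) ε
      (fun f => ∫ x, f x * g₂ x ∂(P : Measure S))
      (fun f => sint (H : SignedMeasure S) f + ∫ x, f x * g₁ x ∂(P : Measure S)) n (k n))
    (p := fun n => ENNReal.ofReal (Real.exp
      (-(k n * b n ^ 2 * ((∫ x, g₂ x ^ 2 ∂(P : Measure S)) / 2 + η))))) hη sample (by
    filter_upwards [bootstrap, h.eventually_trunc, eventually_pos] with w le_pi trunc hβ hw
    refine le_pi.trans (measure_mono fun y hy f hf =>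
      ⟨(hy f hf).trans (by gcongr), le_trans ?_ ((hw f hf).trans (by gcongr))⟩)
    rw [avg_congr (g := f) fun i => Set.indicator_of_mem (s := {x | F x ≤ (b w.1)⁻¹}) (trunc i) f])
  filter_upwards [two_stage, eventually_exp_neg_le_mul (b := b) hk (by positivity) hη
    hηI.le] with n le_sampleLaw exp_le
  exact exp_le.trans le_sampleLaw

theorem nearSet_subset_deviationEvent (hb : Normalizing b) {J : Finset (S → ℝ)}
    (hJ : ∀ f ∈ J, f ∈ Phi P b) {β ε : ℝ} (hβ : 0 < β) {d₂ d₁ : (S → ℝ) → ℝ} {n k : ℕ}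
    (hn : 1 ≤ n) (hk : 1 ≤ k) {Ω : Set (Lambda0 (Phi P b) × Lambda0 (Phi P b))}
    (hΩ : ∀ G : Lambda0 (Phi P b) × Lambda0 (Phi P b),
      (∀ f ∈ J, |sint (G.1 : SignedMeasure S) f - d₂ f| ≤ ε ∧
        |sint (G.2 : SignedMeasure S) f - d₁ f| ≤ ε) → G ∈ Ω) :
    nearSet J (P : Measure S) β ε d₂ d₁ n k ⊆ deviationEvent P β Ω n k := by
  intro w hw
  have : NeZero n := ⟨by omega⟩
  have : NeZero k := ⟨by omega⟩
  have measurable_of_mem : ∀ f ∈ Phi P b, Measurable f := fun f hf => ((mem_Phi_iff hb).1 hf).1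
  obtain ⟨G₂, hG₂⟩ := exists_Lambda0_of_sub (Φ := Phi P b)
    (fun f hf => integrable_empirical w.2 (measurable_of_mem f hf))
    (fun f hf => integrable_empirical w.1 (measurable_of_mem f hf)) hβ.ne'
  obtain ⟨G₁, hG₁⟩ := exists_Lambda0_of_sub (Φ := Phi P b)
    (fun f hf => integrable_empirical w.1 (measurable_of_mem f hf))
    (fun f hf => integrable_of_mem_Phi hb hf) hβ.ne'
  refine ⟨(G₂, G₁), hΩ _ fun f hf => ?_, hG₂, hG₁⟩
  have hfm := measurable_of_mem f (hJ f hf)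
  obtain ⟨near₂, near₁⟩ := hw f hf
  simp only [← integral_empirical _ hfm] at near₂ near₁
  exact ⟨abs_sint_sub_le hβ hG₂ (integrable_empirical _ hfm) (integrable_empirical _ hfm) near₂,
    abs_sint_sub_le hβ hG₁ (integrable_empirical _ hfm) (integrable_of_mem_Phi hb (hJ f hf)) near₁⟩

theorem eventually_le_sampleLaw (hb : Normalizing b) (hA : LocalAlternatives P b Pn Hn H)
    (hν : 0 < ν) (hk : Tendsto (fun n : ℕ => (k n : ℝ) / (n : ℝ)) atTop (𝓝 ν))
    {Ω : Set (Lambda0 (Phi P b) × Lambda0 (Phi P b))} {G : Lambda0 (Phi P b) × Lambda0 (Phi P b)}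
    (hG : G ∈ interior ((fun G => G - (0, H)) '' Ω)) {I : ℝ}
    (hI : rho0bsq ν P G < ENNReal.ofReal I) :
    ∀ᶠ n : ℕ in atTop, ENNReal.ofReal (Real.exp (n * b n ^ 2 * (-I)))
      ≤ sampleLaw (Pn n) n (k n) (deviationEvent P (b n) Ω n (k n)) := by
  obtain ⟨g₂, g₁, density₂, density₁, rate_lt⟩ := exists_density_of_rho0bsq_lt hν hI
  obtain ⟨J, hJ, ε, hε, near⟩ := exists_finset_of_mem_interior_image_sub hG
  obtain ⟨g₂', hg₂', ⟨M₂, hM₂⟩, mean₂, sq_le₂, close₂⟩ :=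
    exists_bounded_approx_sint hb density₂ hJ (half_pos hε)
  obtain ⟨g₁', hg₁', ⟨M₁, hM₁⟩, mean₁, sq_le₁, close₁⟩ :=
    exists_bounded_approx_sint hb density₁ hJ (half_pos hε)
  have rate_lt' : ν * ((∫ x, g₂' x ^ 2 ∂(P : Measure S)) / 2)
      + (∫ x, g₁' x ^ 2 ∂(P : Measure S)) / 2 < I :=
    lt_of_le_of_lt (by gcongr) rate_lt
  filter_upwards [le_sampleLaw_nearSet hb hA hν hk hJ hg₂' hM₂ mean₂ hg₁' hM₁ mean₁ (half_pos hε)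
    rate_lt', hb.eventually_pos, eventually_one_le_of_tendsto_div hν hk, eventually_ge_atTop 1]
    with n le_nearSet hβ hkn hn
  refine le_nearSet.trans (measure_mono (nearSet_subset_deviationEvent hb hJ hβ hn hkn
    fun G' hG' => near G' fun f hf => ?_))
  obtain ⟨near₂, near₁⟩ := hG' f hf
  have approx₂ := abs_lt.1 (close₂ f hf)
  have approx₁ := abs_lt.1 (close₁ f hf)
  rw [abs_le] at near₂ near₁
  rw [abs_lt, abs_lt]
  refine ⟨⟨?_, ?_⟩, ?_, ?_⟩ <;> linarith

theorem le_liminf_scaledLog (hb : Normalizing b) (hA : LocalAlternatives P b Pn Hn H)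
    (hν : 0 < ν) (hk : Tendsto (fun n : ℕ => (k n : ℝ) / (n : ℝ)) atTop (𝓝 ν))
    (Ω : Set (Lambda0 (Phi P b) × Lambda0 (Phi P b))) :
    -((rho0bsqSet ν P (interior ((fun G => G - (0, H)) '' Ω)) : ℝ≥0∞) : EReal)
      ≤ liminf (fun n : ℕ => scaledLog n (b n) (sampleLaw (Pn n) n (k n)
        (deviationEvent P (b n) Ω n (k n)))) atTop := by
  rw [← EReal.ge_of_forall_gt_iff_ge]
  intro z hz
  rw [EReal.lt_neg_comm, ← EReal.coe_neg] at hz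
  have neg_nonneg : 0 ≤ -z := EReal.coe_nonneg.1 ((EReal.coe_ennreal_nonneg _).trans hz.le)
  have rate_lt : rho0bsqSet ν P (interior ((fun G => G - (0, H)) '' Ω))
      < ENNReal.ofReal (-z) := by
    rwa [← EReal.coe_ennreal_lt_coe_ennreal_iff, EReal.coe_ennreal_ofReal, max_eq_left neg_nonneg]
  obtain ⟨G, hG, hGz⟩ : ∃ G ∈ interior ((fun G => G - (0, H)) '' Ω),
      rho0bsq ν P G < ENNReal.ofReal (-z) := by
    simpa only [rho0bsqSet, iInf_lt_iff, exists_prop] using rate_lt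
  refine le_liminf_of_le (by isBoundedDefault) ?_
  filter_upwards [eventually_le_sampleLaw hb hA hν hk hG hGz, hb.eventually_speed_pos]
    with n le_event hspeed
  rw [le_scaledLog_iff hspeed]
  simpa using le_event

end LowerBound

end BootstrapMDP

end

theorem mainTheorem2_general {S : Type*} [MeasurableSpace S]
    {P : ProbabilityMeasure S} {b : ℕ → ℝ} (hb : BootstrapMDP.Normalizing b)
    {k : ℕ → ℕ} {ν : ℝ} (hν : 0 < ν)
    (hk : Tendsto (fun n : ℕ => (k n : ℝ) / (n : ℝ)) atTop (𝓝 ν))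
    {Pn : ℕ → ProbabilityMeasure S}
    {Hn : ℕ → BootstrapMDP.Lambda0 (BootstrapMDP.Phi P b)}
    {H : BootstrapMDP.Lambda0 (BootstrapMDP.Phi P b)}
    (hA : BootstrapMDP.LocalAlternatives P b Pn Hn H)
    (Ω : Set (BootstrapMDP.Lambda0 (BootstrapMDP.Phi P b) ×
      BootstrapMDP.Lambda0 (BootstrapMDP.Phi P b))) :
    -((BootstrapMDP.rho0bsqSet ν P (interior ((fun G => G - (0, H)) '' Ω)) : ℝ≥0∞) : EReal)
        ≤ liminf (fun n : ℕ => BootstrapMDP.scaledLog n (b n)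
            (BootstrapMDP.sampleLaw (Pn n) n (k n)
              (BootstrapMDP.deviationEvent P (b n) Ω n (k n)))) atTop ∧
    limsup (fun n : ℕ => BootstrapMDP.scaledLog n (b n)
            (BootstrapMDP.sampleLaw (Pn n) n (k n)
              (BootstrapMDP.deviationEvent P (b n) Ω n (k n)))) atTop
        ≤ -((BootstrapMDP.rho0bsqSet ν P (closure ((fun G => G - (0, H)) '' Ω)) : ℝ≥0∞) : EReal) :=
  ⟨BootstrapMDP.le_liminf_scaledLog hb hA hν hk Ω, BootstrapMDP.limsup_scaledLog_le hb hA hν hk Ω⟩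

theorem mainTheorem2 {S : Type*} [MeasurableSpace S]
    (P : ProbabilityMeasure S)
    (b : ℕ → ℝ) (hb_pos : ∀ n, 1 ≤ n → 0 < b n)
    (hb_zero : Tendsto b atTop (𝓝 0))
    (hb_speed : Tendsto (fun n : ℕ => (n : ℝ) * b n ^ 2) atTop atTop)
    (hb_ratio : Tendsto (fun n : ℕ => b n / b (n + 1)) atTop (𝓝 1))
    (k : ℕ → ℕ) (ν : ℝ) (hν : 0 < ν)
    (hk : Tendsto (fun n : ℕ => (k n : ℝ) / (n : ℝ)) atTop (𝓝 ν))
    (Pn : ℕ → ProbabilityMeasure S)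
    (Hn : ℕ → BootstrapMDP.Lambda0 (BootstrapMDP.Phi P b))
    (H : BootstrapMDP.Lambda0 (BootstrapMDP.Phi P b))
    (hA : BootstrapMDP.AssumptionA P b Pn Hn H)
    (hB1 : BootstrapMDP.AssumptionB1 P b Hn)
    (Ω : Set (BootstrapMDP.Lambda0 (BootstrapMDP.Phi P b) ×
      BootstrapMDP.Lambda0 (BootstrapMDP.Phi P b)))
    (hΩ : MeasurableSet Ω) :
    -((BootstrapMDP.rho0bsqSet ν P (interior ((fun G => G - (0, H)) '' Ω)) : ℝ≥0∞) : EReal)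
        ≤ liminf (fun n : ℕ => BootstrapMDP.scaledLog n (b n)
            (BootstrapMDP.sampleLaw (Pn n) n (k n)
              (BootstrapMDP.deviationEvent P (b n) Ω n (k n)))) atTop ∧
    limsup (fun n : ℕ => BootstrapMDP.scaledLog n (b n)
            (BootstrapMDP.sampleLaw (Pn n) n (k n)
              (BootstrapMDP.deviationEvent P (b n) Ω n (k n)))) atTop
        ≤ -((BootstrapMDP.rho0bsqSet ν P (closure ((fun G => G - (0, H)) '' Ω)) : ℝ≥0∞) : EReal) := by
  have hb : BootstrapMDP.Normalizing b := ⟨hb_pos, hb_zero, hb_speed⟩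
  exact mainTheorem2_general hb hν hk (.of_assumptions hb hA hB1) Ω
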